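/- Let $L>0$ and let $\mathbb{T}^2=(\mathbb{R}/L\mathbb{Z})^2$ be the flat two-dimensional torus. For $k\in\mathbb{N}_0$ let $W^{k,2}(\mathbb{T}^2)$ be the space of real functions in $L^2(\mathbb{T}^2)$ whose weak derivatives up to order $k$ lie in $L^2(\mathbb{T}^2)$, with norm $\|v\|_{k,2}=\sum_{|\beta|\le k}\|\partial^\beta v\|_{L^2}$, and let $W^{k,2}_{\mathrm{div}}(\mathbb{T}^2;\mathbb{R}^2)$ be the space of weakly divergence-free vector fields with components in $W^{k,2}(\mathbb{T}^2)$. Put $\mathcal{M}=W^{3,2}(\mathbb{T}^2)\times W^{2,2}(\mathbb{T}^2)$ with $\|(b,\omega)\|_{\mathcal{M}}=\|b\|_{3,2}+\|\omega\|_{2,2}$. Let $\mathbf{u}_h\in W^{3,2}_{\mathrm{div}}(\mathbb{T}^2;\mathbb{R}^2)$, $f\in W^{2,2}(\mathbb{T}^2)$ and $(b_0,\omega_0)\in\mathcal{M}$. The thermal quasi-geostrophic (TQG) system is $$\partial_t b+\mathbf{u}\cdot\nabla b=0,\qquad \partial_t\omega+\mathbf{u}\cdot\nabla(\omega-b)=-\mathbf{u}_h\cdot\nabla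 b,\qquad \mathbf{u}=\nabla^\perp\psi=(-\partial_y\psi,\partial_x\psi),\qquad \omega=(\Delta-1)\psi+f .$$ For $T>0$, $(b,\omega,T)$ is a local strong solution with initial condition $(b_0,\omega_0)$ if $b\in C([0,T];W^{3,2}(\mathbb{T}^2))$, $\omega\in C([0,T];W^{2,2}(\mathbb{T}^2))$ and, for all $t\in[0,T]$, $$b(t)=b_0-\int_0^t\mathrm{div}(b\mathbf{u})\,d\tau,\qquad \omega(t)=\omega_0-\int_0^t\big[\mathrm{div}((\omega-b)\mathbf{u})+\mathrm{div}(b\mathbf{u}_h)\big]\,d\tau ,$$ where $\mathbf{u}$ is determined by $\omega$ and $f$ as above. $(b,\omega,T_{\max})$ with $T_{\max}\in(0,\infty]$ is a maximal solution if there is an increasing sequence $(T_n)_{n\in\mathbb{N}}$ with limit $T_{\max}$ such that $(b,\omega,T_n)$ is a local strong solution with initial condition $(b_0,\omega_0)$ for every $n$ and, if $T_{\max}<\infty$, $\limsup_{n\to\infty}\|(b,\omega)(T_n)\|_{\mathcal{M}}^2=\infty$. Theorem (existence of a maximal solution). There exists a unique maximal solution $(b,\omega,T_{\max})$ of the TQG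 system with initial condition $(b_0,\omega_0)$: a maximal solution exists, and any two maximal solutions have the same maximal time $T_{\max}$ and coincide on $[0,T_{\max})$. -/

import Mathlib

open MeasureTheory Filter Topology

namespace TQG

/-- The flat two-dimensional torus `(ℝ / Lℤ)²`. Its `volume` is Lebesgue measure, of mass `L²`. -/
abbrev Torus (L : ℝ) : Type := Fin 2 → AddCircle L

/-- Real-valued square-integrable functions on the torus, modulo equality almost everywhere. -/
noncomputable abbrev L2 (L : ℝ) [Fact (0 < L)] : Type :=
  Lp ℝ 2 (volume : Measure (Torus L))

/-- Smooth functions on the torus: those whose periodic lift to `ℝ²` is smooth. -/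
def IsTest {L : ℝ} (φ : Torus L → ℝ) : Prop :=
  ContDiff ℝ ((⊤ : ℕ∞) : WithTop ℕ∞) fun x : Fin 2 → ℝ => φ fun i => (x i : AddCircle L)

/-- The classical partial derivative in the direction of the `i`-th coordinate. -/
noncomputable def pderiv {L : ℝ} (i : Fin 2) (φ : Torus L → ℝ) (x : Torus L) : ℝ :=
  deriv (fun s : ℝ => φ (x + Pi.single i (s : AddCircle L))) 0

/-- The classical derivative `∂^β = ∂₀^{β₁} ∂₁^{β₂}` for a multi-index `β = (β₁, β₂)`. -/
noncomputable def mderiv {L : ℝ} (β : ℕ × ℕ) (φ : Torus L → ℝ) : Torus L → ℝ :=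
  (pderiv 0)^[β.1] ((pderiv 1)^[β.2] φ)

section

variable {L : ℝ} [Fact (0 < L)]

/-- `v` is the weak derivative `∂^β u`. -/
def HasWeakDeriv (β : ℕ × ℕ) (u v : L2 L) : Prop :=
  ∀ φ : Torus L → ℝ, IsTest φ →
    ∫ x, u x * mderiv β φ x = (-1) ^ (β.1 + β.2) * ∫ x, v x * φ x

/-- `v` is the weak divergence of the vector field `g`. -/
def HasWeakDiv (g : Fin 2 → Torus L → ℝ) (v : L2 L) : Prop :=
  ∀ φ : Torus L → ℝ, IsTest φ →
    ∫ x, ∑ i, g i x * pderiv i φ x = -∫ x, v x * φ x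

/-- Membership in the Sobolev space `W^{k,2}` of the torus. -/
def MemSobolev (k : ℕ) (u : L2 L) : Prop :=
  ∀ β : ℕ × ℕ, β.1 + β.2 ≤ k → ∃ v : L2 L, HasWeakDeriv β u v

open Classical in
/-- The weak derivative `∂^β u` (zero if there is none in `L²`). -/
noncomputable def weakDeriv (β : ℕ × ℕ) (u : L2 L) : L2 L :=
  if h : ∃ v : L2 L, HasWeakDeriv β u v then h.choose else 0

/-- The norm `∑_{|β| ≤ k} ‖∂^β u‖_{L²}` of `W^{k,2}`. -/
noncomputable def sobolevNorm (k : ℕ) (u : L2 L) : ℝ :=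
  ∑ n ∈ Finset.range (k + 1), ∑ β ∈ Finset.HasAntidiagonal.antidiagonal n, ‖weakDeriv β u‖

/-- The norm of `W^{3,2} × W^{2,2}`. -/
noncomputable def normM (b ω : L2 L) : ℝ :=
  sobolevNorm 3 b + sobolevNorm 2 ω

/-- Weakly divergence-free vector fields with components in `W^{k,2}`. -/
def MemSobolevDiv (k : ℕ) (v : Fin 2 → L2 L) : Prop :=
  (∀ i, MemSobolev k (v i)) ∧ HasWeakDiv (fun i x => v i x) 0

/-- The restriction of `b` to `[0, T]` belongs to `C([0, T]; W^{k,2})`. -/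
def ContinuousInSobolev (k : ℕ) (T : ℝ) (b : ℝ → L2 L) : Prop :=
  (∀ t ∈ Set.Icc 0 T, MemSobolev k (b t)) ∧
    ∀ t ∈ Set.Icc 0 T,
      Tendsto (fun s => sobolevNorm k (b s - b t)) (𝓝[Set.Icc 0 T] t) (𝓝 0)

/-- `u = ∇^⊥ ψ = (-∂_y ψ, ∂_x ψ)`, where the stream function `ψ` is the (unique) weak solution of
`(Δ - 1) ψ = ω - f` on the torus. -/
def IsVelocity (f ω : L2 L) (u : Fin 2 → L2 L) : Prop :=
  ∃ ψ : L2 L,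
    (∀ φ : Torus L → ℝ, IsTest φ →
      ∫ x, ψ x * (mderiv (2, 0) φ x + mderiv (0, 2) φ x - φ x) = ∫ x, (ω x - f x) * φ x) ∧
    HasWeakDeriv (0, 1) ψ (-u 0) ∧ HasWeakDeriv (1, 0) ψ (u 1)

/-- `(b, ω, T)` is a local strong solution of the thermal quasi-geostrophic system with data
`uh`, `f` and initial state `(b₀, ω₀)`. Here `u` is the velocity field, and `Db`, `Dω`, `Dh` are
`div (b u)`, `div ((ω - b) u)`, `div (b uh)`; they are determined by `b`, `ω`, `f`, `uh`
on `[0, T]`. The time integrals are Bochner integrals in `L²`. -/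
def IsLocalSolution (uh : Fin 2 → L2 L) (f b₀ ω₀ : L2 L) (b ω : ℝ → L2 L) (T : ℝ) : Prop :=
  0 < T ∧ ContinuousInSobolev 3 T b ∧ ContinuousInSobolev 2 T ω ∧
    ∃ (u : ℝ → Fin 2 → L2 L) (Db Dω Dh : ℝ → L2 L),
      (∀ t ∈ Set.Icc 0 T,
        IsVelocity f (ω t) (u t) ∧
        HasWeakDiv (fun i x => b t x * u t i x) (Db t) ∧
        HasWeakDiv (fun i x => (ω t x - b t x) * u t i x) (Dω t) ∧
        HasWeakDiv (fun i x => b t x * uh i x) (Dh t)) ∧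
      IntervalIntegrable Db volume 0 T ∧
      IntervalIntegrable Dω volume 0 T ∧
      IntervalIntegrable Dh volume 0 T ∧
      (∀ t ∈ Set.Icc 0 T, b t = b₀ - ∫ τ in (0 : ℝ)..t, Db τ) ∧
      (∀ t ∈ Set.Icc 0 T, ω t = ω₀ - ∫ τ in (0 : ℝ)..t, (Dω τ + Dh τ))

/-- `(b, ω, Tmax)` is a maximal solution, with maximal time `Tmax ∈ (0, ∞]`. -/
def IsMaximalSolution (uh : Fin 2 → L2 L) (f b₀ ω₀ : L2 L) (b ω : ℝ → L2 L) (Tmax : EReal) :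
    Prop :=
  0 < Tmax ∧
    ∃ T : ℕ → ℝ, StrictMono T ∧
      Tendsto (fun n => (T n : EReal)) atTop (𝓝 Tmax) ∧
      (∀ n, IsLocalSolution uh f b₀ ω₀ b ω (T n)) ∧
      (Tmax < ⊤ →
        limsup (fun n => ((normM (b (T n)) (ω (T n)) ^ 2 : ℝ) : EReal)) atTop = ⊤)

end

end TQG

/-! On the Fourier side the system becomes an infinite family of ordinary differential equations for
the coefficients of b and ω. With ζ = ω - f, transport by u is convolution with the kernel ξ² (k₁m₂
- k₂m₁) / `helm L (k - m)`, where ξ = 2π/L. Two features of this kernel carry the proof. Dividing by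
`helm` gains two orders, so the velocity is one order smoother than the vorticity. The kernel is
also real and antisymmetric in (k, m), which is incompressibility of u.

A priori bounds. The Sobolev norms are equivalent to weighted ℓ² norms, and in dimension two `wt ^
(-4)` is summable, so `kconv_bound` reduces every product estimate to an inequality between weights.
Transport costs a derivative, but in the energy pairing of b with the transport of b the leading
part cancels by antisymmetry and a harmless commutator remains (`FData.abs_epair_trans_le`). The
choice of order 3 for b and order 2 for ω closes the estimate, since the ω equation contains only
first derivatives of b outside the transport of ω itself. Energies are taken with multipliers
`cutoff s N` of finite support whose commutators are bounded uniformly in N. The estimates therefore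
apply to solutions having just the regularity of the energy, without mollification.

Local theory. Galerkin truncations exist on a common time interval with common bounds
(`exists_galerkin`). Differences of approximate solutions are compared two orders lower, at order 1
for b and order 0 for ω (`ApproxSol.stability`). There the truncation errors are of size 1/(N + 1),
so the Galerkin sequence is Cauchy, and its limit is a solution whose lifespan depends only on the
size of the data (`exists_isSol`). The bounds at top order survive because they involve only finite
sums of coefficients. Stability with zero error is uniqueness. Strong continuity in time follows
from continuity of the coefficients together with continuity of the norms.

Return to the torus. Testing with trigonometric monomials, and conversely expanding test functions
in Fourier series, turns weak derivatives, weak divergences and the stream function equation into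
multiplier identities. Hence `IsLocalSolution` and `IsSol` are interchangeable
(`IsLocalSolution.isSol`, `IsSol.isLocalSolution`).

Maximal solutions. By uniqueness all local solutions fit together, and the maximal time is the
supremum of their lifespans. If the norms stayed bounded along times tending to a finite supremum,
each of these states could be continued for the same positive time (`exists_extension`), which would
pass the supremum. Two maximal solutions cannot have different maximal times: the shorter one would
agree with the longer one, which is bounded up to and beyond the supposed blow-up. -/

namespace TQG

/-! ### Weighted square-summable sequences -/

/-- The weight `1 + |k₁| + |k₂|` on frequencies. -/
noncomputable def wt (k : ℤ × ℤ) : ℝ := 1 + |(k.1 : ℝ)| + |(k.2 : ℝ)|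

lemma one_le_wt (k : ℤ × ℤ) : 1 ≤ wt k := by
  unfold wt; have := abs_nonneg (k.1 : ℝ); have := abs_nonneg (k.2 : ℝ); linarith

lemma wt_pos (k : ℤ × ℤ) : 0 < wt k := lt_of_lt_of_le one_pos (one_le_wt k)

lemma wt_neg (k : ℤ × ℤ) : wt (-k) = wt k := by simp [wt]

lemma wt_sub_comm (k m : ℤ × ℤ) : wt (k - m) = wt (m - k) := by rw [← wt_neg, neg_sub]

lemma abs_fst_le_wt (k : ℤ × ℤ) : |(k.1 : ℝ)| ≤ wt k := by
  unfold wt; have := abs_nonneg (k.2 : ℝ); linarith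

lemma abs_snd_le_wt (k : ℤ × ℤ) : |(k.2 : ℝ)| ≤ wt k := by
  unfold wt; have := abs_nonneg (k.1 : ℝ); linarith

lemma wt_add_le (k m : ℤ × ℤ) : wt (k + m) ≤ wt k + wt m := by
  unfold wt
  have h1 := abs_add_le (k.1 : ℝ) (m.1 : ℝ)
  have h2 := abs_add_le (k.2 : ℝ) (m.2 : ℝ)
  push_cast [Prod.fst_add, Prod.snd_add]
  linarith

lemma wt_le_sub_add (k m : ℤ × ℤ) : wt k ≤ wt (k - m) + wt m := by
  simpa using wt_add_le (k - m) m

lemma wt_le_sub_add' (k m : ℤ × ℤ) : wt m ≤ wt (k - m) + wt k := by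
  rw [wt_sub_comm]; exact wt_le_sub_add m k

lemma abs_wt_sub_le (k m : ℤ × ℤ) : |wt k - wt m| ≤ wt (k - m) := by
  rw [abs_le]
  constructor <;> linarith [wt_le_sub_add k m, wt_le_sub_add' k m]

lemma wt_le_mul (k m : ℤ × ℤ) : wt m ≤ 2 * (wt (k - m) * wt k) := by
  nlinarith [wt_le_sub_add' k m, one_le_wt k, one_le_wt (k - m)]

lemma summable_one_add_abs_sq : Summable fun n : ℤ => ((1 + |(n : ℝ)|) ^ 2)⁻¹ := by
  have h : Summable fun n : ℕ => ((1 + (n : ℝ)) ^ 2)⁻¹ := by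
    have := (summable_nat_add_iff 1).2 (Real.summable_nat_pow_inv.2 (one_lt_two))
    refine this.congr fun n => ?_
    push_cast; rw [add_comm]
  refine Summable.of_nat_of_neg ?_ ?_ <;> simpa using h

/-- The exponent 4 exceeds the dimension: `wt k ^ 4` dominates (1 + |k₁|)² (1 + |k₂|)², which
reduces the claim to one variable. -/
lemma summable_wt : Summable fun k : ℤ × ℤ => (wt k ^ 4)⁻¹ := by
  have h := summable_one_add_abs_sq.mul_of_nonneg summable_one_add_abs_sq
    (fun _ => by positivity) (fun _ => by positivity)
  refine Summable.of_nonneg_of_le (fun k => by have := wt_pos k; positivity) (fun k => ?_) h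
  rw [← mul_inv]
  refine inv_anti₀ (by positivity) ?_
  have h1 := abs_nonneg (k.1 : ℝ)
  have h2 := abs_nonneg (k.2 : ℝ)
  rw [← mul_pow, show wt k ^ 4 = (wt k ^ 2) ^ 2 by ring]
  refine pow_le_pow_left₀ (by positivity) ?_ 2
  unfold wt; nlinarith [mul_nonneg h1 h2]

/-- The sum of `wt ^ (-4)`. -/
noncomputable def wtSum : ℝ := ∑' k : ℤ × ℤ, (wt k ^ 4)⁻¹

lemma wtSum_nonneg : 0 ≤ wtSum := tsum_nonneg fun k => by have := wt_pos k; positivity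

/-- `a` has norm at most `R` in the weighted `ℓ²` space of order `s`. -/
def SobBd (s : ℕ) (a : ℤ × ℤ → ℂ) (R : ℝ) : Prop :=
  0 ≤ R ∧ ∀ S : Finset (ℤ × ℤ), ∑ k ∈ S, (wt k ^ s * ‖a k‖) ^ 2 ≤ R ^ 2

namespace SobBd

variable {s : ℕ} {a b : ℤ × ℤ → ℂ} {A B : ℝ}

lemma mono (h : SobBd s a A) (hAB : A ≤ B) : SobBd s a B :=
  ⟨h.1.trans hAB, fun S => (h.2 S).trans (pow_le_pow_left₀ h.1 hAB 2)⟩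

lemma mono_order {r : ℕ} (hr : r ≤ s) (h : SobBd s a A) : SobBd r a A := by
  refine ⟨h.1, fun S => le_trans (Finset.sum_le_sum fun k _ => ?_) (h.2 S)⟩
  have := wt_pos k
  have h2 : wt k ^ r ≤ wt k ^ s := pow_le_pow_right₀ (one_le_wt k) hr
  gcongr

lemma of_le (h : SobBd s b B) (hab : ∀ k, ‖a k‖ ≤ ‖b k‖) : SobBd s a B := by
  refine ⟨h.1, fun S => le_trans (Finset.sum_le_sum fun k _ => ?_) (h.2 S)⟩
  have := wt_pos k
  have := hab k
  gcongr

lemma zero : SobBd s (fun _ => 0) 0 := ⟨le_rfl, by simp⟩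

lemma le (h : SobBd s a A) (k : ℤ × ℤ) : wt k ^ s * ‖a k‖ ≤ A := by
  have := h.2 {k}
  rw [Finset.sum_singleton] at this
  exact le_of_sq_le_sq this h.1

lemma norm_le (h : SobBd s a A) (k : ℤ × ℤ) : ‖a k‖ ≤ A := by
  simpa using (h.mono_order (Nat.zero_le s)).le k

lemma summable (h : SobBd s a A) : Summable fun k => (wt k ^ s * ‖a k‖) ^ 2 :=
  summable_of_sum_le (fun _ => sq_nonneg _) h.2

lemma of_summable (h : Summable fun k => (wt k ^ s * ‖a k‖) ^ 2) :
    SobBd s a (√(∑' k, (wt k ^ s * ‖a k‖) ^ 2)) := by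
  refine ⟨Real.sqrt_nonneg _, fun S => ?_⟩
  rw [Real.sq_sqrt (tsum_nonneg fun _ => sq_nonneg _)]
  exact h.sum_le_tsum S fun _ _ => sq_nonneg _

lemma add (ha : SobBd s a A) (hb : SobBd s b B) : SobBd s (fun k => a k + b k) (A + B) := by
  refine ⟨add_nonneg ha.1 hb.1, fun S => ?_⟩
  have hcs := Finset.sum_mul_sq_le_sq_mul_sq S (fun k => wt k ^ s * ‖a k‖)
    (fun k => wt k ^ s * ‖b k‖)
  have h1 := ha.2 S
  have h2 := hb.2 S
  have h0 : 0 ≤ ∑ k ∈ S, (wt k ^ s * ‖a k‖) ^ 2 := Finset.sum_nonneg fun _ _ => sq_nonneg _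
  have h3 : ∑ k ∈ S, (wt k ^ s * ‖a k‖) * (wt k ^ s * ‖b k‖) ≤ A * B := by
    refine le_of_sq_le_sq (hcs.trans ?_) (mul_nonneg ha.1 hb.1)
    rw [mul_pow]
    exact mul_le_mul h1 h2 (Finset.sum_nonneg fun _ _ => sq_nonneg _) (sq_nonneg _)
  calc ∑ k ∈ S, (wt k ^ s * ‖a k + b k‖) ^ 2
      ≤ ∑ k ∈ S, (wt k ^ s * ‖a k‖ + wt k ^ s * ‖b k‖) ^ 2 := by
        refine Finset.sum_le_sum fun k _ => ?_
        have := wt_pos k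
        rw [← mul_add]
        have := norm_add_le (a k) (b k)
        gcongr
    _ = ∑ k ∈ S, (wt k ^ s * ‖a k‖) ^ 2
        + 2 * ∑ k ∈ S, (wt k ^ s * ‖a k‖) * (wt k ^ s * ‖b k‖)
        + ∑ k ∈ S, (wt k ^ s * ‖b k‖) ^ 2 := by
        rw [Finset.mul_sum, ← Finset.sum_add_distrib, ← Finset.sum_add_distrib]
        exact Finset.sum_congr rfl fun k _ => by ring
    _ ≤ (A + B) ^ 2 := by nlinarith

lemma neg (ha : SobBd s a A) : SobBd s (fun k => -a k) A := ha.of_le fun k => by simp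

lemma sub (ha : SobBd s a A) (hb : SobBd s b B) : SobBd s (fun k => a k - b k) (A + B) := by
  simpa [sub_eq_add_neg] using ha.add hb.neg

/-- A form of Fatou's lemma. Only finite sums enter `SobBd`, so convergence of each coefficient is
enough. This keeps the bounds of top order in limits that converge only in weaker norms. -/
lemma of_tendsto {ι : Type*} {l : Filter ι} [l.NeBot] {u : ι → ℤ × ℤ → ℂ}
    (hu : ∀ k, Tendsto (fun i => u i k) l (𝓝 (a k))) (h : ∀ᶠ i in l, SobBd s (u i) A) :
    SobBd s a A := by
  obtain ⟨i, hi⟩ := h.exists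
  refine ⟨hi.1, fun S => ?_⟩
  refine le_of_tendsto (f := fun i => ∑ k ∈ S, (wt k ^ s * ‖u i k‖) ^ 2)
    (tendsto_finsetSum _ fun k _ => (((hu k).norm.const_mul _).pow 2)) ?_
  filter_upwards [h] with i hi using hi.2 S

/-- Cauchy–Schwarz against a multiplier of order `s`. -/
lemma pairing_le (ha : SobBd s a A) (hb : SobBd s b B) {μ : ℤ × ℤ → ℝ}
    (hμ : ∀ k, |μ k| ≤ wt k ^ s) (S : Finset (ℤ × ℤ)) :
    ∑ k ∈ S, μ k ^ 2 * (‖a k‖ * ‖b k‖) ≤ A * B := by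
  have hcs := Finset.sum_mul_sq_le_sq_mul_sq S (fun k => wt k ^ s * ‖a k‖)
    (fun k => wt k ^ s * ‖b k‖)
  have h3 : ∑ k ∈ S, (wt k ^ s * ‖a k‖) * (wt k ^ s * ‖b k‖) ≤ A * B := by
    refine le_of_sq_le_sq (hcs.trans ?_) (mul_nonneg ha.1 hb.1)
    rw [mul_pow]
    exact mul_le_mul (ha.2 S) (hb.2 S) (Finset.sum_nonneg fun _ _ => sq_nonneg _) (sq_nonneg _)
  refine le_trans (Finset.sum_le_sum fun k _ => ?_) h3
  have : μ k ^ 2 ≤ (wt k ^ s) ^ 2 := by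
    rw [← sq_abs]; exact pow_le_pow_left₀ (abs_nonneg _) (hμ k) 2
  calc μ k ^ 2 * (‖a k‖ * ‖b k‖) ≤ (wt k ^ s) ^ 2 * (‖a k‖ * ‖b k‖) := by gcongr
    _ = _ := by ring

end SobBd

/-! ### Convolution estimates -/

/-- Cauchy–Schwarz for series. -/
lemma tsum_mul_sq_le {ι : Type*} {f g : ι → ℝ} (hf0 : ∀ i, 0 ≤ f i) (hg0 : ∀ i, 0 ≤ g i)
    (hf : Summable fun i => f i ^ 2) (hg : Summable fun i => g i ^ 2) :
    (Summable fun i => f i * g i) ∧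
      (∑' i, f i * g i) ^ 2 ≤ (∑' i, f i ^ 2) * ∑' i, g i ^ 2 := by
  have hs : Summable fun i => f i * g i := by
    refine Summable.of_nonneg_of_le (fun i => mul_nonneg (hf0 i) (hg0 i)) (fun i => ?_) (hf.add hg)
    nlinarith [sq_nonneg (f i - g i), sq_nonneg (f i), sq_nonneg (g i)]
  refine ⟨hs, ?_⟩
  have h0 : 0 ≤ (∑' i, f i ^ 2) * ∑' i, g i ^ 2 :=
    mul_nonneg (tsum_nonneg fun _ => sq_nonneg _) (tsum_nonneg fun _ => sq_nonneg _)
  have : ∑' i, f i * g i ≤ √((∑' i, f i ^ 2) * ∑' i, g i ^ 2) := by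
    refine hs.tsum_le_of_sum_le fun S => Real.le_sqrt_of_sq_le ?_
    refine (Finset.sum_mul_sq_le_sq_mul_sq S f g).trans ?_
    exact mul_le_mul (hf.sum_le_tsum S fun _ _ => sq_nonneg _)
      (hg.sum_le_tsum S fun _ _ => sq_nonneg _) (Finset.sum_nonneg fun _ _ => sq_nonneg _)
      (tsum_nonneg fun _ => sq_nonneg _)
  calc _ ≤ (√((∑' i, f i ^ 2) * ∑' i, g i ^ 2)) ^ 2 :=
        pow_le_pow_left₀ (tsum_nonneg fun i => mul_nonneg (hf0 i) (hg0 i)) this 2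
    _ = _ := Real.sq_sqrt h0

/-- The kernel `wt (k - m) ^ (-2) + wt m ^ (-2)`, whose sections are square summable. -/
noncomputable def convWt (k m : ℤ × ℤ) : ℝ := (wt (k - m) ^ 2)⁻¹ + (wt m ^ 2)⁻¹

lemma convWt_nonneg (k m : ℤ × ℤ) : 0 ≤ convWt k m := by
  have := wt_pos m; have := wt_pos (k - m); unfold convWt; positivity

lemma convWt_sq (k : ℤ × ℤ) :
    (Summable fun m => convWt k m ^ 2) ∧ ∑' m, convWt k m ^ 2 ≤ 4 * wtSum := by
  have h1 : Summable fun m => (wt (k - m) ^ 4)⁻¹ := (Equiv.subLeft k).summable_iff.2 summable_wt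
  have h1' : ∑' m, (wt (k - m) ^ 4)⁻¹ = wtSum :=
    (Equiv.subLeft k).tsum_eq fun m => (wt m ^ 4)⁻¹
  have hle : ∀ m, convWt k m ^ 2 ≤ 2 * ((wt (k - m) ^ 4)⁻¹ + (wt m ^ 4)⁻¹) := by
    intro m
    have e1 : (wt (k - m) ^ 4)⁻¹ = ((wt (k - m) ^ 2)⁻¹) ^ 2 := by rw [← inv_pow]; ring
    have e2 : (wt m ^ 4)⁻¹ = ((wt m ^ 2)⁻¹) ^ 2 := by rw [← inv_pow]; ring
    rw [e1, e2, convWt]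
    nlinarith [sq_nonneg ((wt (k - m) ^ 2)⁻¹ - (wt m ^ 2)⁻¹)]
  have hs := (h1.add summable_wt).mul_left 2
  have hs' := Summable.of_nonneg_of_le (fun m => sq_nonneg (convWt k m)) hle hs
  refine ⟨hs', (hs'.tsum_le_tsum hle hs).trans_eq ?_⟩
  rw [tsum_mul_left, h1.tsum_add summable_wt, h1', wtSum]; ring

/-- Cauchy–Schwarz in m separates the kernel, whose square sum over m is bounded uniformly in k.
What remains is the double sum of f(k - m)² g(m)², which factors after summing over k first. -/
lemma conv_bound {f g : ℤ × ℤ → ℝ} (hf0 : ∀ k, 0 ≤ f k) (hg0 : ∀ k, 0 ≤ g k) {A B : ℝ}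
    (hA : ∀ S : Finset (ℤ × ℤ), ∑ k ∈ S, f k ^ 2 ≤ A)
    (hB : ∀ S : Finset (ℤ × ℤ), ∑ k ∈ S, g k ^ 2 ≤ B) :
    (∀ k, Summable fun m => convWt k m * (f (k - m) * g m)) ∧
      ∀ S : Finset (ℤ × ℤ), ∑ k ∈ S, (∑' m, convWt k m * (f (k - m) * g m)) ^ 2
        ≤ 4 * wtSum * (A * B) := by
  have hg : Summable fun k => g k ^ 2 := summable_of_sum_le (fun _ => sq_nonneg _) hB
  have hf1 : ∀ k, f k ^ 2 ≤ A := fun k => by simpa using hA {k}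
  have hA0 : 0 ≤ A := by simpa using hA ∅
  have hfg : ∀ k, Summable fun m => (f (k - m) * g m) ^ 2 := fun k => by
    refine Summable.of_nonneg_of_le (fun _ => sq_nonneg _) (fun m => ?_) (hg.mul_left A)
    rw [mul_pow]
    exact mul_le_mul_of_nonneg_right (hf1 _) (sq_nonneg _)
  have hcs := fun k => tsum_mul_sq_le (convWt_nonneg k)
    (fun m => mul_nonneg (hf0 (k - m)) (hg0 m)) (convWt_sq k).1 (hfg k)
  refine ⟨fun k => (hcs k).1, fun S => ?_⟩
  have hw := wtSum_nonneg
  calc ∑ k ∈ S, (∑' m, convWt k m * (f (k - m) * g m)) ^ 2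
      ≤ ∑ k ∈ S, 4 * wtSum * ∑' m, (f (k - m) * g m) ^ 2 := by
        refine Finset.sum_le_sum fun k _ => (hcs k).2.trans ?_
        exact mul_le_mul_of_nonneg_right (convWt_sq k).2 (tsum_nonneg fun _ => sq_nonneg _)
    _ = 4 * wtSum * ∑' m, ∑ k ∈ S, (f (k - m) * g m) ^ 2 := by
        rw [← Finset.mul_sum, Summable.tsum_finsetSum fun k _ => hfg k]
    _ ≤ 4 * wtSum * (A * B) := by
        refine mul_le_mul_of_nonneg_left ?_ (by positivity)
        have hle : ∀ m, ∑ k ∈ S, (f (k - m) * g m) ^ 2 ≤ A * g m ^ 2 := fun m => by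
          simp_rw [mul_pow]
          rw [← Finset.sum_mul]
          refine mul_le_mul_of_nonneg_right ?_ (sq_nonneg _)
          have := hA (S.map (Equiv.subRight m).toEmbedding)
          simpa using this
        refine ((summable_sum fun k _ => hfg k).tsum_le_tsum hle (hg.mul_left A)).trans ?_
        rw [tsum_mul_left]
        exact mul_le_mul_of_nonneg_left (hg.tsum_le_of_sum_le hB) hA0

/-- Convolution of `a` and `b` with a kernel `κ k m`. -/
noncomputable def kconv (κ : ℤ × ℤ → ℤ × ℤ → ℂ) (a b : ℤ × ℤ → ℂ) (k : ℤ × ℤ) : ℂ :=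
  ∑' m, κ k m * (a (k - m) * b m)

/-- The constant in the convolution estimates. -/
noncomputable def convConst : ℝ := √(4 * wtSum)

lemma convConst_nonneg : 0 ≤ convConst := Real.sqrt_nonneg _

/-- A criterion for all product estimates below: p and q are the orders available for the two
factors and r is the order of the result. The analytic content is the summability inside `convWt`;
the hypothesis on κ is a pointwise comparison of weights. -/
lemma kconv_bound {κ : ℤ × ℤ → ℤ × ℤ → ℂ} {r p q : ℕ} {C : ℝ} (hC : 0 ≤ C)
    (hκ : ∀ k m, wt k ^ r * ‖κ k m‖ ≤ C * (convWt k m * (wt (k - m) ^ p * wt m ^ q)))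
    {a b : ℤ × ℤ → ℂ} {A B : ℝ} (ha : SobBd p a A) (hb : SobBd q b B) :
    (∀ k, Summable fun m => κ k m * (a (k - m) * b m)) ∧
      SobBd r (kconv κ a b) (C * convConst * (A * B)) := by
  have hw := wt_pos
  obtain ⟨h1, h2⟩ := conv_bound (f := fun k => wt k ^ p * ‖a k‖) (g := fun k => wt k ^ q * ‖b k‖)
    (fun k => by have := hw k; positivity) (fun k => by have := hw k; positivity) ha.2 hb.2
  have hle : ∀ k m, wt k ^ r * ‖κ k m * (a (k - m) * b m)‖ ≤
      C * (convWt k m * ((wt (k - m) ^ p * ‖a (k - m)‖) * (wt m ^ q * ‖b m‖))) := by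
    intro k m
    calc wt k ^ r * ‖κ k m * (a (k - m) * b m)‖
        = (wt k ^ r * ‖κ k m‖) * (‖a (k - m)‖ * ‖b m‖) := by rw [norm_mul, norm_mul]; ring
      _ ≤ C * (convWt k m * (wt (k - m) ^ p * wt m ^ q)) * (‖a (k - m)‖ * ‖b m‖) :=
          mul_le_mul_of_nonneg_right (hκ k m) (by positivity)
      _ = _ := by ring
  have hs' : ∀ k, Summable fun m => wt k ^ r * ‖κ k m * (a (k - m) * b m)‖ := fun k =>
    Summable.of_nonneg_of_le (fun m => by have := hw k; positivity) (hle k) ((h1 k).mul_left C)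
  have hs : ∀ k, Summable fun m => ‖κ k m * (a (k - m) * b m)‖ := fun k =>
    (summable_mul_left_iff (pow_pos (hw k) r).ne').1 (hs' k)
  refine ⟨fun k => (hs k).of_norm, by have := convConst_nonneg; have := ha.1; have := hb.1; positivity, fun S => ?_⟩
  have hk : ∀ k, wt k ^ r * ‖kconv κ a b k‖ ≤
      C * ∑' m, convWt k m * ((wt (k - m) ^ p * ‖a (k - m)‖) * (wt m ^ q * ‖b m‖)) := by
    intro k
    rw [← tsum_mul_left]
    refine le_trans ?_ ((hs' k).tsum_le_tsum (hle k) ((h1 k).mul_left C))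
    rw [tsum_mul_left]
    exact mul_le_mul_of_nonneg_left (norm_tsum_le_tsum_norm (hs k)) (by have := hw k; positivity)
  calc ∑ k ∈ S, (wt k ^ r * ‖kconv κ a b k‖) ^ 2
      ≤ ∑ k ∈ S, (C * ∑' m, convWt k m *
          ((wt (k - m) ^ p * ‖a (k - m)‖) * (wt m ^ q * ‖b m‖))) ^ 2 :=
        Finset.sum_le_sum fun k _ =>
          pow_le_pow_left₀ (by have := hw k; positivity) (hk k) 2
    _ = C ^ 2 * ∑ k ∈ S, (∑' m, convWt k m *
          ((wt (k - m) ^ p * ‖a (k - m)‖) * (wt m ^ q * ‖b m‖))) ^ 2 := by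
        rw [Finset.mul_sum]; exact Finset.sum_congr rfl fun k _ => by ring
    _ ≤ C ^ 2 * (4 * wtSum * (A ^ 2 * B ^ 2)) := mul_le_mul_of_nonneg_left (h2 S) (sq_nonneg _)
    _ = (C * convConst * (A * B)) ^ 2 := by
        rw [mul_pow, mul_pow, convConst, Real.sq_sqrt (by have := wtSum_nonneg; positivity)]; ring


open ComplexConjugate

/-! ### Smooth frequency cutoffs -/

/-- The square of frequencies `|k₁|, |k₂| ≤ N`. -/
noncomputable def box (N : ℕ) : Finset (ℤ × ℤ) :=
  Finset.Icc (-(N : ℤ)) N ×ˢ Finset.Icc (-(N : ℤ)) N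

lemma neg_mem_box {N : ℕ} {k : ℤ × ℤ} : -k ∈ box N ↔ k ∈ box N := by
  simp only [box, Finset.mem_product, Finset.mem_Icc, Prod.fst_neg, Prod.snd_neg]
  constructor <;> rintro ⟨⟨_, _⟩, _, _⟩ <;> refine ⟨⟨?_, ?_⟩, ?_, ?_⟩ <;> omega

lemma wt_of_notMem_box {N : ℕ} {k : ℤ × ℤ} (hk : k ∉ box N) : (N : ℝ) + 1 ≤ wt k := by
  have h : (N : ℤ) + 1 ≤ |k.1| ∨ (N : ℤ) + 1 ≤ |k.2| := by
    simp only [box, Finset.mem_product, Finset.mem_Icc] at hk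
    by_contra h
    rw [not_or, not_le, not_le] at h
    have h1 := abs_le.1 (Int.lt_add_one_iff.1 h.1)
    have h2 := abs_le.1 (Int.lt_add_one_iff.1 h.2)
    exact hk ⟨h1, h2⟩
  unfold wt
  have h1 := abs_nonneg (k.1 : ℝ)
  have h2 := abs_nonneg (k.2 : ℝ)
  rcases h with h | h
  · have : (N : ℝ) + 1 ≤ |(k.1 : ℝ)| := by exact_mod_cast h
    linarith
  · have : (N : ℝ) + 1 ≤ |(k.2 : ℝ)| := by exact_mod_cast h
    linarith

lemma eventually_mem_box (k : ℤ × ℤ) : ∀ᶠ N in atTop, k ∈ box N := by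
  filter_upwards [eventually_ge_atTop (k.1.natAbs + k.2.natAbs)] with N hN
  simp only [box, Finset.mem_product, Finset.mem_Icc]
  omega

/-- The multiplier `wt ^ s · (1 - wt / (N + 1))₊`. -/
noncomputable def cutoff (s N : ℕ) (k : ℤ × ℤ) : ℝ := wt k ^ s * max 0 (1 - wt k / (N + 1))

lemma cutoff_nonneg (s N : ℕ) (k : ℤ × ℤ) : 0 ≤ cutoff s N k :=
  mul_nonneg (pow_nonneg (wt_pos k).le _) (le_max_left _ _)

lemma cutoff_le (s N : ℕ) (k : ℤ × ℤ) : cutoff s N k ≤ wt k ^ s := by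
  have h : max 0 (1 - wt k / (N + 1)) ≤ 1 := by
    have := wt_pos k
    refine max_le zero_le_one ?_
    have : 0 ≤ wt k / (N + 1) := by positivity
    linarith
  exact mul_le_of_le_one_right (pow_nonneg (wt_pos k).le _) h

lemma abs_cutoff_le (s N : ℕ) (k : ℤ × ℤ) : |cutoff s N k| ≤ wt k ^ s := by
  rw [abs_of_nonneg (cutoff_nonneg _ _ _)]; exact cutoff_le s N k

lemma cutoff_of_notMem {s N : ℕ} {k : ℤ × ℤ} (hk : k ∉ box N) : cutoff s N k = 0 := by
  have h := wt_of_notMem_box hk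
  have : 1 ≤ wt k / (N + 1) := by rw [le_div_iff₀ (by positivity)]; linarith
  rw [cutoff, max_eq_left (by linarith), mul_zero]

lemma tendsto_cutoff (s : ℕ) (k : ℤ × ℤ) :
    Tendsto (fun N => cutoff s N k) atTop (𝓝 (wt k ^ s)) := by
  have h : Tendsto (fun N : ℕ => wt k / ((N : ℝ) + 1)) atTop (𝓝 0) :=
    tendsto_const_nhds.div_atTop
      (tendsto_atTop_add_const_right _ _ tendsto_natCast_atTop_atTop)
  have := ((tendsto_const_nhds (x := (0 : ℝ))).max
    ((tendsto_const_nhds (x := (1 : ℝ))).sub h)).const_mul (wt k ^ s)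
  simpa [cutoff] using this

/-- The profile (1 - y/n)₊ has slope at most 1/n, so for v ≤ n the factor v is paid for by 1/n. For
v ≥ n only x ≤ n matters, and then v ≤ x + d, x (1 - x/n) ≤ n - x and n - x ≤ v - x ≤ d. -/
lemma mul_abs_max_sub_le {x v d n : ℝ} (hn : 0 < n) (hx : 1 ≤ x) (hd : 1 ≤ d)
    (hxv : |x - v| ≤ d) : v * |max 0 (1 - x / n) - max 0 (1 - v / n)| ≤ 2 * d := by
  obtain ⟨h1, h2⟩ := abs_le.1 hxv
  rcases le_total v n with hvn | hvn
  · rcases le_total v 0 with hv0 | hv0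
    · nlinarith [abs_nonneg (max 0 (1 - x / n) - max 0 (1 - v / n))]
    have h3 : |max 0 (1 - x / n) - max 0 (1 - v / n)| ≤ d / n := by
      have h := abs_max_sub_max_le_abs (1 - x / n) (1 - v / n) 0
      rw [max_comm, max_comm (1 - v / n)] at h
      refine h.trans ?_
      rw [show 1 - x / n - (1 - v / n) = -((x - v) / n) by ring, abs_neg, abs_div, abs_of_pos hn]
      gcongr
    calc _ ≤ n * (d / n) := by gcongr
      _ = d := by field_simp
      _ ≤ 2 * d := by linarith
  · have hv : max 0 (1 - v / n) = 0 := by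
      refine max_eq_left ?_
      have : 1 ≤ v / n := by rwa [le_div_iff₀ hn, one_mul]
      linarith
    rw [hv, sub_zero, abs_of_nonneg (le_max_left _ _)]
    rcases le_total n x with hxn | hxn
    · have : 1 ≤ x / n := by rwa [le_div_iff₀ hn, one_mul]
      rw [max_eq_left (by linarith)]; linarith
    · have h4 : x / n ≤ 1 := by rwa [div_le_iff₀ hn, one_mul]
      rw [max_eq_right (by linarith)]
      have h5 : x * (1 - x / n) ≤ n - x := by
        rw [show n - x = n * (1 - x / n) by field_simp]
        exact mul_le_mul_of_nonneg_right hxn (by linarith)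
      have h6 : 0 ≤ x / n := by positivity
      nlinarith

/-- The mean value estimate for powers, using x ≤ v + d and cleared of denominators. The extra
factor v³ is what the transport kernel requires: one v for the derivative on the transported
function and v² from the denominators of `convWt`. -/
lemma abs_pow_sub_pow_le {s : ℕ} (hs : s ≤ 3) {x v d : ℝ} (hx : 1 ≤ x) (hv : 1 ≤ v) (hd : 1 ≤ d)
    (hxv : |x - v| ≤ d) : |x ^ s - v ^ s| * v ^ 3 ≤ 5 * (d * v ^ s * (v ^ 2 + d ^ 2)) := by
  have hxd : x ≤ v + d := by linarith [(abs_le.1 hxv).2]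
  interval_cases s
  · simp; positivity
  · simp only [pow_one]
    have : |x - v| * v ^ 3 ≤ d * v ^ 3 := by gcongr
    have : 0 ≤ d * v * d ^ 2 := by positivity
    have : 0 ≤ d * v * v ^ 2 := by positivity
    nlinarith
  · have : |x ^ 2 - v ^ 2| ≤ d * (2 * v + d) := by
      rw [show x ^ 2 - v ^ 2 = (x - v) * (x + v) by ring, abs_mul,
        abs_of_nonneg (by linarith : 0 ≤ x + v)]
      exact mul_le_mul hxv (by linarith) (by linarith) (by linarith)
    calc _ ≤ d * (2 * v + d) * v ^ 3 := by gcongr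
      _ = d * v ^ 2 * (2 * v ^ 2 + d * v) := by ring
      _ ≤ d * v ^ 2 * (5 * (v ^ 2 + d ^ 2)) := by
        gcongr; nlinarith [sq_nonneg (d - v)]
      _ = _ := by ring
  · have : |x ^ 3 - v ^ 3| ≤ d * (5 * (v ^ 2 + d ^ 2)) := by
      rw [show x ^ 3 - v ^ 3 = (x - v) * (x ^ 2 + x * v + v ^ 2) by ring, abs_mul,
        abs_of_nonneg (by positivity : 0 ≤ x ^ 2 + x * v + v ^ 2)]
      gcongr
      have : x ^ 2 ≤ (v + d) ^ 2 := by gcongr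
      nlinarith [sq_nonneg (d - v), sq_nonneg (x - v)]
    calc _ ≤ d * (5 * (v ^ 2 + d ^ 2)) * v ^ 3 := by gcongr
      _ = _ := by ring

/-- The commutator bound for the cutoffs, uniform in `N`. -/
lemma abs_cutoff_sub_le {s : ℕ} (hs : s ≤ 3) (N : ℕ) (k m : ℤ × ℤ) :
    |cutoff s N k - cutoff s N m| * wt m ^ 3 ≤
      7 * (wt (k - m) * wt m ^ s * (wt m ^ 2 + wt (k - m) ^ 2)) := by
  have hx := one_le_wt k
  have hv := one_le_wt m
  have hd := one_le_wt (k - m)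
  have hxv := abs_wt_sub_le k m
  have hn : (0 : ℝ) < N + 1 := by positivity
  unfold cutoff
  generalize wt k = x at *
  generalize wt m = v at *
  generalize wt (k - m) = d at *
  have hη0 : 0 ≤ max 0 (1 - x / ((N : ℝ) + 1)) := le_max_left _ _
  have hη1 : max 0 (1 - x / ((N : ℝ) + 1)) ≤ 1 := by
    refine max_le zero_le_one ?_
    have : 0 ≤ x / ((N : ℝ) + 1) := by positivity
    linarith
  have h1 := mul_abs_max_sub_le hn hx hd hxv
  have h2 := abs_pow_sub_pow_le hs hx hv hd hxv
  generalize max 0 (1 - x / ((N : ℝ) + 1)) = α at *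
  generalize max 0 (1 - v / ((N : ℝ) + 1)) = β at *
  have h3 : |x ^ s * α - v ^ s * β| ≤ |x ^ s - v ^ s| + v ^ s * |α - β| := by
    rw [show x ^ s * α - v ^ s * β = (x ^ s - v ^ s) * α + v ^ s * (α - β) by ring]
    refine (abs_add_le _ _).trans ?_
    rw [abs_mul, abs_mul, abs_of_nonneg hη0, abs_of_nonneg (by positivity : 0 ≤ v ^ s)]
    gcongr
    exact mul_le_of_le_one_right (abs_nonneg _) hη1
  have h4 : v ^ s * |α - β| * v ^ 3 ≤ 2 * (d * v ^ s * (v ^ 2 + d ^ 2)) := by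
    calc v ^ s * |α - β| * v ^ 3 = v ^ s * v ^ 2 * (v * |α - β|) := by ring
      _ ≤ v ^ s * v ^ 2 * (2 * d) := by gcongr
      _ = 2 * (d * v ^ s * v ^ 2) := by ring
      _ ≤ _ := by gcongr; nlinarith
  calc _ ≤ (|x ^ s - v ^ s| + v ^ s * |α - β|) * v ^ 3 := by gcongr
    _ ≤ _ := by rw [add_mul]; linarith

/-! ### The transport and forcing operators -/

/-- Symmetry of the Fourier coefficients of a real-valued function. -/
def Herm (a : ℤ × ℤ → ℂ) : Prop := ∀ k, a (-k) = conj (a k)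

lemma Herm.add {a b : ℤ × ℤ → ℂ} (ha : Herm a) (hb : Herm b) : Herm fun k => a k + b k :=
  fun k => by simp [ha k, hb k]

lemma Herm.sub {a b : ℤ × ℤ → ℂ} (ha : Herm a) (hb : Herm b) : Herm fun k => a k - b k :=
  fun k => by simp [ha k, hb k]

lemma Herm.neg {a : ℤ × ℤ → ℂ} (ha : Herm a) : Herm fun k => -a k :=
  fun k => by simp [ha k]

/-- The data of the Fourier-transformed system: `G` is the multiplier taking the vorticity to the
velocity, `f` and `v` are the coefficients of the bathymetry and of the rotational field, and `ξ`
is the fundamental frequency. -/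
structure FData where
  ξ : ℝ
  G : ℤ × ℤ → ℝ
  CG : ℝ
  f : ℤ × ℤ → ℂ
  v₁ : ℤ × ℤ → ℂ
  v₂ : ℤ × ℤ → ℂ
  F : ℝ
  V : ℝ
  G_neg : ∀ k, G (-k) = G k
  G_le : ∀ k, |G k| * wt k ^ 2 ≤ CG
  f_bd : SobBd 2 f F
  v₁_bd : SobBd 3 v₁ V
  v₂_bd : SobBd 3 v₂ V
  f_herm : Herm f
  v₁_herm : Herm v₁
  v₂_herm : Herm v₂

namespace FData

variable (D : FData)

lemma CG_nonneg : 0 ≤ D.CG := le_trans (by have := wt_pos 0; positivity) (D.G_le 0)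

/-- The kernel of the transport operator. -/
noncomputable def tker (k m : ℤ × ℤ) : ℂ :=
  (((k.1 * m.2 - k.2 * m.1 : ℝ) * D.G (k - m) : ℝ) : ℂ)

/-- The coefficients of `u · ∇b`, where `u` is the velocity with vorticity `ζ`. -/
noncomputable def trans (ζ b : ℤ × ℤ → ℂ) : ℤ × ℤ → ℂ := kconv D.tker ζ b

/-- The coefficients of `v · ∇b`. -/
noncomputable def forcing (b : ℤ × ℤ → ℂ) (k : ℤ × ℤ) : ℂ :=
  kconv (fun _ m => Complex.I * D.ξ * m.1) D.v₁ b k +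
    kconv (fun _ m => Complex.I * D.ξ * m.2) D.v₂ b k

/-- Since k × k = 0, the cross product k × m equals (k - m) × m. So one of the two frequencies falls
on the vorticity factor, where G gains two orders: the kernel gains one order in k - m and costs one
in m. -/
lemma norm_tker_le (k m : ℤ × ℤ) : ‖D.tker k m‖ * wt (k - m) ≤ D.CG * wt m := by
  have hd := wt_pos (k - m)
  have hm := wt_pos m
  have h1 : |(k.1 * m.2 - k.2 * m.1 : ℝ)| ≤ wt (k - m) * wt m := by
    rw [show (k.1 * m.2 - k.2 * m.1 : ℝ) = ((k - m).1 : ℝ) * m.2 - ((k - m).2 : ℝ) * m.1 by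
      push_cast [Prod.fst_sub, Prod.snd_sub]; ring]
    refine (abs_sub _ _).trans ?_
    rw [abs_mul, abs_mul]
    unfold wt
    have h1 := abs_nonneg (((k - m).1 : ℤ) : ℝ)
    have h2 := abs_nonneg (((k - m).2 : ℤ) : ℝ)
    have h3 := abs_nonneg (m.1 : ℝ)
    have h4 := abs_nonneg (m.2 : ℝ)
    nlinarith [mul_nonneg h1 h3, mul_nonneg h2 h4]
  have h2 := D.G_le (k - m)
  rw [tker, Complex.norm_real, Real.norm_eq_abs, abs_mul]
  calc _ ≤ (wt (k - m) * wt m) * |D.G (k - m)| * wt (k - m) := by gcongr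
    _ = (|D.G (k - m)| * wt (k - m) ^ 2) * wt m := by ring
    _ ≤ _ := by gcongr

lemma kernel_bound_iff {K C d v P : ℝ} (hd : 0 < d) (hv : 0 < v) :
    K ≤ C * (((d ^ 2)⁻¹ + (v ^ 2)⁻¹) * P) ↔ K * (d ^ 2 * v ^ 2) ≤ C * ((v ^ 2 + d ^ 2) * P) := by
  rw [← le_div_iff₀ (by positivity)]
  have : C * ((v ^ 2 + d ^ 2) * P) / (d ^ 2 * v ^ 2) = C * (((d ^ 2)⁻¹ + (v ^ 2)⁻¹) * P) := by
    field_simp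
  rw [this]

/-- The three weights are replaced by free variables x, d, v ≥ 1 with x ≤ d + v, so that each
mapping property of the transport operator becomes a polynomial inequality. -/
lemma tker_bound {r p q : ℕ} {C : ℝ}
    (h : ∀ x d v : ℝ, 1 ≤ x → 1 ≤ d → 1 ≤ v → x ≤ d + v →
      x ^ r * d * v ^ 3 ≤ C * ((v ^ 2 + d ^ 2) * (d ^ p * v ^ q))) (k m : ℤ × ℤ) :
    wt k ^ r * ‖D.tker k m‖ ≤ D.CG * C * (convWt k m * (wt (k - m) ^ p * wt m ^ q)) := by
  have hd := wt_pos (k - m)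
  have hm := wt_pos m
  have hk := wt_pos k
  rw [convWt, kernel_bound_iff hd hm]
  have h1 := h _ _ _ (one_le_wt k) (one_le_wt (k - m)) (one_le_wt m) (wt_le_sub_add k m)
  calc wt k ^ r * ‖D.tker k m‖ * (wt (k - m) ^ 2 * wt m ^ 2)
      = (‖D.tker k m‖ * wt (k - m)) * (wt k ^ r * wt (k - m) * wt m ^ 2) := by ring
    _ ≤ (D.CG * wt m) * (wt k ^ r * wt (k - m) * wt m ^ 2) :=
        mul_le_mul_of_nonneg_right (D.norm_tker_le k m) (by positivity)
    _ = D.CG * (wt k ^ r * wt (k - m) * wt m ^ 3) := by ring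
    _ ≤ D.CG * (C * ((wt m ^ 2 + wt (k - m) ^ 2) * (wt (k - m) ^ p * wt m ^ q))) :=
        mul_le_mul_of_nonneg_left h1 D.CG_nonneg
    _ = _ := by ring

variable {D} {ζ b : ℤ × ℤ → ℂ} {A B : ℝ}

/-- The constant in the bounds for the transport operator. -/
noncomputable def CT (D : FData) : ℝ := D.CG * 7 * convConst

lemma CT_nonneg (D : FData) : 0 ≤ D.CT := by
  have := D.CG_nonneg; have := convConst_nonneg; unfold CT; positivity

lemma trans_bound {r p q : ℕ}
    (h : ∀ x d v : ℝ, 1 ≤ x → 1 ≤ d → 1 ≤ v → x ≤ d + v →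
      x ^ r * d * v ^ 3 ≤ 7 * ((v ^ 2 + d ^ 2) * (d ^ p * v ^ q)))
    (hζ : SobBd p ζ A) (hb : SobBd q b B) : SobBd r (D.trans ζ b) (D.CT * (A * B)) :=
  (kconv_bound (mul_nonneg D.CG_nonneg (by norm_num)) (D.tker_bound h) hζ hb).2

lemma trans_bound_two (hζ : SobBd 2 ζ A) (hb : SobBd 3 b B) :
    SobBd 2 (D.trans ζ b) (D.CT * (A * B)) := by
  refine trans_bound (fun x d v hx hd hv hxd => ?_) hζ hb
  have h1 : x ^ 2 ≤ (d + v) ^ 2 := by gcongr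
  calc x ^ 2 * d * v ^ 3 ≤ (2 * (v ^ 2 + d ^ 2)) * d * v ^ 3 := by
        gcongr; nlinarith [sq_nonneg (d - v)]
    _ ≤ (7 * (v ^ 2 + d ^ 2)) * d ^ 2 * v ^ 3 := by
        gcongr
        · norm_num
        · nlinarith
    _ = _ := by ring

/-- Meant for differences of solutions: a vorticity difference is controlled only at order 0, which
is compensated by the third order of the buoyancy. -/
lemma trans_bound_one (hζ : SobBd 0 ζ A) (hb : SobBd 3 b B) :
    SobBd 1 (D.trans ζ b) (D.CT * (A * B)) := by
  refine trans_bound (fun x d v hx hd hv hxd => ?_) hζ hb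
  have h1 : x * d ≤ 7 * (v ^ 2 + d ^ 2) := by nlinarith [sq_nonneg (d - v)]
  calc x ^ 1 * d * v ^ 3 = (x * d) * v ^ 3 := by ring
    _ ≤ (7 * (v ^ 2 + d ^ 2)) * v ^ 3 := by gcongr
    _ = _ := by ring

lemma trans_bound_one' (hζ : SobBd 2 ζ A) (hb : SobBd 2 b B) :
    SobBd 1 (D.trans ζ b) (D.CT * (A * B)) := by
  refine trans_bound (fun x d v hx hd hv hxd => ?_) hζ hb
  have h1 : x * v ≤ 7 * (v ^ 2 + d ^ 2) := by nlinarith [sq_nonneg (d - v)]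
  calc x ^ 1 * d * v ^ 3 = (x * v) * (d * v ^ 2) := by ring
    _ ≤ (7 * (v ^ 2 + d ^ 2)) * (d ^ 2 * v ^ 2) := by gcongr; nlinarith
    _ = _ := by ring

lemma trans_bound_zero (hζ : SobBd 0 ζ A) (hb : SobBd 2 b B) :
    SobBd 0 (D.trans ζ b) (D.CT * (A * B)) := by
  refine trans_bound (fun x d v hx hd hv hxd => ?_) hζ hb
  have h1 : d * v ≤ 7 * (v ^ 2 + d ^ 2) := by nlinarith [sq_nonneg (d - v)]
  calc x ^ 0 * d * v ^ 3 = (d * v) * v ^ 2 := by ring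
    _ ≤ (7 * (v ^ 2 + d ^ 2)) * v ^ 2 := by gcongr
    _ = _ := by ring

lemma trans_bound_zero' (hζ : SobBd 2 ζ A) (hb : SobBd 1 b B) :
    SobBd 0 (D.trans ζ b) (D.CT * (A * B)) := by
  refine trans_bound (fun x d v hx hd hv hxd => ?_) hζ hb
  calc x ^ 0 * d * v ^ 3 = v ^ 2 * (d * v) := by ring
    _ ≤ (7 * (v ^ 2 + d ^ 2)) * (d ^ 2 * v) := by
      gcongr
      · nlinarith
      · nlinarith
    _ = _ := by ring

lemma trans_summable (hζ : SobBd 2 ζ A) (hb : SobBd 2 b B) (k : ℤ × ℤ) :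
    Summable fun m => D.tker k m * (ζ (k - m) * b m) := by
  refine (kconv_bound (r := 0) (mul_nonneg D.CG_nonneg (by norm_num : (0 : ℝ) ≤ 7))
    (D.tker_bound fun x d v hx hd hv hxd => ?_) hζ hb).1 k
  have h1 : d * v ≤ 7 * (v ^ 2 + d ^ 2) := by nlinarith [sq_nonneg (d - v)]
  calc x ^ 0 * d * v ^ 3 = (d * v) * (1 * v ^ 2) := by ring
    _ ≤ (7 * (v ^ 2 + d ^ 2)) * (d ^ 2 * v ^ 2) := by gcongr; nlinarith
    _ = _ := by ring

/-- The constant in the bounds for the forcing operator. -/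
noncomputable def CU (D : FData) : ℝ := |D.ξ| * 2 * convConst * D.V * 2

lemma CU_nonneg (D : FData) : 0 ≤ D.CU := by
  have := D.v₁_bd.1; have := convConst_nonneg; unfold CU; positivity

lemma fker_bound {r p q : ℕ} {ξ : ℝ}
    (h : ∀ x d v : ℝ, 1 ≤ x → 1 ≤ d → 1 ≤ v → x ≤ d + v →
      x ^ r * d ^ 2 * v ^ 3 ≤ 2 * ((v ^ 2 + d ^ 2) * (d ^ p * v ^ q)))
    {j : ℤ × ℤ → ℤ} (hj : ∀ m, |(j m : ℝ)| ≤ wt m) (k m : ℤ × ℤ) :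
    wt k ^ r * ‖Complex.I * ξ * j m‖ ≤ |ξ| * 2 * (convWt k m * (wt (k - m) ^ p * wt m ^ q)) := by
  have hd := wt_pos (k - m)
  have hm := wt_pos m
  have hk := wt_pos k
  rw [convWt, kernel_bound_iff hd hm]
  have h1 := h _ _ _ (one_le_wt k) (one_le_wt (k - m)) (one_le_wt m) (wt_le_sub_add k m)
  have h2 : ‖Complex.I * ξ * j m‖ ≤ |ξ| * wt m := by
    rw [norm_mul, norm_mul, Complex.norm_I, one_mul, Complex.norm_real, Real.norm_eq_abs,
      Complex.norm_intCast]
    exact mul_le_mul_of_nonneg_left (hj m) (abs_nonneg _)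
  calc _ ≤ wt k ^ r * (|ξ| * wt m) * (wt (k - m) ^ 2 * wt m ^ 2) := by gcongr
    _ = |ξ| * (wt k ^ r * wt (k - m) ^ 2 * wt m ^ 3) := by ring
    _ ≤ |ξ| * (2 * ((wt m ^ 2 + wt (k - m) ^ 2) * (wt (k - m) ^ p * wt m ^ q))) :=
        mul_le_mul_of_nonneg_left h1 (abs_nonneg _)
    _ = _ := by ring

lemma forcing_bound {r q : ℕ}
    (h : ∀ x d v : ℝ, 1 ≤ x → 1 ≤ d → 1 ≤ v → x ≤ d + v →
      x ^ r * d ^ 2 * v ^ 3 ≤ 2 * ((v ^ 2 + d ^ 2) * (d ^ 3 * v ^ q)))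
    (hb : SobBd q b B) : SobBd r (D.forcing b) (D.CU * B) := by
  have h0 : 0 ≤ |D.ξ| * 2 := by positivity
  have h1 := (kconv_bound h0 (fker_bound h abs_fst_le_wt) D.v₁_bd hb).2
  have h2 := (kconv_bound h0 (fker_bound h abs_snd_le_wt) D.v₂_bd hb).2
  refine (h1.add h2).mono (le_of_eq ?_)
  unfold CU; ring

lemma forcing_bound_two (hb : SobBd 3 b B) : SobBd 2 (D.forcing b) (D.CU * B) := by
  refine forcing_bound (fun x d v hx hd hv hxd => ?_) hb
  have h1 : x ^ 2 ≤ (d + v) ^ 2 := by gcongr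
  calc x ^ 2 * d ^ 2 * v ^ 3 ≤ (2 * (v ^ 2 + d ^ 2)) * d ^ 3 * v ^ 3 := by
        gcongr
        · nlinarith [sq_nonneg (d - v)]
        · norm_num
    _ = _ := by ring

lemma forcing_bound_zero (hb : SobBd 1 b B) : SobBd 0 (D.forcing b) (D.CU * B) := by
  refine forcing_bound (fun x d v hx hd hv hxd => ?_) hb
  calc x ^ 0 * d ^ 2 * v ^ 3 = v ^ 2 * (d ^ 2 * v) := by ring
    _ ≤ (2 * (v ^ 2 + d ^ 2)) * (d ^ 3 * v) := by
      gcongr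
      · nlinarith
      · norm_num
    _ = _ := by ring

lemma forcing_summable (hb : SobBd 1 b B) (k : ℤ × ℤ) :
    (Summable fun m => Complex.I * D.ξ * (m.1 : ℂ) * (D.v₁ (k - m) * b m)) ∧
      Summable fun m => Complex.I * D.ξ * (m.2 : ℂ) * (D.v₂ (k - m) * b m) := by
  have h : ∀ x d v : ℝ, 1 ≤ x → 1 ≤ d → 1 ≤ v → x ≤ d + v →
      x ^ 0 * d ^ 2 * v ^ 3 ≤ 2 * ((v ^ 2 + d ^ 2) * (d ^ 3 * v ^ 1)) := fun x d v hx hd hv hxd => by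
    calc x ^ 0 * d ^ 2 * v ^ 3 = v ^ 2 * (d ^ 2 * v) := by ring
      _ ≤ (2 * (v ^ 2 + d ^ 2)) * (d ^ 3 * v) := by
        gcongr
        · nlinarith
        · norm_num
      _ = _ := by ring
  have h0 : 0 ≤ |D.ξ| * 2 := by positivity
  exact ⟨(kconv_bound h0 (fker_bound h abs_fst_le_wt) D.v₁_bd hb).1 k,
    (kconv_bound h0 (fker_bound h abs_snd_le_wt) D.v₂_bd hb).1 k⟩

end FData


/-! ### Energy pairings -/

lemma kconv_herm {κ : ℤ × ℤ → ℤ × ℤ → ℂ} (hκ : ∀ k m, κ (-k) (-m) = conj (κ k m))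
    {a b : ℤ × ℤ → ℂ} (ha : Herm a) (hb : Herm b) : Herm (kconv κ a b) := by
  intro k
  rw [kconv, kconv, Complex.conj_tsum, ← (Equiv.neg (ℤ × ℤ)).tsum_eq]
  refine tsum_congr fun m => ?_
  rw [Equiv.neg_apply, hκ, map_mul, map_mul, ← ha, ← hb, neg_sub_neg, neg_sub]

/-- The real part of the weighted inner product of `a` and `g` over `S`. -/
noncomputable def epair (μ : ℤ × ℤ → ℝ) (S : Finset (ℤ × ℤ)) (a g : ℤ × ℤ → ℂ) : ℝ :=
  ∑ k ∈ S, μ k ^ 2 * (conj (a k) * g k).re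

lemma epair_add (μ : ℤ × ℤ → ℝ) (S : Finset (ℤ × ℤ)) (a g h : ℤ × ℤ → ℂ) :
    epair μ S a (fun k => g k + h k) = epair μ S a g + epair μ S a h := by
  simp only [epair, mul_add, Complex.add_re, Finset.sum_add_distrib]

lemma epair_neg (μ : ℤ × ℤ → ℝ) (S : Finset (ℤ × ℤ)) (a g : ℤ × ℤ → ℂ) :
    epair μ S a (fun k => -g k) = -epair μ S a g := by
  simp only [epair, mul_neg, Complex.neg_re, Finset.sum_neg_distrib]

lemma epair_sub (μ : ℤ × ℤ → ℝ) (S : Finset (ℤ × ℤ)) (a g h : ℤ × ℤ → ℂ) :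
    epair μ S a (fun k => g k - h k) = epair μ S a g - epair μ S a h := by
  simp only [epair, mul_sub, Complex.sub_re, Finset.sum_sub_distrib]

lemma abs_epair_le {s : ℕ} {a g : ℤ × ℤ → ℂ} {A B : ℝ} (ha : SobBd s a A) (hg : SobBd s g B)
    {μ : ℤ × ℤ → ℝ} (hμ : ∀ k, |μ k| ≤ wt k ^ s) (S : Finset (ℤ × ℤ)) :
    |epair μ S a g| ≤ A * B := by
  refine (Finset.abs_sum_le_sum_abs _ _).trans (le_trans (Finset.sum_le_sum fun k _ => ?_)
    (ha.pairing_le hg hμ S))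
  rw [abs_mul, abs_of_nonneg (sq_nonneg (μ k))]
  refine mul_le_mul_of_nonneg_left ((Complex.abs_re_le_norm _).trans ?_) (sq_nonneg _)
  rw [norm_mul, Complex.norm_conj]

namespace FData

variable {D : FData} {ζ ζ' b b' : ℤ × ℤ → ℂ} {A A' B B' : ℝ}

/-- The Fourier form of div u = 0, and the source of the cancellation in the energy estimates. -/
lemma tker_swap (k m : ℤ × ℤ) : D.tker m k = -D.tker k m := by
  rw [tker, tker, ← neg_sub k m, D.G_neg, ← Complex.ofReal_neg]
  congr 1; ring

lemma conj_tker (k m : ℤ × ℤ) : conj (D.tker k m) = D.tker k m := Complex.conj_ofReal _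

lemma tker_neg_neg (k m : ℤ × ℤ) : D.tker (-k) (-m) = D.tker k m := by
  rw [tker, tker, neg_sub_neg, ← neg_sub k m, D.G_neg]
  congr 2
  push_cast [Prod.fst_neg, Prod.snd_neg]; ring

lemma trans_herm (hζ : Herm ζ) (hb : Herm b) : Herm (D.trans ζ b) :=
  kconv_herm (fun k m => by rw [conj_tker, tker_neg_neg]) hζ hb

lemma forcing_herm (hb : Herm b) : Herm (D.forcing b) :=
  (kconv_herm (by intro k m; simp) D.v₁_herm hb).add (kconv_herm (by intro k m; simp) D.v₂_herm hb)

lemma trans_sub_left (hζ : SobBd 2 ζ A) (hζ' : SobBd 2 ζ' A') (hb : SobBd 2 b B) (k : ℤ × ℤ) :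
    D.trans (fun k => ζ k - ζ' k) b k = D.trans ζ b k - D.trans ζ' b k := by
  rw [trans, trans, trans, kconv, kconv, kconv,
    ← (trans_summable hζ hb k).tsum_sub (trans_summable hζ' hb k)]
  exact tsum_congr fun m => by ring

lemma trans_sub_right (hζ : SobBd 2 ζ A) (hb : SobBd 2 b B) (hb' : SobBd 2 b' B') (k : ℤ × ℤ) :
    D.trans ζ (fun k => b k - b' k) k = D.trans ζ b k - D.trans ζ b' k := by
  rw [trans, trans, trans, kconv, kconv, kconv,
    ← (trans_summable hζ hb k).tsum_sub (trans_summable hζ hb' k)]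
  exact tsum_congr fun m => by ring

lemma forcing_sub (hb : SobBd 1 b B) (hb' : SobBd 1 b' B') (k : ℤ × ℤ) :
    D.forcing (fun k => b k - b' k) k = D.forcing b k - D.forcing b' k := by
  obtain ⟨h1, h2⟩ := forcing_summable (D := D) hb k
  obtain ⟨h1', h2'⟩ := forcing_summable (D := D) hb' k
  simp only [forcing, kconv]
  rw [add_sub_add_comm, ← h1.tsum_sub h1', ← h2.tsum_sub h2']
  congr 1 <;> exact tsum_congr fun m => by ring

/-- Transport by a real divergence-free field loses no derivative in the energy estimates of
order `s ≤ 3`. -/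
lemma abs_epair_trans_le {s : ℕ} (hs : s ≤ 3) (N : ℕ) (hζs : Herm ζ) (hζ : SobBd 2 ζ A)
    (hb : SobBd s b B) :
    |epair (cutoff s N) (box N) b (D.trans ζ b)| ≤ D.CT * (A * B ^ 2) := by
  set μ := cutoff s N with hμ
  set S := box N
  -- K is the kernel of the commutator of the multiplier μ with transport. By `abs_cutoff_sub_le` it
  -- maps order s to order 0 with a bound independent of N.
  set K : ℤ × ℤ → ℤ × ℤ → ℂ := fun k m => ((μ k - μ m : ℝ) : ℂ) * D.tker k m with hK
  have hKb : ∀ k m, wt k ^ 0 * ‖K k m‖ ≤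
      D.CG * 7 * (convWt k m * (wt (k - m) ^ 2 * wt m ^ s)) := by
    intro k m
    have hd := wt_pos (k - m)
    have hm := wt_pos m
    rw [convWt, kernel_bound_iff hd hm, pow_zero, one_mul, hK, norm_mul, Complex.norm_real,
      Real.norm_eq_abs]
    calc |μ k - μ m| * ‖D.tker k m‖ * (wt (k - m) ^ 2 * wt m ^ 2)
        = (‖D.tker k m‖ * wt (k - m)) * (|μ k - μ m| * wt (k - m) * wt m ^ 2) := by ring
      _ ≤ (D.CG * wt m) * (|μ k - μ m| * wt (k - m) * wt m ^ 2) :=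
          mul_le_mul_of_nonneg_right (D.norm_tker_le k m) (by positivity)
      _ = D.CG * wt (k - m) * (|μ k - μ m| * wt m ^ 3) := by ring
      _ ≤ D.CG * wt (k - m) * (7 * (wt (k - m) * wt m ^ s * (wt m ^ 2 + wt (k - m) ^ 2))) :=
          mul_le_mul_of_nonneg_left (abs_cutoff_sub_le hs N k m)
            (mul_nonneg D.CG_nonneg hd.le)
      _ = _ := by ring
  obtain ⟨hsum, hbd⟩ := kconv_bound (mul_nonneg D.CG_nonneg (by norm_num)) hKb hζ hb
  set c : ℤ × ℤ → ℂ := fun k => (μ k : ℂ) * b k with hc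
  have hcb : SobBd 0 c B := by
    refine ⟨hb.1, fun S => le_trans (Finset.sum_le_sum fun k _ => ?_) (hb.2 S)⟩
    rw [pow_zero, one_mul, hc, norm_mul, Complex.norm_real, Real.norm_eq_abs]
    have := abs_cutoff_le s N k
    gcongr
  -- The multiplier is moved inside: μ·(transport of b) is the commutator plus the transport of μb.
  -- The last sum is finite because μ vanishes outside the box.
  have hsplit : ∀ k, (μ k : ℂ) * D.trans ζ b k =
      kconv K ζ b k + ∑ m ∈ S, D.tker k m * (ζ (k - m) * c m) := by
    intro k
    have h0 : ∀ m ∉ S, D.tker k m * (ζ (k - m) * c m) = 0 := fun m hm => by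
      rw [hc]; simp [hμ, cutoff_of_notMem hm]
    have hfin : Summable fun m => D.tker k m * (ζ (k - m) * c m) :=
      summable_of_ne_finset_zero (s := S) h0
    rw [← tsum_eq_sum (L := .unconditional _) h0, kconv, ← (hsum k).tsum_add hfin, trans, kconv, ← tsum_mul_left]
    refine tsum_congr fun m => ?_
    simp only [hK, hc, Complex.ofReal_sub]; ring
  clear_value c
  -- Conjugating and exchanging the names k and m changes only the sign, because the kernel is real
  -- and antisymmetric and ζ is Hermitian. The sum is therefore purely imaginary.
  have hanti : (∑ k ∈ S, ∑ m ∈ S, conj (c k) * (D.tker k m * (ζ (k - m) * c m))).re = 0 := by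
    have : (starRingEnd ℂ) (∑ k ∈ S, ∑ m ∈ S, conj (c k) * (D.tker k m * (ζ (k - m) * c m))) =
        -∑ k ∈ S, ∑ m ∈ S, conj (c k) * (D.tker k m * (ζ (k - m) * c m)) := by
      rw [map_sum, Finset.sum_congr rfl fun k _ => map_sum _ _ _, Finset.sum_comm,
        ← Finset.sum_neg_distrib]
      refine Finset.sum_congr rfl fun k _ => ?_
      rw [← Finset.sum_neg_distrib]
      refine Finset.sum_congr rfl fun m _ => ?_
      rw [map_mul, map_mul, map_mul, conj_tker, Complex.conj_conj, ← hζs, neg_sub, tker_swap]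
      ring
    have h := congrArg Complex.re this
    rw [Complex.conj_re, Complex.neg_re] at h
    linarith
  have hmain : epair μ S b (D.trans ζ b) = epair (fun _ => 1) S c (kconv K ζ b) := by
    have h1 : epair μ S b (D.trans ζ b) =
        epair (fun _ => 1) S c (kconv K ζ b) +
          (∑ k ∈ S, ∑ m ∈ S, conj (c k) * (D.tker k m * (ζ (k - m) * c m))).re := by
      rw [epair, epair, Complex.re_sum, ← Finset.sum_add_distrib]
      refine Finset.sum_congr rfl fun k _ => ?_
      rw [one_pow, one_mul, ← Finset.mul_sum, ← Complex.add_re, ← mul_add, ← hsplit,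
        ← Complex.re_ofReal_mul]
      congr 1
      rw [hc]
      simp only [map_mul, Complex.conj_ofReal]
      push_cast; ring
    rw [h1, hanti, add_zero]
  rw [hmain]
  refine (abs_epair_le hcb hbd (by simp) S).trans (le_of_eq ?_)
  rw [CT]; ring

/-- The right-hand side of the buoyancy equation. -/
noncomputable def rhsB (D : FData) (b ω : ℤ × ℤ → ℂ) (k : ℤ × ℤ) : ℂ :=
  -D.trans (fun k => ω k - D.f k) b k

/-- The right-hand side of the vorticity equation. -/
noncomputable def rhsW (D : FData) (b ω : ℤ × ℤ → ℂ) (k : ℤ × ℤ) : ℂ :=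
  -(D.trans (fun k => ω k - D.f k) (fun k => ω k - b k) k + D.forcing b k)

lemma rhsB_herm {ω : ℤ × ℤ → ℂ} (hb : Herm b) (hω : Herm ω) : Herm (D.rhsB b ω) :=
  (trans_herm (hω.sub D.f_herm) hb).neg

lemma rhsW_herm {ω : ℤ × ℤ → ℂ} (hb : Herm b) (hω : Herm ω) : Herm (D.rhsW b ω) :=
  ((trans_herm (hω.sub D.f_herm) (hω.sub hb)).add (forcing_herm hb)).neg

variable {ω : ℤ × ℤ → ℂ} {R : ℝ}

lemma rhsB_bound (hb : SobBd 3 b R) (hω : SobBd 2 ω R) :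
    SobBd 2 (D.rhsB b ω) (D.CT * ((R + D.F) * R)) :=
  (trans_bound_two (hω.sub D.f_bd) hb).neg

/-- The transport of ω differentiates ω itself, so only order 1 remains. This is still one order
above the norm in which the errors of the vorticity equation are measured, and that margin gives the
Galerkin rate. -/
lemma rhsW_bound (hb : SobBd 3 b R) (hω : SobBd 2 ω R) :
    SobBd 1 (D.rhsW b ω) (D.CT * ((R + D.F) * (R + R)) + D.CU * R) :=
  ((trans_bound_one' (hω.sub D.f_bd) (hω.sub (hb.mono_order (by norm_num)))).add
    ((forcing_bound_two hb).mono_order (by norm_num))).neg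

/-- The rate of change of the energy of order `3 × 2` on the ball of radius `R`. -/
noncomputable def rate (D : FData) (R : ℝ) : ℝ :=
  2 * (D.CT * ((R + D.F) * R ^ 2) * 2 + R * (D.CT * ((R + D.F) * R)) + R * (D.CU * R))

lemma abs_epair_rhsB_le (N : ℕ) (hωs : Herm ω) (hb : SobBd 3 b R) (hω : SobBd 2 ω R) :
    |epair (cutoff 3 N) (box N) b (D.rhsB b ω)| ≤ D.CT * ((R + D.F) * R ^ 2) := by
  rw [show D.rhsB b ω = fun k => -D.trans (fun k => ω k - D.f k) b k from rfl, epair_neg, abs_neg]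
  exact abs_epair_trans_le le_rfl N (hωs.sub D.f_herm) (hω.sub D.f_bd) hb

/-- The transport of ω - b is split. The part with ω costs no derivative by antisymmetry, while the
part with b, like the forcing, is estimated directly because b is one order smoother than ω. -/
lemma abs_epair_rhsW_le (N : ℕ) (hωs : Herm ω) (hb : SobBd 3 b R) (hω : SobBd 2 ω R) :
    |epair (cutoff 2 N) (box N) ω (D.rhsW b ω)| ≤
      D.CT * ((R + D.F) * R ^ 2) + R * (D.CT * ((R + D.F) * R)) + R * (D.CU * R) := by
  have hζ := hω.sub D.f_bd
  have e : D.rhsW b ω = fun k => -(D.trans (fun k => ω k - D.f k) ω k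
      - D.trans (fun k => ω k - D.f k) b k + D.forcing b k) := by
    funext k
    rw [rhsW, trans_sub_right hζ hω (hb.mono_order (by norm_num))]
  rw [e, epair_neg, abs_neg, epair_add, epair_sub]
  have h1 := abs_epair_trans_le (D := D) (by norm_num : 2 ≤ 3) N (hωs.sub D.f_herm) hζ hω
  have h2 := abs_epair_le hω (trans_bound_two (D := D) hζ hb) (abs_cutoff_le 2 N) (box N)
  have h3 := abs_epair_le hω (forcing_bound_two (D := D) hb) (abs_cutoff_le 2 N) (box N)
  refine (abs_add_le _ _).trans (add_le_add ((abs_sub _ _).trans (add_le_add h1 h2)) h3)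

end FData


open ComplexConjugate Set

/-! ### Energies along curves -/

/-- The weighted energy of `a` over `S`. -/
noncomputable def energy (μ : ℤ × ℤ → ℝ) (S : Finset (ℤ × ℤ)) (a : ℤ × ℤ → ℂ) : ℝ :=
  ∑ k ∈ S, μ k ^ 2 * ‖a k‖ ^ 2

lemma energy_nonneg (μ : ℤ × ℤ → ℝ) (S : Finset (ℤ × ℤ)) (a : ℤ × ℤ → ℂ) : 0 ≤ energy μ S a :=
  Finset.sum_nonneg fun _ _ => by positivity

lemma SobBd.energy_le {s : ℕ} {a : ℤ × ℤ → ℂ} {A : ℝ} (h : SobBd s a A) (N : ℕ)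
    (S : Finset (ℤ × ℤ)) : energy (cutoff s N) S a ≤ A ^ 2 := by
  refine le_trans (Finset.sum_le_sum fun k _ => ?_) (h.2 S)
  rw [mul_pow]
  have := cutoff_le s N k
  have := cutoff_nonneg s N k
  gcongr

lemma SobBd.of_energy_le {s : ℕ} {a : ℤ × ℤ → ℂ} {E : ℝ}
    (h : ∀ N, energy (cutoff s N) (box N) a ≤ E) : SobBd s a (√E) := by
  have hE : 0 ≤ E := (energy_nonneg _ _ _).trans (h 0)
  refine ⟨Real.sqrt_nonneg _, fun S => ?_⟩
  rw [Real.sq_sqrt hE]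
  have ht : Tendsto (fun N => energy (cutoff s N) S a) atTop
      (𝓝 (∑ k ∈ S, (wt k ^ s * ‖a k‖) ^ 2)) := by
    simp_rw [energy, mul_pow]
    exact tendsto_finsetSum _ fun k _ => ((tendsto_cutoff s k).pow 2).mul_const _
  refine le_of_tendsto ht ?_
  have hS : ∀ᶠ N in atTop, ∀ k ∈ S, k ∈ box N :=
    (Finset.eventually_all S).2 fun k _ => eventually_mem_box k
  filter_upwards [hS] with N hN
  exact (Finset.sum_le_sum_of_subset_of_nonneg hN fun _ _ _ => by positivity).trans (h N)

lemma tendsto_energy {s : ℕ} {a : ℤ × ℤ → ℂ} {A : ℝ} (h : SobBd s a A) :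
    Tendsto (fun N => energy (cutoff s N) (box N) a) atTop
      (𝓝 (∑' k, (wt k ^ s * ‖a k‖) ^ 2)) := by
  have he : ∀ N, energy (cutoff s N) (box N) a = ∑' k, cutoff s N k ^ 2 * ‖a k‖ ^ 2 := fun N =>
    (tsum_eq_sum fun k hk => by simp [cutoff_of_notMem hk]).symm
  simp_rw [he]
  refine tendsto_tsum_of_dominated_convergence h.summable (fun k => ?_)
    (Eventually.of_forall fun N k => ?_)
  · simp_rw [mul_pow]
    exact ((tendsto_cutoff s k).pow 2).mul_const _
  · have := cutoff_le s N k
    have := cutoff_nonneg s N k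
    rw [Real.norm_of_nonneg (by positivity), mul_pow]
    gcongr

lemma hasDerivWithinAt_energy (μ : ℤ × ℤ → ℝ) (S : Finset (ℤ × ℤ)) {c : ℝ → ℤ × ℤ → ℂ}
    {c' : ℤ × ℤ → ℂ} {I : Set ℝ} {t : ℝ}
    (h : ∀ k, HasDerivWithinAt (fun s => c s k) (c' k) I t) :
    HasDerivWithinAt (fun s => energy μ S (c s)) (2 * epair μ S (c t) c') I t := by
  have h1 : HasDerivWithinAt (fun s => energy μ S (c s))
      (∑ k ∈ S, μ k ^ 2 * (2 * inner ℝ (c t k) (c' k))) I t :=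
    HasDerivWithinAt.fun_sum fun k _ => (h k).norm_sq.const_mul _
  refine h1.congr_deriv ?_
  rw [epair, Finset.mul_sum]
  refine Finset.sum_congr rfl fun k _ => ?_
  rw [Complex.inner, mul_comm (c' k)]; ring

/-- Convergence of coefficients and of norms implies convergence in norm. -/
lemma tendsto_tsum_sub_of_tendsto {ι : Type*} {l : Filter ι} {s : ℕ} {a : ι → ℤ × ℤ → ℂ}
    {a₀ : ℤ × ℤ → ℂ} (hs : ∀ᶠ i in l, Summable fun k => (wt k ^ s * ‖a i k‖) ^ 2)
    (hs₀ : Summable fun k => (wt k ^ s * ‖a₀ k‖) ^ 2)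
    (hk : ∀ k, Tendsto (fun i => a i k) l (𝓝 (a₀ k)))
    (hE : Tendsto (fun i => ∑' k, (wt k ^ s * ‖a i k‖) ^ 2) l
      (𝓝 (∑' k, (wt k ^ s * ‖a₀ k‖) ^ 2))) :
    Tendsto (fun i => ∑' k, (wt k ^ s * ‖a i k - a₀ k‖) ^ 2) l (𝓝 0) := by
  rw [Metric.tendsto_nhds]
  intro η hη
  obtain ⟨S, hS⟩ := ((hs₀.hasSum.eventually (lt_mem_nhds (sub_lt_self _ (by linarith :
    0 < η / 4)))).exists)
  -- By the parallelogram bound the quantity 2|aᵢ|² + 2|a₀|² - |aᵢ - a₀|² is non-negative, so its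
  -- full sum is at least its sum over S. Thus h bounds the sum to be estimated, while its limit is
  -- four times the tail of a₀ outside S, which is below η.
  set h : ι → ℝ := fun i => ∑ k ∈ S, ((wt k ^ s * ‖a i k - a₀ k‖) ^ 2
    - 2 * (wt k ^ s * ‖a i k‖) ^ 2 - 2 * (wt k ^ s * ‖a₀ k‖) ^ 2)
    + 2 * (∑' k, (wt k ^ s * ‖a i k‖) ^ 2) + 2 * ∑' k, (wt k ^ s * ‖a₀ k‖) ^ 2 with hh
  have hlim : Tendsto h l (𝓝 (∑ k ∈ S, ((wt k ^ s * ‖a₀ k - a₀ k‖) ^ 2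
    - 2 * (wt k ^ s * ‖a₀ k‖) ^ 2 - 2 * (wt k ^ s * ‖a₀ k‖) ^ 2)
    + 2 * (∑' k, (wt k ^ s * ‖a₀ k‖) ^ 2) + 2 * ∑' k, (wt k ^ s * ‖a₀ k‖) ^ 2)) := by
    refine ((tendsto_finsetSum _ fun k _ => ?_).add (hE.const_mul 2)).add tendsto_const_nhds
    exact (((((hk k).sub_const _).norm.const_mul _).pow 2).sub
      ((((hk k).norm.const_mul _).pow 2).const_mul 2)).sub tendsto_const_nhds
  have hval : ∑ k ∈ S, ((wt k ^ s * ‖a₀ k - a₀ k‖) ^ 2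
    - 2 * (wt k ^ s * ‖a₀ k‖) ^ 2 - 2 * (wt k ^ s * ‖a₀ k‖) ^ 2)
    + 2 * (∑' k, (wt k ^ s * ‖a₀ k‖) ^ 2) + 2 * ∑' k, (wt k ^ s * ‖a₀ k‖) ^ 2 < η := by
    have : ∑ k ∈ S, ((wt k ^ s * ‖a₀ k - a₀ k‖) ^ 2
        - 2 * (wt k ^ s * ‖a₀ k‖) ^ 2 - 2 * (wt k ^ s * ‖a₀ k‖) ^ 2) =
        -4 * ∑ k ∈ S, (wt k ^ s * ‖a₀ k‖) ^ 2 := by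
      rw [Finset.mul_sum]
      refine Finset.sum_congr rfl fun k _ => ?_
      rw [sub_self, norm_zero]; ring
    rw [this]; linarith
  filter_upwards [hlim.eventually (gt_mem_nhds hval), hs] with i hi hsi
  have hpar : ∀ k, (wt k ^ s * ‖a i k - a₀ k‖) ^ 2 ≤
      2 * (wt k ^ s * ‖a i k‖) ^ 2 + 2 * (wt k ^ s * ‖a₀ k‖) ^ 2 := fun k => by
    have h1 := norm_sub_le (a i k) (a₀ k)
    have h2 : (0 : ℝ) ≤ wt k ^ s := pow_nonneg (wt_pos k).le _
    have : wt k ^ s * ‖a i k - a₀ k‖ ≤ wt k ^ s * ‖a i k‖ + wt k ^ s * ‖a₀ k‖ := by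
      rw [← mul_add]; gcongr
    nlinarith [sq_nonneg (wt k ^ s * ‖a i k‖ - wt k ^ s * ‖a₀ k‖),
      mul_nonneg h2 (norm_nonneg (a i k - a₀ k))]
  have hsum2 : Summable fun k => 2 * (wt k ^ s * ‖a i k‖) ^ 2 + 2 * (wt k ^ s * ‖a₀ k‖) ^ 2 :=
    (hsi.mul_left 2).add (hs₀.mul_left 2)
  have hsd := Summable.of_nonneg_of_le (fun k => sq_nonneg (wt k ^ s * ‖a i k - a₀ k‖)) hpar hsum2
  rw [Real.dist_eq, sub_zero, abs_of_nonneg (tsum_nonneg fun _ => sq_nonneg _)]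
  refine lt_of_le_of_lt ?_ hi
  have h0 := (hsum2.sub hsd).sum_le_tsum S fun k _ => sub_nonneg.2 (hpar k)
  rw [hsum2.tsum_sub hsd, (hsi.mul_left 2).tsum_add (hs₀.mul_left 2), tsum_mul_left,
    tsum_mul_left] at h0
  have h1 : ∑ k ∈ S, ((wt k ^ s * ‖a i k - a₀ k‖) ^ 2
      - 2 * (wt k ^ s * ‖a i k‖) ^ 2 - 2 * (wt k ^ s * ‖a₀ k‖) ^ 2) =
      -∑ k ∈ S, (2 * (wt k ^ s * ‖a i k‖) ^ 2 + 2 * (wt k ^ s * ‖a₀ k‖) ^ 2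
        - (wt k ^ s * ‖a i k - a₀ k‖) ^ 2) := by
    rw [← Finset.sum_neg_distrib]
    exact Finset.sum_congr rfl fun k _ => by ring
  rw [hh]; dsimp only
  rw [h1]; linarith

/-! ### Approximate solutions -/

/-- `(b, ω)` solves the system on `[0, T]` up to errors `(eb, eω)` and has norm at most `R`. -/
structure ApproxSol (D : FData) (T R : ℝ) (b ω eb eω : ℝ → ℤ × ℤ → ℂ) : Prop where
  bdB : ∀ t ∈ Icc 0 T, SobBd 3 (b t) R
  bdW : ∀ t ∈ Icc 0 T, SobBd 2 (ω t) R
  hermB : ∀ t ∈ Icc 0 T, Herm (b t)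
  hermW : ∀ t ∈ Icc 0 T, Herm (ω t)
  derivB : ∀ t ∈ Icc 0 T, ∀ k,
    HasDerivWithinAt (fun s => b s k) (D.rhsB (b t) (ω t) k + eb t k) (Icc 0 T) t
  derivW : ∀ t ∈ Icc 0 T, ∀ k,
    HasDerivWithinAt (fun s => ω s k) (D.rhsW (b t) (ω t) k + eω t k) (Icc 0 T) t

/-- `(b, ω)` solves the system on `[0, T]` and has norm at most `R`. -/
def IsSol (D : FData) (T R : ℝ) (b ω : ℝ → ℤ × ℤ → ℂ) : Prop :=
  ApproxSol D T R b ω (fun _ _ => 0) (fun _ _ => 0)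

/-- The full energy need not be differentiable term by term. The regularised energies are Lipschitz
with the common constant 2K, and their pointwise limit inherits it. -/
lemma continuousOn_tsum_of_energy_rate {s : ℕ} {T R K : ℝ} {c c' : ℝ → ℤ × ℤ → ℂ}
    (hc : ∀ t ∈ Icc 0 T, SobBd s (c t) R)
    (hd : ∀ t ∈ Icc 0 T, ∀ k, HasDerivWithinAt (fun s => c s k) (c' t k) (Icc 0 T) t)
    (hK : ∀ t ∈ Icc 0 T, ∀ N, |epair (cutoff s N) (box N) (c t) (c' t)| ≤ K) :
    ContinuousOn (fun t => ∑' k, (wt k ^ s * ‖c t k‖) ^ 2) (Icc 0 T) := by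
  have hlip : ∀ t ∈ Icc 0 T, ∀ r ∈ Icc 0 T,
      ‖(∑' k, (wt k ^ s * ‖c t k‖) ^ 2) - ∑' k, (wt k ^ s * ‖c r k‖) ^ 2‖ ≤ 2 * K * ‖t - r‖ := by
    intro t ht r hr
    refine le_of_tendsto ((tendsto_energy (hc t ht)).sub (tendsto_energy (hc r hr))).norm
      (Eventually.of_forall fun N => ?_)
    refine Convex.norm_image_sub_le_of_norm_hasDerivWithin_le
      (f := fun t => energy (cutoff s N) (box N) (c t))
      (fun x hx => hasDerivWithinAt_energy _ _ (hd x hx)) (fun x hx => ?_) (convex_Icc 0 T) hr ht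
    rw [Real.norm_eq_abs, abs_mul, abs_two]
    linarith [hK x hx N]
  have hK0 : ∀ t ∈ Icc 0 T, 0 ≤ K := fun t ht => (abs_nonneg _).trans (hK t ht 0)
  -- Non-negativity of K is available only at a point of the interval, so the empty interval is
  -- treated apart.
  rcases (Icc 0 T).eq_empty_or_nonempty with he | ⟨t₀, ht₀⟩
  · rw [he]; exact continuousOn_empty _
  have hK0 := hK0 t₀ ht₀
  refine (LipschitzOnWith.of_dist_le_mul (K := ⟨2 * K, by positivity⟩) fun t ht r hr => ?_).continuousOn
  rw [dist_eq_norm, dist_eq_norm]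
  exact hlip t ht r hr

/-- Solutions are continuous in the strong topology. -/
lemma IsSol.tendsto_sub {D : FData} {T R : ℝ} {b ω : ℝ → ℤ × ℤ → ℂ} (h : IsSol D T R b ω)
    {t : ℝ} (ht : t ∈ Icc 0 T) :
    Tendsto (fun r => ∑' k, (wt k ^ 3 * ‖b r k - b t k‖) ^ 2) (𝓝[Icc 0 T] t) (𝓝 0) ∧
      Tendsto (fun r => ∑' k, (wt k ^ 2 * ‖ω r k - ω t k‖) ^ 2) (𝓝[Icc 0 T] t) (𝓝 0) := by
  constructor
  · refine tendsto_tsum_sub_of_tendsto (eventually_mem_nhdsWithin.mono fun r hr =>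
      (h.bdB r hr).summable) (h.bdB t ht).summable
      (fun k => (h.derivB t ht k).continuousWithinAt.tendsto) ?_
    refine continuousOn_tsum_of_energy_rate h.bdB h.derivB
      (K := D.CT * ((R + D.F) * R ^ 2)) (fun r hr N => ?_) t ht
    simp only [add_zero]
    exact FData.abs_epair_rhsB_le N (h.hermW r hr) (h.bdB r hr) (h.bdW r hr)
  · refine tendsto_tsum_sub_of_tendsto (eventually_mem_nhdsWithin.mono fun r hr =>
      (h.bdW r hr).summable) (h.bdW t ht).summable
      (fun k => (h.derivW t ht k).continuousWithinAt.tendsto) ?_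
    refine continuousOn_tsum_of_energy_rate h.bdW h.derivW
      (K := D.CT * ((R + D.F) * R ^ 2) + R * (D.CT * ((R + D.F) * R)) + R * (D.CU * R))
      (fun r hr N => ?_) t ht
    simp only [add_zero]
    exact FData.abs_epair_rhsW_le N (h.hermW r hr) (h.bdB r hr) (h.bdW r hr)

/-- The growth rate in the stability estimate. -/
noncomputable def FData.stabRate (D : FData) (R : ℝ) : ℝ :=
  2 * (3 * D.CT * R + 3 * D.CT * (R + D.F) + D.CU + 2)

namespace ApproxSol

variable {D : FData} {T R ε : ℝ} {b ω eb eω b' ω' eb' eω' : ℝ → ℤ × ℤ → ℂ}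

/-- The differential inequality for the difference of two approximate solutions. -/
lemma rate_le (h : ApproxSol D T R b ω eb eω) (h' : ApproxSol D T R b' ω' eb' eω') {t : ℝ}
    (ht : t ∈ Icc 0 T) (heb : SobBd 1 (eb t) ε) (heω : SobBd 0 (eω t) ε)
    (heb' : SobBd 1 (eb' t) ε) (heω' : SobBd 0 (eω' t) ε) {Y : ℝ}
    (hY : SobBd 1 (fun k => b t k - b' t k) Y) (hY' : SobBd 0 (fun k => ω t k - ω' t k) Y)
    (N : ℕ) :
    2 * epair (cutoff 1 N) (box N) (fun k => b t k - b' t k)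
      (fun k => (D.rhsB (b t) (ω t) k + eb t k) - (D.rhsB (b' t) (ω' t) k + eb' t k)) +
    2 * epair (cutoff 0 N) (box N) (fun k => ω t k - ω' t k)
      (fun k => (D.rhsW (b t) (ω t) k + eω t k) - (D.rhsW (b' t) (ω' t) k + eω' t k)) ≤
    D.stabRate R * Y ^ 2 + 4 * ε ^ 2 := by
  have hb := h.bdB t ht
  have hω := h.bdW t ht
  have hb' := h'.bdB t ht
  have hω' := h'.bdW t ht
  have hb2 := hb.mono_order (by norm_num : 2 ≤ 3)
  have hb2' := hb'.mono_order (by norm_num : 2 ≤ 3)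
  have hζ := hω.sub D.f_bd
  have hζ' := hω'.sub D.f_bd
  have hs' := (h'.hermW t ht).sub D.f_herm
  have hδω := hω.sub hω'
  -- The difference of two bilinear terms is split so that each piece contains one difference. The
  -- bathymetry f cancels in the vorticity slot.
  have key : ∀ {c c' : ℤ × ℤ → ℂ} {C C' : ℝ}, SobBd 2 c C → SobBd 2 c' C' → ∀ k,
      D.trans (fun k => ω t k - D.f k) c k - D.trans (fun k => ω' t k - D.f k) c' k =
      D.trans (fun k => ω t k - ω' t k) c k +
        D.trans (fun k => ω' t k - D.f k) (fun k => c k - c' k) k := by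
    intro c c' C C' hc hc' k
    rw [FData.trans_sub_right hζ' hc hc']
    have := FData.trans_sub_left (D := D) hζ hζ' hc k
    simp only [sub_sub_sub_cancel_right] at this
    rw [this]; ring
  have e1 : (fun k => (D.rhsB (b t) (ω t) k + eb t k) - (D.rhsB (b' t) (ω' t) k + eb' t k)) =
      fun k => -(D.trans (fun k => ω t k - ω' t k) (b t) k +
        D.trans (fun k => ω' t k - D.f k) (fun k => b t k - b' t k) k) + (eb t k - eb' t k) := by
    funext k
    rw [← key hb2 hb2', FData.rhsB, FData.rhsB]; ring
  have e2 : (fun k => (D.rhsW (b t) (ω t) k + eω t k) - (D.rhsW (b' t) (ω' t) k + eω' t k)) =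
      fun k => -(D.trans (fun k => ω t k - ω' t k) (fun k => ω t k - b t k) k +
        D.trans (fun k => ω' t k - D.f k) (fun k => ω t k - ω' t k) k -
        D.trans (fun k => ω' t k - D.f k) (fun k => b t k - b' t k) k +
        D.forcing (fun k => b t k - b' t k) k) + (eω t k - eω' t k) := by
    funext k
    have h1 := key (hω.sub hb2) (hω'.sub hb2') k
    have h2 := FData.trans_sub_right (D := D) hζ' hδω (hb2.sub hb2') k
    have h3 : (fun k => ω t k - ω' t k - (b t k - b' t k)) =
        fun k => ω t k - b t k - (ω' t k - b' t k) := by funext k; ring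
    rw [h3] at h2
    rw [FData.forcing_sub (hb.mono_order (by norm_num)) (hb'.mono_order (by norm_num)),
      FData.rhsW, FData.rhsW]
    linear_combination -h1 - h2
  rw [e1, e2]
  simp only [epair_add, epair_sub, epair_neg]
  have a1 := abs_le.1 (abs_epair_le hY (FData.trans_bound_one (D := D) hY' hb) (abs_cutoff_le 1 N) (box N))
  have a2 := abs_le.1 (FData.abs_epair_trans_le (D := D) (by norm_num : 1 ≤ 3) N hs' hζ' hY)
  have a3 := abs_le.1 (abs_epair_le hY heb (abs_cutoff_le 1 N) (box N))
  have a3' := abs_le.1 (abs_epair_le hY heb' (abs_cutoff_le 1 N) (box N))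
  have c1 := abs_le.1 (abs_epair_le hY' (FData.trans_bound_zero (D := D) hY' (hω.sub hb2))
    (abs_cutoff_le 0 N) (box N))
  have c2 := abs_le.1 (FData.abs_epair_trans_le (D := D) (by norm_num : 0 ≤ 3) N hs' hζ' hY')
  have c3 := abs_le.1 (abs_epair_le hY' (FData.trans_bound_zero' (D := D) hζ' hY)
    (abs_cutoff_le 0 N) (box N))
  have c4 := abs_le.1 (abs_epair_le hY' (FData.forcing_bound_zero (D := D) hY)
    (abs_cutoff_le 0 N) (box N))
  have c5 := abs_le.1 (abs_epair_le hY' heω (abs_cutoff_le 0 N) (box N))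
  have c5' := abs_le.1 (abs_epair_le hY' heω' (abs_cutoff_le 0 N) (box N))
  -- Four error pairings of size Yε enter, each doubled; 8Yε ≤ 4Y² + 4ε² accounts for the summand 2
  -- in `FData.stabRate` and for 4ε².
  have q : 2 * (Y * ε) ≤ Y ^ 2 + ε ^ 2 := by nlinarith [sq_nonneg (Y - ε)]
  unfold FData.stabRate
  nlinarith [a1.1, a2.1, a3.2, a3'.1, c1.1, c2.1, c3.2, c4.1, c5.2, c5'.1]

end ApproxSol


lemma SobBd.of_tendsto_radius {s : ℕ} {a : ℤ × ℤ → ℂ} {R : ℕ → ℝ} {R₀ : ℝ}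
    (hR : Tendsto R atTop (𝓝 R₀)) (h : ∀ n, SobBd s a (R n)) : SobBd s a R₀ :=
  ⟨ge_of_tendsto' hR fun n => (h n).1, fun S => ge_of_tendsto' (hR.pow 2) fun n => (h n).2 S⟩

namespace ApproxSol

variable {D : FData} {T R ε : ℝ} {b ω eb eω b' ω' eb' eω' : ℝ → ℤ × ℤ → ℂ}

/-- Two approximate solutions that are initially within `ε` remain within a multiple of `ε`. -/
lemma stability (hT : 0 < T) (h : ApproxSol D T R b ω eb eω)
    (h' : ApproxSol D T R b' ω' eb' eω')
    (heb : ∀ t ∈ Icc 0 T, SobBd 1 (eb t) ε) (heω : ∀ t ∈ Icc 0 T, SobBd 0 (eω t) ε)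
    (heb' : ∀ t ∈ Icc 0 T, SobBd 1 (eb' t) ε) (heω' : ∀ t ∈ Icc 0 T, SobBd 0 (eω' t) ε)
    (h0 : SobBd 1 (fun k => b 0 k - b' 0 k) ε) (h0' : SobBd 0 (fun k => ω 0 k - ω' 0 k) ε)
    {t : ℝ} (ht : t ∈ Icc 0 T) :
    SobBd 1 (fun k => b t k - b' t k) (√(2 * (2 + 4 * T) * Real.exp (2 * D.stabRate R * T)) * ε) ∧
    SobBd 0 (fun k => ω t k - ω' t k)
      (√(2 * (2 + 4 * T) * Real.exp (2 * D.stabRate R * T)) * ε) := by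
  have hε : 0 ≤ ε := h0.1
  have hz : (0 : ℝ) ∈ Icc 0 T := ⟨le_rfl, hT.le⟩
  have hR : 0 ≤ R := (h.bdB 0 hz).1
  set κ := D.stabRate R with hκ
  have hκ0 : 0 < κ := by
    have := D.CT_nonneg; have := D.CU_nonneg; have := D.f_bd.1
    rw [hκ, FData.stabRate]; positivity
  set A : ℝ := (2 + 4 * T) * ε ^ 2 with hA
  have hA0 : 0 ≤ A := by positivity
  -- The rate of a regularised energy is controlled only by the full norm, so Gronwall's inequality
  -- is not directly applicable. Instead a bound Z exp(2κt) assumed for both squared norms is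
  -- inserted into the rate and integrated; the exponent 2κ makes the term κZ exp(2κt) integrate to
  -- at most half the assumed bound.
  have step : ∀ Z : ℝ, 0 ≤ Z →
      (∀ t ∈ Icc 0 T, SobBd 1 (fun k => b t k - b' t k) (√(Z * Real.exp (2 * κ * t))) ∧
        SobBd 0 (fun k => ω t k - ω' t k) (√(Z * Real.exp (2 * κ * t)))) →
      ∀ t ∈ Icc 0 T, SobBd 1 (fun k => b t k - b' t k) (√((A + Z / 2) * Real.exp (2 * κ * t))) ∧
        SobBd 0 (fun k => ω t k - ω' t k) (√((A + Z / 2) * Real.exp (2 * κ * t))) := by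
    intro Z hZ hP t ht
    have hen : ∀ N, energy (cutoff 1 N) (box N) (fun k => b t k - b' t k) +
        energy (cutoff 0 N) (box N) (fun k => ω t k - ω' t k) ≤
        (A + Z / 2) * Real.exp (2 * κ * t) := by
      intro N
      have hd : ∀ x ∈ Icc 0 T, HasDerivWithinAt
          (fun x => energy (cutoff 1 N) (box N) (fun k => b x k - b' x k) +
            energy (cutoff 0 N) (box N) (fun k => ω x k - ω' x k)) _ (Icc 0 T) x := fun x hx =>
        (hasDerivWithinAt_energy (cutoff 1 N) (box N)
          fun k => (h.derivB x hx k).sub (h'.derivB x hx k)).add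
        (hasDerivWithinAt_energy (cutoff 0 N) (box N)
          fun k => (h.derivW x hx k).sub (h'.derivW x hx k))
      have hB : ∀ x : ℝ, HasDerivAt
          (fun x => 2 * ε ^ 2 + 4 * ε ^ 2 * x + Z / 2 * Real.exp (2 * κ * x))
          (4 * ε ^ 2 + κ * (Z * Real.exp (2 * κ * x))) x := by
        intro x
        have h1 := (((hasDerivAt_id x).const_mul (2 * κ)).exp).const_mul (Z / 2)
        have h2 := ((hasDerivAt_id x).const_mul (4 * ε ^ 2)).const_add (2 * ε ^ 2)
        refine (h2.add h1).congr_deriv ?_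
        simp only [id]; ring
      have hle := image_le_of_deriv_right_le_deriv_boundary
        (fun x hx => (hd x hx).continuousWithinAt)
        (fun x hx => (hd x (Ico_subset_Icc_self hx)).mono_of_mem_nhdsWithin
          (Icc_mem_nhdsGE_of_mem hx))
        (B := fun x => 2 * ε ^ 2 + 4 * ε ^ 2 * x + Z / 2 * Real.exp (2 * κ * x))
        (B' := fun x => 4 * ε ^ 2 + κ * (Z * Real.exp (2 * κ * x)))
        ?_ (fun x _ => (hB x).continuousAt.continuousWithinAt)
        (fun x _ => (hB x).hasDerivWithinAt) (fun x hx => ?_) ht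
      · refine hle.trans ?_
        have h1 : 1 ≤ Real.exp (2 * κ * t) := by
          have := ht.1
          rw [← Real.exp_zero]; exact Real.exp_le_exp.2 (by positivity)
        have h2 : 2 * ε ^ 2 + 4 * ε ^ 2 * t ≤ A := by
          rw [hA]; nlinarith [ht.2, sq_nonneg ε]
        nlinarith
      · have h1 := h0.energy_le N (box N)
        have h2 := h0'.energy_le N (box N)
        simp only [mul_zero, Real.exp_zero]
        linarith
      · have hx' := Ico_subset_Icc_self hx
        have h1 := rate_le h h' hx' (heb x hx') (heω x hx') (heb' x hx') (heω' x hx')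
          (hP x hx').1 (hP x hx').2 N
        rw [Real.sq_sqrt (by positivity)] at h1
        exact h1.trans (by rw [add_comm])
    exact ⟨SobBd.of_energy_le fun N => le_trans
        (le_add_of_nonneg_right (energy_nonneg _ _ _)) (hen N),
      SobBd.of_energy_le fun N => le_trans (le_add_of_nonneg_left (energy_nonneg _ _ _)) (hen N)⟩
  -- The map Z ↦ A + Z/2 has fixed point 2A. The iteration starts from the crude bound 2R for both
  -- differences, whose square is the summand 4R² that is halved at every stage.
  have iter : ∀ n : ℕ, ∀ t ∈ Icc 0 T,
      SobBd 1 (fun k => b t k - b' t k)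
        (√((2 * A + 4 * R ^ 2 / 2 ^ n) * Real.exp (2 * κ * t))) ∧
      SobBd 0 (fun k => ω t k - ω' t k)
        (√((2 * A + 4 * R ^ 2 / 2 ^ n) * Real.exp (2 * κ * t))) := by
    intro n
    induction n with
    | zero =>
      intro t ht
      have h1 : 1 ≤ Real.exp (2 * κ * t) := by
        have := ht.1
        rw [← Real.exp_zero]; exact Real.exp_le_exp.2 (by positivity)
      have h2 : R + R ≤ √((2 * A + 4 * R ^ 2 / 2 ^ 0) * Real.exp (2 * κ * t)) := by
        refine Real.le_sqrt_of_sq_le ?_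
        rw [pow_zero, div_one]
        nlinarith [sq_nonneg R]
      exact ⟨(((h.bdB t ht).sub (h'.bdB t ht)).mono_order (by norm_num)).mono h2,
        (((h.bdW t ht).sub (h'.bdW t ht)).mono_order (by norm_num)).mono h2⟩
    | succ n ih =>
      have := step _ (by positivity) ih
      have e : A + (2 * A + 4 * R ^ 2 / 2 ^ n) / 2 = 2 * A + 4 * R ^ 2 / 2 ^ (n + 1) := by
        rw [pow_succ]; field_simp; ring
      rwa [e] at this
  have hlim : Tendsto (fun n : ℕ => √((2 * A + 4 * R ^ 2 / 2 ^ n) * Real.exp (2 * κ * t))) atTop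
      (𝓝 (√((2 * A + 0) * Real.exp (2 * κ * t)))) := by
    refine ((tendsto_const_nhds.add ?_).mul_const _).sqrt
    exact tendsto_const_nhds.div_atTop (tendsto_pow_atTop_atTop_of_one_lt one_lt_two)
  have hfin : √((2 * A + 0) * Real.exp (2 * κ * t)) ≤
      √(2 * (2 + 4 * T) * Real.exp (2 * κ * T)) * ε := by
    refine Real.sqrt_le_iff.2 ⟨by positivity, ?_⟩
    rw [mul_pow, Real.sq_sqrt (by positivity), hA, add_zero]
    have : Real.exp (2 * κ * t) ≤ Real.exp (2 * κ * T) := by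
      have := ht.2
      gcongr
    calc 2 * ((2 + 4 * T) * ε ^ 2) * Real.exp (2 * κ * t)
        ≤ 2 * ((2 + 4 * T) * ε ^ 2) * Real.exp (2 * κ * T) := by gcongr
      _ = _ := by ring
  exact ⟨(SobBd.of_tendsto_radius hlim fun n => (iter n t ht).1).mono hfin,
    (SobBd.of_tendsto_radius hlim fun n => (iter n t ht).2).mono hfin⟩

end ApproxSol

lemma IsSol.mono_radius {D : FData} {T R R' : ℝ} {b ω : ℝ → ℤ × ℤ → ℂ} (h : IsSol D T R b ω)
    (hR : R ≤ R') : IsSol D T R' b ω :=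
  ⟨fun t ht => (h.bdB t ht).mono hR, fun t ht => (h.bdW t ht).mono hR, h.hermB, h.hermW,
    h.derivB, h.derivW⟩

lemma IsSol.mono_time {D : FData} {T T' R : ℝ} {b ω : ℝ → ℤ × ℤ → ℂ} (h : IsSol D T R b ω)
    (hT : T' ≤ T) : IsSol D T' R b ω := by
  have hsub : Icc 0 T' ⊆ Icc 0 T := Icc_subset_Icc_right hT
  exact ⟨fun t ht => h.bdB t (hsub ht), fun t ht => h.bdW t (hsub ht),
    fun t ht => h.hermB t (hsub ht), fun t ht => h.hermW t (hsub ht),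
    fun t ht k => (h.derivB t (hsub ht) k).mono hsub,
    fun t ht k => (h.derivW t (hsub ht) k).mono hsub⟩

/-- Solutions are determined by their initial values. -/
lemma IsSol.unique {D : FData} {T R R' : ℝ} {b ω b' ω' : ℝ → ℤ × ℤ → ℂ} (hT : 0 < T)
    (h : IsSol D T R b ω) (h' : IsSol D T R' b' ω') (hb : b 0 = b' 0) (hω : ω 0 = ω' 0)
    {t : ℝ} (ht : t ∈ Icc 0 T) : b t = b' t ∧ ω t = ω' t := by
  have h1 := h.mono_radius (le_max_left R R')
  have h2 := h'.mono_radius (le_max_right R R')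
  have := ApproxSol.stability (ε := 0) hT h1 h2 (fun _ _ => SobBd.zero) (fun _ _ => SobBd.zero)
    (fun _ _ => SobBd.zero) (fun _ _ => SobBd.zero)
    (by simpa [hb] using SobBd.zero) (by simpa [hω] using SobBd.zero) ht
  rw [mul_zero] at this
  constructor
  · funext k
    exact sub_eq_zero.1 (norm_le_zero_iff.1 (this.1.norm_le k))
  · funext k
    exact sub_eq_zero.1 (norm_le_zero_iff.1 (this.2.norm_le k))

/-! ### Continuous dependence of the right-hand sides on the coefficients -/

/-- If the coefficients converge and stay bounded, so do convolutions. -/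
lemma tendsto_kconv {ι : Type*} {l : Filter ι} {κ : ℤ × ℤ → ℤ × ℤ → ℂ} {k : ℤ × ℤ} {p : ℕ}
    {C A B : ℝ} (hC : ∀ m, ‖κ k m‖ ≤ C * wt (k - m) ^ p) (hC0 : 0 ≤ C) {a b : ι → ℤ × ℤ → ℂ}
    {a₀ b₀ : ℤ × ℤ → ℂ}
    (ha : ∀ᶠ i in l, SobBd (2 + p) (a i) A) (hb : ∀ᶠ i in l, SobBd 2 (b i) B)
    (hak : ∀ k, Tendsto (fun i => a i k) l (𝓝 (a₀ k)))
    (hbk : ∀ k, Tendsto (fun i => b i k) l (𝓝 (b₀ k))) :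
    Tendsto (fun i => kconv κ (a i) (b i) k) l (𝓝 (kconv κ a₀ b₀ k)) := by
  have hbd : Summable fun m => C * (4 * wt k ^ 2 * A * B) * (wt m ^ 4)⁻¹ :=
    summable_wt.mul_left _
  refine tendsto_tsum_of_dominated_convergence hbd
    (fun m => ((hak (k - m)).mul (hbk m)).const_mul _) ?_
  filter_upwards [ha, hb] with i hai hbi m
  have h1 := hai.le (k - m)
  have h2 := hbi.le m
  have hw := wt_pos m
  have hd := wt_pos (k - m)
  have hk := wt_pos k
  have hwm := wt_le_mul k m
  have hA := hai.1
  have hB := hbi.1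
  -- For fixed k, powers of `wt m` can be traded for powers of `wt (k - m)`. Two of the four powers
  -- of the majorant `wt m ^ (-4)` come from b, the other two from a, whose remaining p orders
  -- absorb the kernel.
  have h3 : wt m ^ 2 ≤ (2 * (wt (k - m) * wt k)) ^ 2 := by gcongr
  rw [norm_mul, norm_mul, ← div_eq_mul_inv, le_div_iff₀ (by positivity)]
  calc ‖κ k m‖ * (‖a i (k - m)‖ * ‖b i m‖) * wt m ^ 4
      ≤ C * wt (k - m) ^ p * (‖a i (k - m)‖ * ‖b i m‖) * wt m ^ 4 := by
        have := hC m
        gcongr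
    _ = C * (wt (k - m) ^ p * ‖a i (k - m)‖ * (wt m ^ 2 * ‖b i m‖) * wt m ^ 2) := by ring
    _ ≤ C * (wt (k - m) ^ p * ‖a i (k - m)‖ * B * (2 * (wt (k - m) * wt k)) ^ 2) := by gcongr
    _ = C * (4 * wt k ^ 2 * (wt (k - m) ^ (2 + p) * ‖a i (k - m)‖) * B) := by ring
    _ ≤ C * (4 * wt k ^ 2 * A * B) := by gcongr

namespace FData

variable {D : FData} {ι : Type*} {l : Filter ι} {b ω : ι → ℤ × ℤ → ℂ} {b₀ ω₀ : ℤ × ℤ → ℂ} {R : ℝ}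

lemma tendsto_trans {ζ c : ι → ℤ × ℤ → ℂ} {ζ₀ c₀ : ℤ × ℤ → ℂ} {A B : ℝ}
    (hζ : ∀ᶠ i in l, SobBd 2 (ζ i) A) (hc : ∀ᶠ i in l, SobBd 2 (c i) B)
    (hζk : ∀ k, Tendsto (fun i => ζ i k) l (𝓝 (ζ₀ k)))
    (hck : ∀ k, Tendsto (fun i => c i k) l (𝓝 (c₀ k))) (k : ℤ × ℤ) :
    Tendsto (fun i => D.trans (ζ i) (c i) k) l (𝓝 (D.trans ζ₀ c₀ k)) := by
  refine tendsto_kconv (p := 0) (C := D.CG * (2 * wt k)) (fun m => ?_)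
    (mul_nonneg D.CG_nonneg (by linarith [wt_pos k])) hζ hc hζk hck
  have hd := wt_pos (k - m)
  rw [pow_zero, mul_one, ← mul_le_mul_iff_left₀ hd]
  refine (D.norm_tker_le k m).trans ?_
  rw [mul_assoc]
  refine mul_le_mul_of_nonneg_left ((wt_le_mul k m).trans_eq (by ring)) D.CG_nonneg

lemma tendsto_forcing {B : ℝ} (hb : ∀ᶠ i in l, SobBd 2 (b i) B)
    (hbk : ∀ k, Tendsto (fun i => b i k) l (𝓝 (b₀ k))) (k : ℤ × ℤ) :
    Tendsto (fun i => D.forcing (b i) k) l (𝓝 (D.forcing b₀ k)) := by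
  have hk : ∀ j : ℤ × ℤ → ℤ, (∀ m, |(j m : ℝ)| ≤ wt m) → ∀ m,
      ‖Complex.I * D.ξ * (j m : ℂ)‖ ≤ |D.ξ| * (2 * wt k) * wt (k - m) ^ 1 := by
    intro j hj m
    rw [norm_mul, norm_mul, Complex.norm_I, one_mul, Complex.norm_real, Real.norm_eq_abs,
      Complex.norm_intCast, mul_assoc, pow_one]
    exact mul_le_mul_of_nonneg_left ((hj m).trans ((wt_le_mul k m).trans_eq (by ring)))
      (abs_nonneg _)
  have h0 : 0 ≤ |D.ξ| * (2 * wt k) := by have := wt_pos k; positivity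
  exact (tendsto_kconv (p := 1) (hk _ abs_fst_le_wt) h0 (Eventually.of_forall fun _ => D.v₁_bd) hb
    (fun _ => tendsto_const_nhds) hbk).add
    (tendsto_kconv (p := 1) (hk _ abs_snd_le_wt) h0 (Eventually.of_forall fun _ => D.v₂_bd) hb
    (fun _ => tendsto_const_nhds) hbk)

lemma tendsto_rhsB (hb : ∀ᶠ i in l, SobBd 3 (b i) R) (hω : ∀ᶠ i in l, SobBd 2 (ω i) R)
    (hbk : ∀ k, Tendsto (fun i => b i k) l (𝓝 (b₀ k)))
    (hωk : ∀ k, Tendsto (fun i => ω i k) l (𝓝 (ω₀ k))) (k : ℤ × ℤ) :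
    Tendsto (fun i => D.rhsB (b i) (ω i) k) l (𝓝 (D.rhsB b₀ ω₀ k)) :=
  (tendsto_trans (hω.mono fun _ h => h.sub D.f_bd) (hb.mono fun _ h => h.mono_order (by norm_num))
    (fun k => (hωk k).sub_const _) hbk k).neg

lemma tendsto_rhsW (hb : ∀ᶠ i in l, SobBd 3 (b i) R) (hω : ∀ᶠ i in l, SobBd 2 (ω i) R)
    (hbk : ∀ k, Tendsto (fun i => b i k) l (𝓝 (b₀ k)))
    (hωk : ∀ k, Tendsto (fun i => ω i k) l (𝓝 (ω₀ k))) (k : ℤ × ℤ) :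
    Tendsto (fun i => D.rhsW (b i) (ω i) k) l (𝓝 (D.rhsW b₀ ω₀ k)) := by
  have hb2 : ∀ᶠ i in l, SobBd 2 (b i) R := hb.mono fun _ h => h.mono_order (by norm_num)
  exact ((tendsto_trans (hω.mono fun _ h => h.sub D.f_bd)
    ((hω.and hb2).mono fun _ h => h.1.sub h.2) (fun k => (hωk k).sub_const _)
    (fun k => (hωk k).sub (hbk k)) k).add (tendsto_forcing hb2 hbk k)).neg

lemma continuousOn_rhs {T : ℝ} {b ω : ℝ → ℤ × ℤ → ℂ} (hb : ∀ t ∈ Icc 0 T, SobBd 3 (b t) R)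
    (hω : ∀ t ∈ Icc 0 T, SobBd 2 (ω t) R) (hbc : ∀ k, ContinuousOn (fun t => b t k) (Icc 0 T))
    (hωc : ∀ k, ContinuousOn (fun t => ω t k) (Icc 0 T)) (k : ℤ × ℤ) :
    ContinuousOn (fun t => D.rhsB (b t) (ω t) k) (Icc 0 T) ∧
      ContinuousOn (fun t => D.rhsW (b t) (ω t) k) (Icc 0 T) :=
  ⟨fun t ht => tendsto_rhsB (eventually_mem_nhdsWithin.mono hb) (eventually_mem_nhdsWithin.mono hω)
      (fun k => hbc k t ht) (fun k => hωc k t ht) k,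
    fun t ht => tendsto_rhsW (eventually_mem_nhdsWithin.mono hb)
      (eventually_mem_nhdsWithin.mono hω) (fun k => hbc k t ht) (fun k => hωc k t ht) k⟩

end FData

/-- The integral and the differential form of an evolution equation are equivalent. -/
lemma forall_hasDerivWithinAt_iff {E : Type*} [NormedAddCommGroup E] [NormedSpace ℝ E]
    [CompleteSpace E] {T : ℝ} {x g : ℝ → E} (hg : ContinuousOn g (Icc 0 T)) :
    (∀ t ∈ Icc 0 T, HasDerivWithinAt x (g t) (Icc 0 T) t) ↔
      ∀ t ∈ Icc 0 T, x t = x 0 + ∫ τ in (0 : ℝ)..t, g τ := by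
  constructor
  · intro h t ht
    have hsub : Icc 0 t ⊆ Icc 0 T := Icc_subset_Icc_right ht.2
    have := intervalIntegral.integral_eq_sub_of_hasDeriv_right_of_le ht.1
      (f := x) (f' := g) (fun s hs => (h s (hsub hs)).continuousWithinAt.mono hsub)
      (fun s hs => (h s (hsub (Ioo_subset_Icc_self hs))).mono_of_mem_nhdsWithin
        (mem_nhdsWithin_of_mem_nhds (Icc_mem_nhds hs.1 (hs.2.trans_le ht.2))))
      ((hg.mono (by rw [uIcc_of_le ht.1]; exact hsub)).intervalIntegrable)
    rw [this]; abel
  · intro h t ht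
    have hInt : IntervalIntegrable g volume 0 t :=
      (hg.mono (by rw [uIcc_of_le ht.1]; exact Icc_subset_Icc_right ht.2)).intervalIntegrable
    have : Fact (t ∈ Icc 0 T) := ⟨ht⟩
    have := (intervalIntegral.integral_hasDerivWithinAt_right hInt (s := Icc 0 T) (t := Icc 0 T)
      (hg.stronglyMeasurableAtFilter_nhdsWithin measurableSet_Icc t) (hg t ht)).const_add (x 0)
    exact this.congr h (h t ht)


/-! ### Galerkin approximation -/

/-- A bounded Lipschitz autonomous equation has solutions on every interval. -/
lemma exists_forall_hasDerivWithinAt {E : Type*} [NormedAddCommGroup E] [NormedSpace ℝ E]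
    [CompleteSpace E] {v : E → E} {K : NNReal} (hK : LipschitzWith K v) {M : ℝ}
    (hM : ∀ x, ‖v x‖ ≤ M) (x₀ : E) {T : ℝ} (hT : 0 ≤ T) :
    ∃ α : ℝ → E, α 0 = x₀ ∧ ∀ t ∈ Icc 0 T, HasDerivWithinAt α (v (α t)) (Icc 0 T) t := by
  have hM0 : 0 ≤ M := (norm_nonneg _).trans (hM x₀)
  -- At speed at most M a solution cannot leave the ball of radius M T during [0, T], so one
  -- application of Picard–Lindelöf covers the whole interval.
  have hPL : IsPicardLindelof (fun _ => v) (⟨0, le_rfl, hT⟩ : Icc (0 : ℝ) T) x₀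
      (⟨M * T, mul_nonneg hM0 hT⟩) 0 ⟨M, hM0⟩ K :=
    { lipschitzOnWith := fun _ _ => hK.lipschitzOnWith
      continuousOn := fun _ _ => continuousOn_const
      norm_le := fun _ _ x _ => hM x
      mul_max_le := by
        change M * max (T - 0) (0 - 0) ≤ M * T - 0
        simp [hT] }
  exact hPL.exists_eq_forall_mem_Icc_hasDerivWithinAt₀

section Galerkin

variable {N : ℕ}

/-- Extension by zero of a function on the box. -/
noncomputable def extBox (x : box N → ℂ) (k : ℤ × ℤ) : ℂ :=
  if h : k ∈ box N then x ⟨k, h⟩ else 0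

lemma extBox_of_mem (x : box N → ℂ) {k : ℤ × ℤ} (h : k ∈ box N) : extBox x k = x ⟨k, h⟩ :=
  dif_pos h

lemma extBox_of_notMem (x : box N → ℂ) {k : ℤ × ℤ} (h : k ∉ box N) : extBox x k = 0 :=
  dif_neg h

lemma contDiff_extBox (k : ℤ × ℤ) : ContDiff ℝ 1 fun x : box N → ℂ => extBox x k := by
  by_cases h : k ∈ box N
  · simp_rw [extBox_of_mem _ h]; exact contDiff_apply _ _ _
  · simp_rw [extBox_of_notMem _ h]; exact contDiff_const

lemma contDiff_kconv_extBox {E : Type*} [NormedAddCommGroup E] [NormedSpace ℝ E]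
    (κ : ℤ × ℤ → ℤ × ℤ → ℂ) {a c : E → ℤ × ℤ → ℂ} (ha : ∀ k, ContDiff ℝ 1 fun x => a x k)
    (hc : ∀ k, ContDiff ℝ 1 fun x => c x k) (h0 : ∀ x, ∀ k ∉ box N, c x k = 0) (k : ℤ × ℤ) :
    ContDiff ℝ 1 fun x => kconv κ (a x) (c x) k := by
  have : ∀ x, kconv κ (a x) (c x) k = ∑ m ∈ box N, κ k m * (a x (k - m) * c x m) := fun x =>
    tsum_eq_sum fun m hm => by simp [h0 x m hm]
  simp_rw [this]
  exact ContDiff.sum fun m _ => contDiff_const.mul ((ha _).mul (hc m))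

/-- The state space of the Galerkin approximation. -/
abbrev GState (N : ℕ) : Type := (box N → ℂ) × (box N → ℂ)

lemma contDiff_rhsB_extBox (D : FData) (k : ℤ × ℤ) :
    ContDiff ℝ 1 fun x : GState N => D.rhsB (extBox x.1) (extBox x.2) k :=
  (contDiff_kconv_extBox _ (fun k => ((contDiff_extBox k).comp contDiff_snd).sub contDiff_const)
    (fun k => (contDiff_extBox k).comp contDiff_fst) (fun _ _ hk => extBox_of_notMem _ hk) k).neg

lemma contDiff_rhsW_extBox (D : FData) (k : ℤ × ℤ) :
    ContDiff ℝ 1 fun x : GState N => D.rhsW (extBox x.1) (extBox x.2) k := by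
  have h1 : ∀ k, ContDiff ℝ 1 fun x : GState N => extBox x.1 k :=
    fun k => (contDiff_extBox k).comp contDiff_fst
  have h2 : ∀ k, ContDiff ℝ 1 fun x : GState N => extBox x.2 k :=
    fun k => (contDiff_extBox k).comp contDiff_snd
  have e1 : ContDiff ℝ 1 fun x : GState N => D.trans (fun k => extBox x.2 k - D.f k)
      (fun k => extBox x.2 k - extBox x.1 k) k :=
    contDiff_kconv_extBox D.tker (fun k => (h2 k).sub contDiff_const)
      (fun k => (h2 k).sub (h1 k))
      (fun x k hk => by rw [extBox_of_notMem _ hk, extBox_of_notMem _ hk, sub_zero]) k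
  have e2 := contDiff_kconv_extBox (fun _ m => Complex.I * D.ξ * m.1)
    (a := fun _ : GState N => D.v₁) (fun _ => contDiff_const) h1
    (fun _ _ hk => extBox_of_notMem _ hk) k
  have e3 := contDiff_kconv_extBox (fun _ m => Complex.I * D.ξ * m.2)
    (a := fun _ : GState N => D.v₂) (fun _ => contDiff_const) h1
    (fun _ _ hk => extBox_of_notMem _ hk) k
  unfold FData.rhsW FData.forcing
  exact (e1.add (e2.add e3)).neg

/-- The full energy of a Galerkin state. -/
noncomputable def gEnergy (x : GState N) : ℝ :=
  ∑ k ∈ box N, (wt k ^ 3 * ‖extBox x.1 k‖) ^ 2 + ∑ k ∈ box N, (wt k ^ 2 * ‖extBox x.2 k‖) ^ 2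

lemma contDiff_gEnergy : ContDiff ℝ 1 (gEnergy (N := N)) := by
  unfold gEnergy
  simp_rw [mul_pow]
  exact (ContDiff.sum fun k _ => contDiff_const.mul
    (((contDiff_extBox k).comp contDiff_fst).norm_sq ℝ)).add
    (ContDiff.sum fun k _ => contDiff_const.mul
      (((contDiff_extBox k).comp contDiff_snd).norm_sq ℝ))

lemma sobBd_extBox {s : ℕ} {a : box N → ℂ} {E : ℝ}
    (h : ∑ k ∈ box N, (wt k ^ s * ‖extBox a k‖) ^ 2 ≤ E) : SobBd s (extBox a) (√E) := by
  have hE : 0 ≤ E := (Finset.sum_nonneg fun _ _ => sq_nonneg _).trans h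
  refine ⟨Real.sqrt_nonneg _, fun S => ?_⟩
  rw [Real.sq_sqrt hE]
  refine le_trans ?_ h
  classical
  rw [← Finset.sum_filter_add_sum_filter_not S (· ∈ box N)]
  have h0 : ∑ k ∈ S with k ∉ box N, (wt k ^ s * ‖extBox a k‖) ^ 2 = 0 :=
    Finset.sum_eq_zero fun k hk => by
      rw [extBox_of_notMem _ (Finset.mem_filter.1 hk).2, norm_zero, mul_zero, sq, mul_zero]
  rw [h0, add_zero]
  exact Finset.sum_le_sum_of_subset_of_nonneg (fun k hk => (Finset.mem_filter.1 hk).2)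
    fun _ _ _ => sq_nonneg _

lemma sobBd_of_gEnergy_le {x : GState N} {E : ℝ} (h : gEnergy x ≤ E) :
    SobBd 3 (extBox x.1) (√E) ∧ SobBd 2 (extBox x.2) (√E) := by
  unfold gEnergy at h
  have h1 : 0 ≤ ∑ k ∈ box N, (wt k ^ 3 * ‖extBox x.1 k‖) ^ 2 :=
    Finset.sum_nonneg fun _ _ => sq_nonneg _
  have h2 : 0 ≤ ∑ k ∈ box N, (wt k ^ 2 * ‖extBox x.2 k‖) ^ 2 :=
    Finset.sum_nonneg fun _ _ => sq_nonneg _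
  exact ⟨sobBd_extBox (by linarith), sobBd_extBox (by linarith)⟩

/-- The truncated Galerkin vector field, symmetrised so that it preserves real functions. -/
noncomputable def gField (D : FData) (P : ℝ) (x : GState N) : GState N :=
  Real.smoothTransition (P - gEnergy x) •
    ((fun k : box N => (D.rhsB (extBox x.1) (extBox x.2) k +
        conj (D.rhsB (extBox x.1) (extBox x.2) (-k))) / 2),
      fun k : box N => (D.rhsW (extBox x.1) (extBox x.2) k +
        conj (D.rhsW (extBox x.1) (extBox x.2) (-k))) / 2)

lemma contDiff_gField (D : FData) (P : ℝ) : ContDiff ℝ 1 (gField D P (N := N)) := by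
  have hχ : ContDiff ℝ 1 fun x : GState N => Real.smoothTransition (P - gEnergy x) :=
    (Real.smoothTransition.contDiff (n := 1)).comp (contDiff_const.sub contDiff_gEnergy)
  have hconj : ∀ {g : GState N → ℂ}, ContDiff ℝ 1 g → ContDiff ℝ 1 fun x => conj (g x) :=
    fun hg => Complex.conjCLE.contDiff.comp hg
  refine hχ.smul (ContDiff.prodMk (contDiff_pi.2 fun k => ?_) (contDiff_pi.2 fun k => ?_))
  · exact ((contDiff_rhsB_extBox D _).add (hconj (contDiff_rhsB_extBox D _))).div_const 2
  · exact ((contDiff_rhsW_extBox D _).add (hconj (contDiff_rhsW_extBox D _))).div_const 2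

/-- The cutoff factor vanishes once the energy reaches P, and the sublevel set is bounded because
all weights are at least one. -/
lemma hasCompactSupport_gField (D : FData) (P : ℝ) :
    HasCompactSupport (gField D P (N := N)) := by
  refine HasCompactSupport.intro (isCompact_closedBall (0 : GState N) (√P)) fun x hx => ?_
  have : P ≤ gEnergy x := by
    by_contra hlt
    obtain ⟨h1, h2⟩ := sobBd_of_gEnergy_le (not_le.1 hlt).le
    refine hx (mem_closedBall_zero_iff.2 ?_)
    rw [Prod.norm_def]
    refine max_le ((pi_norm_le_iff_of_nonneg (Real.sqrt_nonneg _)).2 fun k => ?_)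
      ((pi_norm_le_iff_of_nonneg (Real.sqrt_nonneg _)).2 fun k => ?_)
    · simpa [extBox_of_mem _ k.2] using h1.norm_le k
    · simpa [extBox_of_mem _ k.2] using h2.norm_le k
  rw [gField, Real.smoothTransition.zero_of_nonpos (by linarith), zero_smul]

/-- Truncation of coefficients to the box. -/
noncomputable def truncBox (N : ℕ) (a : ℤ × ℤ → ℂ) (k : ℤ × ℤ) : ℂ := if k ∈ box N then a k else 0

lemma norm_truncBox_le (N : ℕ) (a : ℤ × ℤ → ℂ) (k : ℤ × ℤ) : ‖truncBox N a k‖ ≤ ‖a k‖ := by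
  unfold truncBox; split_ifs <;> simp

lemma extBox_restrict (a : ℤ × ℤ → ℂ) : extBox (fun k : box N => a k) = truncBox N a := by
  funext k; unfold extBox truncBox; split_ifs <;> rfl

/-- A C¹ field of compact support is bounded and globally Lipschitz, which excludes blow-up of the
truncated system. -/
lemma exists_gField_solution (D : FData) (P : ℝ) (b₀ ω₀ : ℤ × ℤ → ℂ) {T : ℝ} (hT : 0 ≤ T) :
    ∃ x : ℝ → GState N, extBox (x 0).1 = truncBox N b₀ ∧ extBox (x 0).2 = truncBox N ω₀ ∧
      ∀ t ∈ Icc 0 T, HasDerivWithinAt x (gField D P (x t)) (Icc 0 T) t := by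
  obtain ⟨K, hK⟩ := (contDiff_gField (N := N) D P).lipschitzWith_of_hasCompactSupport
    (hasCompactSupport_gField D P) one_ne_zero
  obtain ⟨M, hM⟩ := (hasCompactSupport_gField (N := N) D P).exists_bound_of_continuous
    hK.continuous
  obtain ⟨x, hx0, hx⟩ := exists_forall_hasDerivWithinAt hK hM
    ((fun k => b₀ k), (fun k => ω₀ k)) hT
  refine ⟨x, ?_, ?_, hx⟩ <;> rw [hx0] <;> exact extBox_restrict _

lemma hasDerivWithinAt_extBox {y : ℝ → box N → ℂ} {y' : box N → ℂ} {I : Set ℝ} {t : ℝ}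
    (h : HasDerivWithinAt y y' I t) (k : ℤ × ℤ) :
    HasDerivWithinAt (fun s => extBox (y s) k) (extBox y' k) I t := by
  by_cases hk : k ∈ box N
  · simp_rw [extBox_of_mem _ hk]
    exact (hasDerivWithinAt_pi.1 h) _
  · simp_rw [extBox_of_notMem _ hk]
    exact hasDerivWithinAt_const _ _ _

/-- The coefficientwise form of the Galerkin equation. -/
lemma hasDerivWithinAt_gField {D : FData} {P : ℝ} {x : ℝ → GState N} {I : Set ℝ} {t : ℝ}
    (h : HasDerivWithinAt x (gField D P (x t)) I t) (k : ℤ × ℤ) :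
    HasDerivWithinAt (fun s => extBox (x s).1 k) (truncBox N (fun k =>
      Real.smoothTransition (P - gEnergy (x t)) * ((D.rhsB (extBox (x t).1) (extBox (x t).2) k +
        conj (D.rhsB (extBox (x t).1) (extBox (x t).2) (-k))) / 2)) k) I t ∧
    HasDerivWithinAt (fun s => extBox (x s).2 k) (truncBox N (fun k =>
      Real.smoothTransition (P - gEnergy (x t)) * ((D.rhsW (extBox (x t).1) (extBox (x t).2) k +
        conj (D.rhsW (extBox (x t).1) (extBox (x t).2) (-k))) / 2)) k) I t := by
  constructor
  · rw [← extBox_restrict]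
    refine (hasDerivWithinAt_extBox h.fst k).congr_deriv ?_
    congr 1
  · rw [← extBox_restrict]
    refine (hasDerivWithinAt_extBox h.snd k).congr_deriv ?_
    congr 1

lemma truncBox_symm_herm (c : ℝ) (g : ℤ × ℤ → ℂ) :
    Herm (truncBox N fun k => c * ((g k + conj (g (-k))) / 2)) := by
  intro k
  unfold truncBox
  by_cases hk : k ∈ box N
  · rw [if_pos (neg_mem_box.2 hk), if_pos hk]
    simp [add_comm, map_ofNat (starRingEnd ℂ) 2]
  · rw [if_neg (fun h => hk (neg_mem_box.1 h)), if_neg hk, map_zero]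

/-- The defect c(-k) - conj c(k) has zero derivative and vanishes initially. -/
lemma herm_of_hasDerivWithinAt {T : ℝ} {c c' : ℝ → ℤ × ℤ → ℂ}
    (hd : ∀ t ∈ Icc 0 T, ∀ k, HasDerivWithinAt (fun s => c s k) (c' t k) (Icc 0 T) t)
    (h0 : Herm (c 0)) (h' : ∀ t ∈ Icc 0 T, Herm (c' t)) {t : ℝ} (ht : t ∈ Icc 0 T) :
    Herm (c t) := by
  intro k
  have hd' : ∀ s ∈ Icc 0 T, HasDerivWithinAt (fun s => c s (-k) - conj (c s k)) 0 (Icc 0 T) s := by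
    intro s hs
    refine ((hd s hs (-k)).sub (Complex.conjCLE.hasFDerivAt.comp_hasDerivWithinAt s (hd s hs k))).congr_deriv ?_
    rw [h' s hs k]
    exact sub_self _
  have := constant_of_has_deriv_right_zero (fun s hs => (hd' s hs).continuousWithinAt)
    (fun s hs => (hd' s (Ico_subset_Icc_self hs)).mono_of_mem_nhdsWithin
      (Icc_mem_nhdsGE_of_mem hs)) t ht
  rw [h0 k, sub_self] at this
  exact sub_eq_zero.1 this

lemma truncBox_herm {a : ℤ × ℤ → ℂ} (h : Herm a) : Herm (truncBox N a) := by
  intro k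
  unfold truncBox
  by_cases hk : k ∈ box N
  · rw [if_pos (neg_mem_box.2 hk), if_pos hk, h]
  · rw [if_neg (fun h => hk (neg_mem_box.1 h)), if_neg hk, map_zero]

/-- Paired with a state supported in the box, the Galerkin projection disappears. The truncated
system therefore obeys the energy estimates of the full one. -/
lemma epair_truncBox_mul {μ : ℤ × ℤ → ℝ} {S : Finset (ℤ × ℤ)} (a : box N → ℂ) (c : ℝ)
    (g : ℤ × ℤ → ℂ) :
    epair μ S (extBox a) (truncBox N fun k => c * g k) = c * epair μ S (extBox a) g := by
  rw [epair, epair, Finset.mul_sum]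
  refine Finset.sum_congr rfl fun k _ => ?_
  by_cases hk : k ∈ box N
  · rw [truncBox, if_pos hk, mul_left_comm, Complex.re_ofReal_mul]; ring
  · rw [extBox_of_notMem _ hk]; simp

end Galerkin

/-- The existence time for data of size `R`. -/
noncomputable def FData.lifespan (D : FData) (R : ℝ) : ℝ := (D.rate (√(4 * R ^ 2 + 3)) + 1)⁻¹

lemma FData.rate_nonneg (D : FData) {R : ℝ} (hR : 0 ≤ R) : 0 ≤ D.rate R := by
  have := D.CT_nonneg; have := D.CU_nonneg; have := D.f_bd.1
  unfold FData.rate; positivity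

lemma FData.lifespan_pos (D : FData) (R : ℝ) : 0 < D.lifespan R := by
  have := D.rate_nonneg (Real.sqrt_nonneg (4 * R ^ 2 + 3))
  unfold FData.lifespan; positivity

/-- Galerkin approximations exist on a common time interval with common bounds. -/
lemma exists_galerkin (D : FData) {R : ℝ} {b₀ ω₀ : ℤ × ℤ → ℂ} (hb : SobBd 3 b₀ R)
    (hω : SobBd 2 ω₀ R) (hbs : Herm b₀) (hωs : Herm ω₀) (N : ℕ) :
    ∃ b ω : ℝ → ℤ × ℤ → ℂ, b 0 = truncBox N b₀ ∧ ω 0 = truncBox N ω₀ ∧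
      ApproxSol D (D.lifespan R) (√(4 * R ^ 2 + 3)) b ω
        (fun t k => truncBox N (D.rhsB (b t) (ω t)) k - D.rhsB (b t) (ω t) k)
        (fun t k => truncBox N (D.rhsW (b t) (ω t)) k - D.rhsW (b t) (ω t) k) := by
  -- The energy starts below 2R² and, growing at rate at most `D.rate (√P)`, stays below 2R² + 1
  -- during the lifespan. Applied to both components this gives `gEnergy ≤ 4R² + 2 = P - 1`, exactly
  -- where the cutoff factor equals one, so the truncation is never felt.
  set P : ℝ := 4 * R ^ 2 + 3 with hP
  set T := D.lifespan R with hT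
  have hT0 : 0 < T := D.lifespan_pos R
  obtain ⟨x, hx1, hx2, hx⟩ := exists_gField_solution (N := N) D P b₀ ω₀ hT0.le
  have hd := fun t ht k => hasDerivWithinAt_gField (hx t ht) k
  have hs1 : ∀ t ∈ Icc 0 T, Herm (extBox (x t).1) := fun t ht =>
    herm_of_hasDerivWithinAt (c := fun t => extBox (x t).1) (fun t ht k => (hd t ht k).1)
      (by rw [hx1]; exact truncBox_herm hbs) (fun t _ => truncBox_symm_herm _ _) ht
  have hs2 : ∀ t ∈ Icc 0 T, Herm (extBox (x t).2) := fun t ht =>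
    herm_of_hasDerivWithinAt (c := fun t => extBox (x t).2) (fun t ht k => (hd t ht k).2)
      (by rw [hx2]; exact truncBox_herm hωs) (fun t _ => truncBox_symm_herm _ _) ht
  -- On Hermitian states the symmetrisation built into `gField` acts as the identity.
  have hhalf : ∀ {g : ℤ × ℤ → ℂ}, Herm g → ∀ k, (g k + conj (g (-k))) / 2 = g k := fun hg k => by
    rw [hg k, Complex.conj_conj]; ring
  have hd1 : ∀ t ∈ Icc 0 T, ∀ k, HasDerivWithinAt (fun s => extBox (x s).1 k)
      (truncBox N (fun k => Real.smoothTransition (P - gEnergy (x t)) *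
        D.rhsB (extBox (x t).1) (extBox (x t).2) k) k) (Icc 0 T) t := fun t ht k => by
    have := (hd t ht k).1
    simp_rw [hhalf (FData.rhsB_herm (hs1 t ht) (hs2 t ht))] at this
    exact this
  have hd2 : ∀ t ∈ Icc 0 T, ∀ k, HasDerivWithinAt (fun s => extBox (x s).2 k)
      (truncBox N (fun k => Real.smoothTransition (P - gEnergy (x t)) *
        D.rhsW (extBox (x t).1) (extBox (x t).2) k) k) (Icc 0 T) t := fun t ht k => by
    have := (hd t ht k).2
    simp_rw [hhalf (FData.rhsW_herm (hs1 t ht) (hs2 t ht))] at this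
    exact this
  have hrate := D.rate_nonneg (Real.sqrt_nonneg P)
  have hen : ∀ t ∈ Icc 0 T, ∀ M, energy (cutoff 3 M) (box M) (extBox (x t).1) +
      energy (cutoff 2 M) (box M) (extBox (x t).2) ≤ 2 * R ^ 2 + 1 := by
    intro t ht M
    have hde := fun t ht => (hasDerivWithinAt_energy (cutoff 3 M) (box M) (hd1 t ht)).add
      (hasDerivWithinAt_energy (cutoff 2 M) (box M) (hd2 t ht))
    have hle := image_le_of_deriv_right_le_deriv_boundary
        (fun r hr => (hde r hr).continuousWithinAt)
        (fun r hr => (hde r (Ico_subset_Icc_self hr)).mono_of_mem_nhdsWithin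
          (Icc_mem_nhdsGE_of_mem hr))
        (B := fun r => 2 * R ^ 2 + D.rate (√P) * r) (B' := fun _ => D.rate (√P))
        ?_ (by fun_prop)
        (fun r _ => by
          simpa using (((hasDerivAt_id r).const_mul (D.rate (√P))).const_add
            (2 * R ^ 2)).hasDerivWithinAt)
        (fun r hr => ?_) ht
    · refine hle.trans ?_
      have : D.rate (√P) * t ≤ 1 := by
        have h1 : t * (D.rate (√P) + 1) ≤ 1 := by
          have := ht.2
          rw [hT, FData.lifespan] at this
          rwa [← one_div, le_div_iff₀ (by positivity)] at this
        nlinarith [ht.1]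
      linarith
    · simp only [Pi.add_apply, mul_zero, add_zero]
      rw [hx1, hx2]
      have h1 := (hb.of_le (norm_truncBox_le N b₀)).energy_le M (box M)
      have h2 := (hω.of_le (norm_truncBox_le N ω₀)).energy_le M (box M)
      linarith
    · rw [epair_truncBox_mul, epair_truncBox_mul]
      have hr' := Ico_subset_Icc_self hr
      rcases le_or_gt P (gEnergy (x r)) with hge | hlt
      -- Beyond the threshold the field vanishes; below it the state has norm at most √P and the a
      -- priori estimates apply.
      · rw [Real.smoothTransition.zero_of_nonpos (by linarith)]
        simpa using hrate
      · obtain ⟨c1, c2⟩ := sobBd_of_gEnergy_le hlt.le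
        have e1 := FData.abs_epair_rhsB_le (D := D) M (hs2 r hr') c1 c2
        have e2 := FData.abs_epair_rhsW_le (D := D) M (hs2 r hr') c1 c2
        have f0 := Real.smoothTransition.nonneg (P - gEnergy (x r))
        have f1 := Real.smoothTransition.le_one (P - gEnergy (x r))
        set χ := Real.smoothTransition (P - gEnergy (x r))
        set p1 := epair (cutoff 3 M) (box M) (extBox (x r).1)
          (D.rhsB (extBox (x r).1) (extBox (x r).2))
        set p2 := epair (cutoff 2 M) (box M) (extBox (x r).2)
          (D.rhsW (extBox (x r).1) (extBox (x r).2))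
        have h3 : 2 * (p1 + p2) ≤ D.rate (√P) := by
          have := le_abs_self p1
          have := le_abs_self p2
          unfold FData.rate
          linarith
        calc 2 * (χ * p1) + 2 * (χ * p2) = χ * (2 * (p1 + p2)) := by ring
          _ ≤ χ * D.rate (√P) := mul_le_mul_of_nonneg_left h3 f0
          _ ≤ 1 * D.rate (√P) := mul_le_mul_of_nonneg_right f1 hrate
          _ = _ := one_mul _
  have hbd1 : ∀ t ∈ Icc 0 T, SobBd 3 (extBox (x t).1) (√(2 * R ^ 2 + 1)) := fun t ht =>
    SobBd.of_energy_le fun M => le_trans (le_add_of_nonneg_right (energy_nonneg _ _ _)) (hen t ht M)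
  have hbd2 : ∀ t ∈ Icc 0 T, SobBd 2 (extBox (x t).2) (√(2 * R ^ 2 + 1)) := fun t ht =>
    SobBd.of_energy_le fun M => le_trans (le_add_of_nonneg_left (energy_nonneg _ _ _)) (hen t ht M)
  have hχ : ∀ t ∈ Icc 0 T, Real.smoothTransition (P - gEnergy (x t)) = 1 := fun t ht => by
    refine Real.smoothTransition.one_of_one_le ?_
    have h1 := (hbd1 t ht).2 (box N)
    have h2 := (hbd2 t ht).2 (box N)
    rw [Real.sq_sqrt (by positivity)] at h1 h2
    unfold gEnergy
    linarith
  have hle : √(2 * R ^ 2 + 1) ≤ √P := Real.sqrt_le_sqrt (by rw [hP]; nlinarith [sq_nonneg R])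
  refine ⟨fun t => extBox (x t).1, fun t => extBox (x t).2, hx1, hx2,
    fun t ht => (hbd1 t ht).mono hle, fun t ht => (hbd2 t ht).mono hle, hs1, hs2,
    fun t ht k => ?_, fun t ht k => ?_⟩
  · have := hd1 t ht k
    rw [hχ t ht] at this
    simpa using this
  · have := hd2 t ht k
    rw [hχ t ht] at this
    simpa using this


/-! ### Local existence -/

/-- Outside the box the weight is at least N + 1, so one order of regularity is exchanged for a
factor 1/(N + 1). -/
lemma SobBd.tail {r N : ℕ} {a c : ℤ × ℤ → ℂ} {A : ℝ} (ha : SobBd (r + 1) a A)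
    (h0 : ∀ k ∈ box N, c k = 0) (hc : ∀ k, ‖c k‖ ≤ ‖a k‖) : SobBd r c (A / (N + 1)) := by
  have hN : (0 : ℝ) < N + 1 := by positivity
  refine ⟨div_nonneg ha.1 hN.le, fun S => ?_⟩
  rw [div_pow, le_div_iff₀ (by positivity), Finset.sum_mul]
  refine le_trans (Finset.sum_le_sum fun k _ => ?_) (ha.2 S)
  have hw := wt_pos k
  by_cases hk : k ∈ box N
  · rw [h0 k hk]; simp; positivity
  · have h1 := wt_of_notMem_box hk
    have h2 := hc k
    rw [← mul_pow]
    refine pow_le_pow_left₀ (by positivity) ?_ 2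
    calc wt k ^ r * ‖c k‖ * (N + 1) ≤ wt k ^ r * ‖a k‖ * wt k := by gcongr
      _ = _ := by ring

lemma box_mono {N M : ℕ} (h : N ≤ M) : box N ⊆ box M := by
  intro k
  simp only [box, Finset.mem_product, Finset.mem_Icc]
  omega

lemma SobBd.truncBox_sub {r N : ℕ} {a : ℤ × ℤ → ℂ} {A : ℝ} (ha : SobBd (r + 1) a A) :
    SobBd r (fun k => truncBox N a k - a k) (A / (N + 1)) := by
  refine ha.tail (fun k hk => by simp [truncBox, hk]) fun k => ?_
  unfold truncBox; split_ifs <;> simp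

lemma SobBd.truncBox_sub_truncBox {r N M : ℕ} (hNM : N ≤ M) {a : ℤ × ℤ → ℂ} {A : ℝ}
    (ha : SobBd (r + 1) a A) :
    SobBd r (fun k => truncBox N a k - truncBox M a k) (A / (N + 1)) := by
  refine ha.tail (fun k hk => by simp [truncBox, hk, box_mono hNM hk]) fun k => ?_
  unfold truncBox
  split_ifs <;> simp

lemma tendsto_truncBox (a : ℤ × ℤ → ℂ) (k : ℤ × ℤ) :
    Tendsto (fun N => truncBox N a k) atTop (𝓝 (a k)) := by
  refine tendsto_const_nhds.congr' ?_
  filter_upwards [eventually_mem_box k] with N hN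
  simp [truncBox, hN]

lemma tendsto_div_natCast_add_one (C : ℝ) : Tendsto (fun n : ℕ => C / ((n : ℝ) + 1)) atTop (𝓝 0) :=
  tendsto_const_nhds.div_atTop (tendsto_atTop_add_const_right _ _ tendsto_natCast_atTop_atTop)

/-- Passage to the limit in one component of the Galerkin system. -/
lemma eq_add_integral_of_tendsto {T t C : ℝ} (ht : t ∈ Icc 0 T) {y : ℕ → ℝ → ℂ} {g : ℕ → ℝ → ℂ}
    {y₀ g₀ : ℝ → ℂ} (hg : ∀ n, ContinuousOn (g n) (Icc 0 T))
    (hy : ∀ᶠ n in atTop, ∀ t ∈ Icc 0 T, HasDerivWithinAt (y n) (g n t) (Icc 0 T) t)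
    (hgC : ∀ n, ∀ t ∈ Icc 0 T, ‖g n t‖ ≤ C)
    (hylim : ∀ t ∈ Icc 0 T, Tendsto (fun n => y n t) atTop (𝓝 (y₀ t)))
    (hglim : ∀ t ∈ Icc 0 T, Tendsto (fun n => g n t) atTop (𝓝 (g₀ t))) :
    y₀ t = y₀ 0 + ∫ τ in (0 : ℝ)..t, g₀ τ := by
  have hsub : uIoc 0 t ⊆ Icc 0 T := by
    rw [uIoc_of_le ht.1]
    exact Ioc_subset_Icc_self.trans (Icc_subset_Icc_right ht.2)
  have h1 : Tendsto (fun n => y n 0 + ∫ τ in (0 : ℝ)..t, g n τ) atTop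
      (𝓝 (y₀ 0 + ∫ τ in (0 : ℝ)..t, g₀ τ)) := by
    refine (hylim 0 ⟨le_rfl, ht.1.trans ht.2⟩).add ?_
    refine intervalIntegral.tendsto_integral_filter_of_dominated_convergence (fun _ => C)
      (Eventually.of_forall fun n => ?_) (Eventually.of_forall fun n => ?_)
      intervalIntegrable_const ?_
    · exact ((hg n).mono hsub).aestronglyMeasurable measurableSet_uIoc
    · exact Eventually.of_forall fun τ hτ => hgC n τ (hsub hτ)
    · exact Eventually.of_forall fun τ hτ => hglim τ (hsub hτ)
  refine tendsto_nhds_unique (hylim t ht) (h1.congr' ?_)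
  filter_upwards [hy] with n hn
  exact ((forall_hasDerivWithinAt_iff (hg n)).1 hn t ht).symm

/-- Local existence, on a time interval depending only on the size of the data. -/
theorem exists_isSol (D : FData) {R : ℝ} {b₀ ω₀ : ℤ × ℤ → ℂ} (hb : SobBd 3 b₀ R)
    (hω : SobBd 2 ω₀ R) (hbs : Herm b₀) (hωs : Herm ω₀) :
    ∃ b ω : ℝ → ℤ × ℤ → ℂ, b 0 = b₀ ∧ ω 0 = ω₀ ∧
      IsSol D (D.lifespan R) (√(4 * R ^ 2 + 3)) b ω := by
  choose b ω hb0 hω0 hsol using exists_galerkin D hb hω hbs hωs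
  set T := D.lifespan R with hTdef
  set P := √(4 * R ^ 2 + 3) with hP
  have hT : 0 < T := D.lifespan_pos R
  have hP0 : 0 ≤ P := Real.sqrt_nonneg _
  have hz : (0 : ℝ) ∈ Icc 0 T := ⟨le_rfl, hT.le⟩
  have hCT := D.CT_nonneg
  have hCU := D.CU_nonneg
  have hF := D.f_bd.1
  have hR := hb.1
  set C₁ : ℝ := D.CT * ((P + D.F) * P) with hC₁
  set C₂ : ℝ := D.CT * ((P + D.F) * (P + P)) + D.CU * P with hC₂
  set C₀ : ℝ := C₁ + C₂ + R with hC₀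
  have hC₁0 : 0 ≤ C₁ := by positivity
  have hC₂0 : 0 ≤ C₂ := by positivity
  have hdiv : ∀ {N M : ℕ} {c : ℝ}, N ≤ M → c ≤ C₀ → c / ((M : ℝ) + 1) ≤ C₀ / ((N : ℝ) + 1) := by
    intro N M c hNM hc
    have : (N : ℝ) ≤ M := by exact_mod_cast hNM
    have : 0 ≤ C₀ := by positivity
    gcongr
  -- The Galerkin error is minus the high-frequency part of the right-hand side. The latter has
  -- order 2 for b and order 1 for ω, one more than `ApproxSol.stability` requires.
  have herrB : ∀ {N M : ℕ}, N ≤ M → ∀ t ∈ Icc 0 T, SobBd 1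
      (fun k => truncBox M (D.rhsB (b M t) (ω M t)) k - D.rhsB (b M t) (ω M t) k)
      (C₀ / ((N : ℝ) + 1)) := fun {N M} hNM t ht =>
    (FData.rhsB_bound ((hsol M).bdB t ht) ((hsol M).bdW t ht)).truncBox_sub.mono
      (hdiv hNM (by linarith))
  have herrW : ∀ {N M : ℕ}, N ≤ M → ∀ t ∈ Icc 0 T, SobBd 0
      (fun k => truncBox M (D.rhsW (b M t) (ω M t)) k - D.rhsW (b M t) (ω M t) k)
      (C₀ / ((N : ℝ) + 1)) := fun {N M} hNM t ht =>
    (FData.rhsW_bound ((hsol M).bdB t ht) ((hsol M).bdW t ht)).truncBox_sub.mono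
      (hdiv hNM (by linarith))
  set C := √(2 * (2 + 4 * T) * Real.exp (2 * D.stabRate P * T)) with hC
  have hstab : ∀ {N M : ℕ}, N ≤ M → ∀ t ∈ Icc 0 T,
      SobBd 1 (fun k => b N t k - b M t k) (C * (C₀ / ((N : ℝ) + 1))) ∧
      SobBd 0 (fun k => ω N t k - ω M t k) (C * (C₀ / ((N : ℝ) + 1))) := by
    intro N M hNM t ht
    refine ApproxSol.stability hT (hsol N) (hsol M) (herrB le_rfl) (herrW le_rfl) (herrB hNM)
      (herrW hNM) ?_ ?_ ht
    · rw [hb0, hb0]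
      exact ((hb.mono_order (by norm_num : 2 ≤ 3)).truncBox_sub_truncBox hNM).mono
        (hdiv le_rfl (by linarith))
    · rw [hω0, hω0]
      exact ((hω.mono_order (by norm_num : 1 ≤ 2)).truncBox_sub_truncBox hNM).mono
        (hdiv le_rfl (by linarith))
  have hlim0 : Tendsto (fun N : ℕ => C * (C₀ / ((N : ℝ) + 1))) atTop (𝓝 0) := by
    simpa using (tendsto_div_natCast_add_one C₀).const_mul C
  have conv : ∀ {y : ℕ → ℝ → ℤ × ℤ → ℂ}, (∀ {N M : ℕ}, N ≤ M → ∀ t ∈ Icc 0 T, ∀ k,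
      ‖y N t k - y M t k‖ ≤ C * (C₀ / ((N : ℝ) + 1))) →
      ∃ y₀ : ℝ → ℤ × ℤ → ℂ, ∀ t ∈ Icc 0 T, ∀ k, Tendsto (fun N => y N t k) atTop (𝓝 (y₀ t k)) ∧
        ∀ N, ‖y N t k - y₀ t k‖ ≤ C * (C₀ / ((N : ℝ) + 1)) := by
    intro y hy
    have : ∀ t k, ∃ z, t ∈ Icc 0 T → Tendsto (fun N => y N t k) atTop (𝓝 z) := by
      intro t k
      by_cases ht : t ∈ Icc 0 T
      · have hcs : CauchySeq fun N => y N t k := by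
          refine cauchySeq_of_le_tendsto_0' _ (fun N M hNM => ?_) hlim0
          rw [dist_eq_norm]
          exact hy hNM t ht k
        obtain ⟨z, hz⟩ := cauchySeq_tendsto_of_complete hcs
        exact ⟨z, fun _ => hz⟩
      · exact ⟨0, fun h => absurd h ht⟩
    choose y₀ hy₀ using this
    refine ⟨y₀, fun t ht k => ⟨hy₀ t k ht, fun N => ?_⟩⟩
    refine le_of_tendsto ((tendsto_const_nhds (x := y N t k)).sub (hy₀ t k ht)).norm ?_
    filter_upwards [eventually_ge_atTop N] with M hM using hy hM t ht k
  obtain ⟨β, hβ⟩ := conv fun {N M} hNM t ht k => (hstab hNM t ht).1.norm_le k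
  obtain ⟨w, hw⟩ := conv fun {N M} hNM t ht k => (hstab hNM t ht).2.norm_le k
  -- The rate of convergence does not depend on t, so continuity of the coefficients in time passes
  -- to the limit.
  have unif : ∀ {y : ℕ → ℝ → ℤ × ℤ → ℂ} {y₀ : ℝ → ℤ × ℤ → ℂ},
      (∀ t ∈ Icc 0 T, ∀ k, Tendsto (fun N => y N t k) atTop (𝓝 (y₀ t k)) ∧
        ∀ N, ‖y N t k - y₀ t k‖ ≤ C * (C₀ / ((N : ℝ) + 1))) →
      (∀ N k, ContinuousOn (fun t => y N t k) (Icc 0 T)) →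
      ∀ k, ContinuousOn (fun t => y₀ t k) (Icc 0 T) := by
    intro y y₀ h hc k
    refine TendstoUniformlyOn.continuousOn (F := fun N t => y N t k) (p := atTop) ?_
      (Eventually.of_forall fun N => hc N k).frequently
    rw [Metric.tendstoUniformlyOn_iff]
    intro ε hε
    filter_upwards [hlim0.eventually (gt_mem_nhds hε)] with N hN t ht
    rw [dist_comm, dist_eq_norm]
    exact ((h t ht k).2 N).trans_lt hN
  have hcB : ∀ N k, ContinuousOn (fun t => b N t k) (Icc 0 T) :=
    fun N k t ht => ((hsol N).derivB t ht k).continuousWithinAt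
  have hcW : ∀ N k, ContinuousOn (fun t => ω N t k) (Icc 0 T) :=
    fun N k t ht => ((hsol N).derivW t ht k).continuousWithinAt
  have hβc := unif hβ hcB
  have hwc := unif hw hcW
  have hβbd : ∀ t ∈ Icc 0 T, SobBd 3 (β t) P := fun t ht =>
    SobBd.of_tendsto (fun k => (hβ t ht k).1) (Eventually.of_forall fun N => (hsol N).bdB t ht)
  have hwbd : ∀ t ∈ Icc 0 T, SobBd 2 (w t) P := fun t ht =>
    SobBd.of_tendsto (fun k => (hw t ht k).1) (Eventually.of_forall fun N => (hsol N).bdW t ht)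
  have hcont := fun k => FData.continuousOn_rhs (D := D) hβbd hwbd hβc hwc k
  have hcontN := fun N k => FData.continuousOn_rhs (D := D) (hsol N).bdB (hsol N).bdW
    (hcB N) (hcW N) k
  -- The limit is taken in the integral form of the equation. Each fixed k lies in the box for large
  -- N, and from then on its equation is the untruncated one.
  have hB : ∀ k, ∀ t ∈ Icc 0 T,
      HasDerivWithinAt (fun t => β t k) (D.rhsB (β t) (w t) k) (Icc 0 T) t := by
    intro k
    refine (forall_hasDerivWithinAt_iff (hcont k).1).2 fun t ht => ?_
    refine eq_add_integral_of_tendsto (C := C₁) ht (y := fun N t => b N t k)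
      (g := fun N t => D.rhsB (b N t) (ω N t) k) (fun N => (hcontN N k).1) ?_ ?_
      (fun t ht => (hβ t ht k).1) (fun t ht => ?_)
    · filter_upwards [eventually_mem_box k] with N hN t ht
      simpa [truncBox, hN] using (hsol N).derivB t ht k
    · exact fun N t ht => (FData.rhsB_bound ((hsol N).bdB t ht) ((hsol N).bdW t ht)).norm_le k
    · exact FData.tendsto_rhsB (Eventually.of_forall fun N => (hsol N).bdB t ht)
        (Eventually.of_forall fun N => (hsol N).bdW t ht) (fun k => (hβ t ht k).1)
        (fun k => (hw t ht k).1) k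
  have hW : ∀ k, ∀ t ∈ Icc 0 T,
      HasDerivWithinAt (fun t => w t k) (D.rhsW (β t) (w t) k) (Icc 0 T) t := by
    intro k
    refine (forall_hasDerivWithinAt_iff (hcont k).2).2 fun t ht => ?_
    refine eq_add_integral_of_tendsto (C := C₂) ht (y := fun N t => ω N t k)
      (g := fun N t => D.rhsW (b N t) (ω N t) k) (fun N => (hcontN N k).2) ?_ ?_
      (fun t ht => (hw t ht k).1) (fun t ht => ?_)
    · filter_upwards [eventually_mem_box k] with N hN t ht
      simpa [truncBox, hN] using (hsol N).derivW t ht k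
    · exact fun N t ht => (FData.rhsW_bound ((hsol N).bdB t ht) ((hsol N).bdW t ht)).norm_le k
    · exact FData.tendsto_rhsW (Eventually.of_forall fun N => (hsol N).bdB t ht)
        (Eventually.of_forall fun N => (hsol N).bdW t ht) (fun k => (hβ t ht k).1)
        (fun k => (hw t ht k).1) k
  have herm : ∀ {y : ℕ → ℤ × ℤ → ℂ} {y₀ : ℤ × ℤ → ℂ},
      (∀ k, Tendsto (fun N => y N k) atTop (𝓝 (y₀ k))) → (∀ N, Herm (y N)) → Herm y₀ := by
    intro y y₀ hy hs k
    refine tendsto_nhds_unique (hy (-k)) ?_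
    simp_rw [fun N => hs N k]
    exact (Complex.continuous_conj.tendsto _).comp (hy k)
  refine ⟨β, w, ?_, ?_, hβbd, hwbd,
    fun t ht => herm (fun k => (hβ t ht k).1) fun N => (hsol N).hermB t ht,
    fun t ht => herm (fun k => (hw t ht k).1) fun N => (hsol N).hermW t ht,
    fun t ht k => by simpa using hB k t ht, fun t ht k => by simpa using hW k t ht⟩
  · funext k
    refine tendsto_nhds_unique (hβ 0 hz k).1 ?_
    simp_rw [hb0]
    exact tendsto_truncBox b₀ k
  · funext k
    refine tendsto_nhds_unique (hw 0 hz k).1 ?_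
    simp_rw [hω0]
    exact tendsto_truncBox ω₀ k


/-! ### Fourier series on the torus -/

section Fourier

variable {L : ℝ}

/-- The exponential monomials on the torus. -/
noncomputable def mode (k : ℤ × ℤ) : C(Torus L, ℂ) where
  toFun x := fourier k.1 (x 0) * fourier k.2 (x 1)
  continuous_toFun := by fun_prop

lemma mode_apply (k : ℤ × ℤ) (x : Torus L) : mode k x = fourier k.1 (x 0) * fourier k.2 (x 1) :=
  rfl

lemma mode_neg (k : ℤ × ℤ) (x : Torus L) : mode (-k) x = conj (mode k x) := by
  simp only [mode_apply, Prod.fst_neg, Prod.snd_neg, fourier_neg, map_mul]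

lemma mode_add (k m : ℤ × ℤ) (x : Torus L) : mode (k + m) x = mode k x * mode m x := by
  simp only [mode_apply, Prod.fst_add, Prod.snd_add, fourier_add]; ring

lemma mode_sub (k m : ℤ × ℤ) (x : Torus L) : mode (k - m) x = mode k x * conj (mode m x) := by
  rw [sub_eq_add_neg, mode_add, mode_neg]

lemma mode_zero (x : Torus L) : mode 0 x = 1 := by
  simp [mode_apply]

lemma fourier_add_right (n : ℤ) (x y : AddCircle L) :
    fourier n (x + y) = fourier n x * fourier n y := by
  rw [fourier_apply, fourier_apply, fourier_apply, smul_add, AddCircle.toCircle_add, Circle.coe_mul]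

lemma mode_add_right (k : ℤ × ℤ) (x y : Torus L) : mode k (x + y) = mode k x * mode k y := by
  simp only [mode_apply, Pi.add_apply, fourier_add_right]; ring

lemma norm_mode (k : ℤ × ℤ) (x : Torus L) : ‖mode k x‖ = 1 := by
  rw [mode_apply, norm_mul, fourier_apply, fourier_apply, Circle.norm_coe, Circle.norm_coe, one_mul]

variable [hL : Fact (0 < L)]

/-- Translation by half a wavelength, in a direction where the frequency is non-zero, reverses the
sign of the mode but preserves the measure. -/
lemma integral_mode (k : ℤ × ℤ) : ∫ x : Torus L, mode k x = if k = 0 then (L : ℂ) ^ 2 else 0 := by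
  split_ifs with h
  · subst h
    simp_rw [mode_zero]
    have hv : (volume : Measure (Torus L)).real univ = L ^ 2 := by
      rw [measureReal_def, volume_pi, Measure.pi_univ]
      simp [AddCircle.measure_univ, hL.out.le]
    rw [integral_const, hv]
    simp
  · have h' : k.1 ≠ 0 ∨ k.2 ≠ 0 := by
      by_contra hc
      rw [not_or, not_not, not_not] at hc
      exact h (Prod.ext hc.1 hc.2)
    rcases h' with h' | h'
    · refine integral_eq_zero_of_add_right_eq_neg
        (g := Pi.single 0 ((L / 2 / k.1 : ℝ) : AddCircle L)) fun x => ?_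
      simp only [mode_apply, Pi.add_apply, Pi.single_eq_same, Pi.single_eq_of_ne (one_ne_zero),
        add_zero]
      rw [fourier_add_half_inv_index h' hL.out]; ring
    · refine integral_eq_zero_of_add_right_eq_neg
        (g := Pi.single 1 ((L / 2 / k.2 : ℝ) : AddCircle L)) fun x => ?_
      simp only [mode_apply, Pi.add_apply, Pi.single_eq_same, Pi.single_eq_of_ne (zero_ne_one),
        add_zero]
      rw [fourier_add_half_inv_index h' hL.out]; ring

/-- The star subalgebra generated by the monomials. -/
noncomputable def modeSubalgebra (L : ℝ) [Fact (0 < L)] : StarSubalgebra ℂ C(Torus L, ℂ) where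
  toSubalgebra := Algebra.adjoin ℂ (range mode)
  star_mem' := by
    change Algebra.adjoin ℂ (range mode) ≤ star (Algebra.adjoin ℂ (range mode))
    refine Algebra.adjoin_le ?_
    rintro _ ⟨n, rfl⟩
    refine Algebra.subset_adjoin ⟨-n, ?_⟩
    ext1 x
    simp only [mode_neg, starRingEnd_apply, ContinuousMap.star_apply]

lemma modeSubalgebra_coe :
    (modeSubalgebra L).toSubalgebra.toSubmodule = Submodule.span ℂ (range mode) := by
  apply Algebra.adjoin_eq_span_of_subset
  refine .trans (fun x => Submonoid.closure_induction (fun _ => id) ⟨0, ?_⟩ ?_)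
    Submodule.subset_span
  · ext x; simp [mode_zero]
  · rintro _ _ _ _ ⟨m, rfl⟩ ⟨n, rfl⟩
    exact ⟨m + n, by ext x; simp [mode_add]⟩

lemma modeSubalgebra_separatesPoints : (modeSubalgebra L).SeparatesPoints := by
  intro x y hxy
  have key : ∀ {a c : AddCircle L}, fourier 1 a = fourier 1 c → a = c := fun {a c} h => by
    rw [fourier_one, fourier_one] at h
    exact AddCircle.injective_toCircle hL.out.ne' (Subtype.ext h)
  have h' : x 0 ≠ y 0 ∨ x 1 ≠ y 1 := by
    by_contra hc
    rw [not_or, not_not, not_not] at hc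
    exact hxy (funext fun i => by fin_cases i <;> [exact hc.1; exact hc.2])
  rcases h' with h' | h'
  · refine ⟨_, ⟨mode (1, 0), Algebra.subset_adjoin ⟨(1, 0), rfl⟩, rfl⟩, fun h => h' (key ?_)⟩
    simpa [mode_apply] using h
  · refine ⟨_, ⟨mode (0, 1), Algebra.subset_adjoin ⟨(0, 1), rfl⟩, rfl⟩, fun h => h' (key ?_)⟩
    simpa [mode_apply] using h

lemma span_mode_closure_eq_top :
    (Submodule.span ℂ (range (mode (L := L)))).topologicalClosure = ⊤ := by
  rw [← modeSubalgebra_coe]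
  exact congr_arg (Subalgebra.toSubmodule <| StarSubalgebra.toSubalgebra ·)
    (ContinuousMap.starSubalgebra_topologicalClosure_eq_top_of_separatesPoints _
      modeSubalgebra_separatesPoints)

/-- The complex-valued square-integrable functions on the torus. -/
noncomputable abbrev L2C (L : ℝ) [Fact (0 < L)] : Type :=
  Lp ℂ 2 (volume : Measure (Torus L))

/-- The normalised monomials as elements of `L²`. -/
noncomputable def modeLp (k : ℤ × ℤ) : L2C L :=
  ContinuousMap.toLp (E := ℂ) 2 volume ℂ (((L : ℂ)⁻¹) • mode k)

lemma coeFn_modeLp (k : ℤ × ℤ) : modeLp k =ᵐ[volume] fun x : Torus L => (L : ℂ)⁻¹ * mode k x := by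
  have := ContinuousMap.coeFn_toLp (p := 2) (𝕜 := ℂ) (volume : Measure (Torus L))
    (((L : ℂ)⁻¹) • mode k)
  simpa [modeLp] using! this

lemma orthonormal_modeLp : Orthonormal ℂ (modeLp (L := L)) := by
  rw [orthonormal_iff_ite]
  intro k m
  have hL' : (L : ℂ) ≠ 0 := by exact_mod_cast hL.out.ne'
  rw [modeLp, modeLp, ContinuousMap.inner_toLp]
  have : ∀ x : Torus L, ((L : ℂ)⁻¹ • mode m) x * conj (((L : ℂ)⁻¹ • mode k) x) =
      ((L : ℂ) ^ 2)⁻¹ * mode (m - k) x := fun x => by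
    simp only [ContinuousMap.smul_apply, smul_eq_mul, map_mul, map_inv₀, Complex.conj_ofReal,
      mode_sub]
    ring
  simp_rw [this]
  rw [integral_const_mul, integral_mode]
  by_cases h : k = m
  · subst h
    rw [if_pos (sub_self _), if_pos rfl]
    field_simp
  · rw [if_neg (fun hh => h (sub_eq_zero.1 hh).symm), if_neg h, mul_zero]

lemma span_modeLp_closure_eq_top :
    (Submodule.span ℂ (range (modeLp (L := L)))).topologicalClosure = ⊤ := by
  have h := (ContinuousMap.toLp_denseRange ℂ (volume : Measure (Torus L)) ℂ
    (ENNReal.ofNat_ne_top (n := 2))).topologicalClosure_map_submodule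
      span_mode_closure_eq_top
  rw [eq_top_iff, ← h]
  refine Submodule.topologicalClosure_mono ?_
  rw [Submodule.map_span, Submodule.span_le]
  rintro _ ⟨_, ⟨k, rfl⟩, rfl⟩
  have hL' : (L : ℂ) ≠ 0 := by exact_mod_cast hL.out.ne'
  have : ContinuousMap.toLp (E := ℂ) 2 volume ℂ (mode (L := L) k) = (L : ℂ) • modeLp k := by
    rw [modeLp, map_smul, smul_smul, mul_inv_cancel₀ hL', one_smul]
  exact this ▸ Submodule.smul_mem _ _ (Submodule.subset_span ⟨k, rfl⟩)

/-- The Fourier basis of `L²` of the torus. -/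
noncomputable def modeBasis : HilbertBasis (ℤ × ℤ) ℂ (L2C L) :=
  HilbertBasis.mk orthonormal_modeLp span_modeLp_closure_eq_top.ge

lemma modeBasis_apply (k : ℤ × ℤ) : modeBasis k = modeLp (L := L) k := by
  rw [modeBasis, HilbertBasis.coe_mk]

/-- The Fourier coefficients of a function on the torus. -/
noncomputable def fc (g : Torus L → ℂ) (k : ℤ × ℤ) : ℂ :=
  ((L : ℂ) ^ 2)⁻¹ * ∫ x, g x * conj (mode k x)

lemma fc_congr {g h : Torus L → ℂ} (hgh : g =ᵐ[volume] h) : fc g = fc h := by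
  funext k
  rw [fc, fc, integral_congr_ae (hgh.mono fun x hx => by rw [hx])]

lemma inner_modeLp (g : L2C L) (k : ℤ × ℤ) : inner ℂ (modeLp k) g = L * fc g k := by
  have hL' : (L : ℂ) ≠ 0 := by exact_mod_cast hL.out.ne'
  rw [L2.inner_def, fc]
  have : ∀ᵐ x : Torus L, inner ℂ (modeLp k x) (g x) = (L : ℂ)⁻¹ * (g x * conj (mode k x)) := by
    filter_upwards [coeFn_modeLp (L := L) k] with x hx
    rw [hx, RCLike.inner_apply]
    simp only [map_mul, map_inv₀, Complex.conj_ofReal]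
    ring
  rw [integral_congr_ae this, integral_const_mul]
  field_simp

/-- Parseval's identity. -/
lemma hasSum_fc_mul_conj (g h : L2C L) :
    HasSum (fun k => (L : ℂ) ^ 2 * (fc g k * conj (fc h k))) (∫ x, g x * conj (h x)) := by
  have := modeBasis.hasSum_inner_mul_inner h g
  rw [L2.inner_def] at this
  convert! this using 1
  · funext k
    rw [modeBasis_apply, ← inner_conj_symm, inner_modeLp, inner_modeLp, map_mul,
      Complex.conj_ofReal]
    ring

end Fourier


/-! ### Fourier coefficients of real functions -/

section Coef

variable {L : ℝ} [hL : Fact (0 < L)]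

/-- The Fourier coefficients of a real square-integrable function. -/
noncomputable def coef (u : L2 L) : ℤ × ℤ → ℂ := fc fun x => (u x : ℂ)

/-- The inclusion of real into complex functions. -/
noncomputable def toC (u : L2 L) : L2C L := Complex.ofRealCLM.compLp u

lemma coeFn_toC (u : L2 L) : toC u =ᵐ[volume] fun x => (u x : ℂ) :=
  Complex.ofRealCLM.coeFn_compLp u

lemma fc_toC (u : L2 L) : fc (toC u) = coef u := fc_congr (coeFn_toC u)

/-- The Fourier coefficient as a continuous linear functional. -/
noncomputable def coefCLM (k : ℤ × ℤ) : L2 L →L[ℝ] ℂ :=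
  ((L : ℂ)⁻¹ • (innerSL ℂ (modeLp (L := L) k))).restrictScalars ℝ ∘L
    (Complex.ofRealCLM.compLpL 2 (volume : Measure (Torus L)))

lemma coefCLM_apply (k : ℤ × ℤ) (u : L2 L) : coefCLM k u = coef u k := by
  have hL' : (L : ℂ) ≠ 0 := by exact_mod_cast hL.out.ne'
  change (L : ℂ)⁻¹ * inner ℂ (modeLp k) (toC u) = _
  rw [inner_modeLp, fc_toC]
  field_simp

lemma coef_add (u v : L2 L) (k : ℤ × ℤ) : coef (u + v) k = coef u k + coef v k := by
  simp only [← coefCLM_apply, map_add]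

lemma coef_sub (u v : L2 L) (k : ℤ × ℤ) : coef (u - v) k = coef u k - coef v k := by
  simp only [← coefCLM_apply, map_sub]

lemma coef_neg (u : L2 L) (k : ℤ × ℤ) : coef (-u) k = -coef u k := by
  simp only [← coefCLM_apply, map_neg]

lemma fc_herm {g : Torus L → ℝ} : Herm (fc fun x => (g x : ℂ)) := by
  intro k
  rw [fc, fc, map_mul, ← integral_conj]
  simp only [map_mul, map_inv₀, map_pow, Complex.conj_ofReal, Complex.conj_conj, mode_neg]

lemma coef_herm (u : L2 L) : Herm (coef u) := fc_herm

lemma hasSum_norm_coef_sq (u : L2 L) : HasSum (fun k => L ^ 2 * ‖coef u k‖ ^ 2) (‖u‖ ^ 2) := by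
  have h := hasSum_fc_mul_conj (toC u) (toC u)
  have h1 : ∫ x, toC u x * conj (toC u x) = ((‖u‖ ^ 2 : ℝ) : ℂ) := by
    rw [← real_inner_self_eq_norm_sq, L2.inner_def, ← integral_complex_ofReal]
    refine integral_congr_ae ?_
    filter_upwards [coeFn_toC u] with x hx
    rw [hx, Complex.conj_ofReal, ← Complex.ofReal_mul]
    simp [sq]
  rw [h1, fc_toC] at h
  refine Complex.hasSum_ofReal.1 ?_
  convert! h using 1
  funext k
  rw [Complex.mul_conj, Complex.normSq_eq_norm_sq]
  push_cast; rfl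

lemma coef_injective : Function.Injective (coef (L := L)) := by
  intro u v h
  have h1 := hasSum_norm_coef_sq (u - v)
  have h2 : (fun k => L ^ 2 * ‖coef (u - v) k‖ ^ 2) = fun _ => (0 : ℝ) := by
    funext k; rw [coef_sub, h]; simp
  rw [h2] at h1
  have := h1.unique hasSum_zero
  exact sub_eq_zero.1 (norm_eq_zero.1 (pow_eq_zero_iff (by norm_num) |>.1 this))

/-- Every Hermitian square-summable family is the family of coefficients of a real function. -/
lemma exists_coef_eq {a : ℤ × ℤ → ℂ} (ha : Summable fun k => ‖a k‖ ^ 2) (hs : Herm a) :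
    ∃ u : L2 L, coef u = a := by
  have hL' : (L : ℂ) ≠ 0 := by exact_mod_cast hL.out.ne'
  have hmem : Memℓp (fun k => (L : ℂ) * a k) 2 := by
    refine memℓp_gen ?_
    simp only [norm_mul, ENNReal.toReal_ofNat, Real.rpow_ofNat, mul_pow]
    exact ha.mul_left _
  set g : L2C L := modeBasis.repr.symm ⟨_, hmem⟩ with hg
  have hgk : ∀ k, fc g k = a k := fun k => by
    have h1 := modeBasis.repr_apply_apply g k
    rw [hg, LinearIsometryEquiv.apply_symm_apply, modeBasis_apply, inner_modeLp] at h1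
    exact (mul_left_cancel₀ hL' h1).symm
  -- Taking the real part averages the coefficients with their reflected conjugates, which changes
  -- nothing for a Hermitian family.
  refine ⟨Complex.reCLM.compLp g, ?_⟩
  funext k
  have hInt : ∀ k, Integrable fun x => g x * conj (mode k x) := fun k => by
    have h1 : MemLp (g : Torus L → ℂ) 1 volume :=
      (Lp.memLp g).mono_exponent (by norm_num)
    refine (memLp_one_iff_integrable.1 h1).mul_bdd (c := 1)
      (Complex.continuous_conj.comp (mode k).continuous).aestronglyMeasurable
      (Eventually.of_forall fun x => ?_)
    rw [Complex.norm_conj, norm_mode]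
  have h2 : coef (Complex.reCLM.compLp g) k = (fc g k + conj (fc g (-k))) / 2 := by
    rw [coef, fc_congr (h := fun x => (((g x).re : ℝ) : ℂ))
      ((Complex.reCLM.coeFn_compLp g).mono fun x hx => by rw [hx]; rfl)]
    have h3 : ∫ x, conj (g x) * conj (mode k x) = conj (∫ x, g x * conj (mode (-k) x)) := by
      rw [← integral_conj]
      simp only [map_mul, Complex.conj_conj, mode_neg]
    have h4 : Integrable fun x => conj (g x) * conj (mode k x) := by
      have := Complex.conjCLE.toContinuousLinearMap.integrable_comp (hInt (-k))
      refine this.congr (Eventually.of_forall fun x => ?_)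
      simp [mode_neg]
    rw [fc, fc, fc, map_mul, ← h3, map_inv₀, map_pow, Complex.conj_ofReal, ← mul_add,
      ← integral_add (hInt k) h4, mul_div_assoc, ← integral_div]
    congr 2
    funext x
    rw [Complex.re_eq_add_conj]; ring
  rw [h2, hgk, hgk, hs k, Complex.conj_conj]; ring

lemma integrable_mul (u v : L2 L) : Integrable fun x => u x * v x :=
  (Lp.memLp u).integrable_mul (Lp.memLp v)

/-- The coefficients of a product are given by convolution. -/
lemma hasSum_coef_mul (u v : L2 L) (k : ℤ × ℤ) :
    HasSum (fun m => coef u (k - m) * coef v m) (fc (fun x => ((u x * v x : ℝ) : ℂ)) k) := by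
  have hL' : (L : ℂ) ≠ 0 := by exact_mod_cast hL.out.ne'
  -- The product uv is only integrable, so Parseval is applied to the pair v and u · `mode k`, both
  -- of which are square integrable.
  have hmem : MemLp (fun x => toC u x * mode k x) 2 volume := by
    refine (Lp.memLp (toC u)).of_le
      ((Lp.aestronglyMeasurable _).mul (mode k).continuous.aestronglyMeasurable)
      (Eventually.of_forall fun x => ?_)
    rw [norm_mul, norm_mode, mul_one]
  have h := hasSum_fc_mul_conj (toC v) (hmem.toLp _)
  have h1 : ∀ m, fc (hmem.toLp _) m = conj (coef u (k - m)) := fun m => by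
    rw [← coef_herm, neg_sub, ← fc_toC, fc_congr hmem.coeFn_toLp, fc, fc]
    congr 2
    funext x
    rw [mode_sub, map_mul, Complex.conj_conj]; ring
  have h2 : ∫ x, toC v x * conj (hmem.toLp _ x) = ∫ x, ((u x * v x : ℝ) : ℂ) * conj (mode k x) := by
    refine integral_congr_ae ?_
    filter_upwards [coeFn_toC u, coeFn_toC v, hmem.coeFn_toLp] with x h1 h2 h3
    rw [h2, h3, h1, map_mul, Complex.conj_ofReal]
    push_cast; ring
  rw [h2, fc_toC] at h
  have h3 := h.mul_left (((L : ℂ) ^ 2)⁻¹)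
  rw [fc]
  refine h3.congr_fun fun m => ?_
  rw [h1, Complex.conj_conj]
  field_simp

end Coef


/-! ### Test functions -/

section Test

variable {L : ℝ}

/-- The fundamental frequency of the torus. -/
noncomputable def freq (L : ℝ) : ℝ := 2 * Real.pi / L

/-- The `i`-th component of a frequency. -/
def cmp (i : Fin 2) (k : ℤ × ℤ) : ℤ := if i = 0 then k.1 else k.2

lemma cmp_neg (i : Fin 2) (k : ℤ × ℤ) : cmp i (-k) = -cmp i k := by
  unfold cmp; split_ifs <;> simp

lemma mode_single (k : ℤ × ℤ) (i : Fin 2) (s : ℝ) :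
    mode k (Pi.single i (s : AddCircle L)) = Complex.exp (Complex.I * freq L * cmp i k * s) := by
  have h0 : ∀ n : ℤ, fourier n (0 : AddCircle L) = 1 := fun n => by simp
  fin_cases i
  · simp only [mode_apply, Fin.zero_eta, Pi.single_eq_same, Pi.single_eq_of_ne (one_ne_zero), h0,
      mul_one, fourier_coe_apply, cmp, if_true, freq]
    congr 1; push_cast; ring
  · simp only [mode_apply, Fin.mk_one, Pi.single_eq_same, Pi.single_eq_of_ne (zero_ne_one), h0,
      one_mul, fourier_coe_apply, cmp, if_neg (one_ne_zero), freq]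
    congr 1; push_cast; ring

/-- The projection of the plane onto the torus. -/
def proj (L : ℝ) (x : Fin 2 → ℝ) : Torus L := fun i => (x i : AddCircle L)

lemma isOpenQuotientMap_proj : IsOpenQuotientMap (proj L) :=
  IsOpenQuotientMap.piMap (f := fun (_ : Fin 2) (x : ℝ) => (x : AddCircle L))
    fun _ => QuotientAddGroup.isOpenQuotientMap_mk

lemma proj_surjective : Function.Surjective (proj L) := isOpenQuotientMap_proj.surjective

lemma proj_add_single (x : Fin 2 → ℝ) (i : Fin 2) (s : ℝ) :
    proj L x + Pi.single i (s : AddCircle L) = proj L (x + s • Pi.single i 1) := by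
  funext j
  by_cases h : j = i
  · subst h; simp [proj]
  · simp [proj, h]

lemma IsTest.contDiff {φ : Torus L → ℝ} (h : IsTest φ) :
    ContDiff ℝ ((⊤ : ℕ∞) : WithTop ℕ∞) fun x => φ (proj L x) := h

lemma IsTest.continuous {φ : Torus L → ℝ} (h : IsTest φ) : Continuous φ :=
  isOpenQuotientMap_proj.isQuotientMap.continuous_iff.2 h.contDiff.continuous

lemma IsTest.hasDerivAt_proj {φ : Torus L → ℝ} (h : IsTest φ) (i : Fin 2) (x : Fin 2 → ℝ) :
    HasDerivAt (fun s : ℝ => φ (proj L x + Pi.single i (s : AddCircle L)))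
      (fderiv ℝ (fun x => φ (proj L x)) x (Pi.single i 1)) 0 := by
  simp_rw [proj_add_single]
  have h1 : HasDerivAt (fun s : ℝ => x + s • (Pi.single i 1 : Fin 2 → ℝ)) (Pi.single i 1) 0 := by
    simpa using ((hasDerivAt_id (0 : ℝ)).smul_const (Pi.single i 1 : Fin 2 → ℝ)).const_add x
  have h2 : HasFDerivAt (fun x => φ (proj L x)) (fderiv ℝ (fun x => φ (proj L x)) x)
      (x + (0 : ℝ) • (Pi.single i 1 : Fin 2 → ℝ)) := by
    simpa using (h.contDiff.differentiable (by simp) x).hasFDerivAt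
  exact h2.comp_hasDerivAt (0 : ℝ) h1

lemma IsTest.pderiv_proj {φ : Torus L → ℝ} (h : IsTest φ) (i : Fin 2) (x : Fin 2 → ℝ) :
    pderiv i φ (proj L x) = fderiv ℝ (fun x => φ (proj L x)) x (Pi.single i 1) :=
  (h.hasDerivAt_proj i x).deriv

lemma IsTest.pderiv {φ : Torus L → ℝ} (h : IsTest φ) (i : Fin 2) : IsTest (pderiv i φ) := by
  have : (fun x => TQG.pderiv i φ (proj L x)) =
      fun x => fderiv ℝ (fun x => φ (proj L x)) x (Pi.single i 1) :=
    funext fun x => h.pderiv_proj i x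
  change ContDiff ℝ _ fun x => TQG.pderiv i φ (proj L x)
  rw [this]
  exact (h.contDiff.fderiv_right (m := ((⊤ : ℕ∞) : WithTop ℕ∞)) le_rfl).clm_apply contDiff_const

lemma IsTest.hasDerivAt {φ : Torus L → ℝ} (h : IsTest φ) (i : Fin 2) (x : Torus L) (s : ℝ) :
    HasDerivAt (fun s : ℝ => φ (x + Pi.single i (s : AddCircle L)))
      (TQG.pderiv i φ (x + Pi.single i (s : AddCircle L))) s := by
  obtain ⟨y, hy⟩ := proj_surjective (L := L) (x + Pi.single i (s : AddCircle L))
  have h1 := h.hasDerivAt_proj i y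
  rw [← h.pderiv_proj, hy] at h1
  have h1' : HasDerivAt (fun r : ℝ => φ (x + Pi.single i (s : AddCircle L) +
      Pi.single i (r : AddCircle L))) (TQG.pderiv i φ (x + Pi.single i (s : AddCircle L)))
      (s - s) := by rwa [sub_self]
  have h3 := h1'.comp_sub_const s s
  convert! h3 using 1
  funext r
  rw [add_assoc, ← Pi.single_add, ← AddCircle.coe_add, add_sub_cancel]

lemma IsTest.iterate {φ : Torus L → ℝ} (h : IsTest φ) (i : Fin 2) (n : ℕ) :
    IsTest ((TQG.pderiv i)^[n] φ) := by
  induction n with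
  | zero => exact h
  | succ n ih => rw [Function.iterate_succ_apply']; exact ih.pderiv i

lemma IsTest.mderiv {φ : Torus L → ℝ} (h : IsTest φ) (β : ℕ × ℕ) : IsTest (mderiv β φ) :=
  (h.iterate 1 β.2).iterate 0 β.1

/-- The Fourier symbol of `∂^β`. -/
noncomputable def dsym (L : ℝ) (β : ℕ × ℕ) (k : ℤ × ℤ) : ℂ :=
  (Complex.I * freq L * k.1) ^ β.1 * (Complex.I * freq L * k.2) ^ β.2

lemma dsym_neg (β : ℕ × ℕ) (k : ℤ × ℤ) :
    dsym L β (-k) = (-1) ^ (β.1 + β.2) * dsym L β k := by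
  simp only [dsym, Prod.fst_neg, Prod.snd_neg, Int.cast_neg, mul_neg]
  rw [neg_pow, neg_pow (Complex.I * freq L * k.2), pow_add]; ring

/-! ### Trigonometric test functions -/

/-- The real trigonometric monomials. -/
noncomputable def rmode (c : ℂ) (k : ℤ × ℤ) (x : Torus L) : ℝ := (c * mode k x).re

lemma pderiv_rmode (i : Fin 2) (c : ℂ) (k : ℤ × ℤ) :
    pderiv i (rmode c k) = rmode (L := L) (Complex.I * freq L * cmp i k * c) k := by
  funext x
  have h3 : HasDerivAt (fun s : ℝ => Complex.I * freq L * cmp i k * (s : ℂ))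
      (Complex.I * freq L * cmp i k) 0 := by
    simpa using ((hasDerivAt_id (0 : ℝ)).ofReal_comp).const_mul (Complex.I * freq L * cmp i k)
  have h4 : HasDerivAt (fun s : ℝ => c * mode k (x + Pi.single i (s : AddCircle L)))
      (Complex.I * freq L * cmp i k * c * mode k x) 0 := by
    simp_rw [mode_add_right, mode_single]
    have := (h3.cexp.const_mul (mode k x)).const_mul c
    refine this.congr_deriv ?_
    simp; ring
  exact (Complex.reCLM.hasFDerivAt.comp_hasDerivAt (0 : ℝ) h4).deriv

lemma isTest_rmode (c : ℂ) (k : ℤ × ℤ) : IsTest (rmode (L := L) c k) := by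
  have : (fun x : Fin 2 → ℝ => rmode (L := L) c k fun i => (x i : AddCircle L)) =
      fun x => Complex.reCLM (c * (Complex.exp (2 * Real.pi * Complex.I * k.1 / L * (x 0 : ℂ)) *
        Complex.exp (2 * Real.pi * Complex.I * k.2 / L * (x 1 : ℂ)))) := by
    funext x
    simp only [rmode, mode_apply, fourier_coe_apply, Complex.reCLM_apply]
    congr 4 <;> ring
  unfold IsTest
  rw [this]
  have h : ∀ i : Fin 2, ContDiff ℝ ((⊤ : ℕ∞) : WithTop ℕ∞) fun x : Fin 2 → ℝ => ((x i : ℝ) : ℂ) :=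
    fun i => Complex.ofRealCLM.contDiff.comp (contDiff_apply ℝ ℝ i)
  exact Complex.reCLM.contDiff.comp (contDiff_const.mul
    ((contDiff_const.mul (h 0)).cexp.mul (contDiff_const.mul (h 1)).cexp))

lemma mderiv_rmode (β : ℕ × ℕ) (c : ℂ) (k : ℤ × ℤ) :
    mderiv β (rmode c k) = rmode (L := L) (dsym L β k * c) k := by
  have key : ∀ (i : Fin 2) (n : ℕ) (c : ℂ), (pderiv i)^[n] (rmode c k) =
      rmode (L := L) ((Complex.I * freq L * cmp i k) ^ n * c) k := by
    intro i n c
    induction n with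
    | zero => simp
    | succ n ih =>
      rw [Function.iterate_succ_apply', ih, pderiv_rmode, pow_succ]
      congr 1; ring
  rw [mderiv, key, key, dsym]
  simp only [cmp, if_true, if_neg (one_ne_zero)]
  congr 1; ring

/-- Test functions are real, so testing with `rmode c k` yields only a real part; varying the
complex amplitude c recovers the whole coefficient. -/
lemma eq_of_forall_re {z w : ℂ} (h : ∀ c : ℂ, (c * z).re = (c * w).re) : z = w := by
  refine Complex.ext (by simpa using h 1) ?_
  have := h Complex.I
  simpa using this

variable [hL : Fact (0 < L)]

lemma exists_bound {φ : Torus L → ℝ} (h : Continuous φ) : ∃ C, 0 ≤ C ∧ ∀ x, |φ x| ≤ C := by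
  obtain ⟨C, hC⟩ := isCompact_univ.exists_bound_of_continuousOn h.continuousOn
  exact ⟨C, (abs_nonneg _).trans (hC 0 (mem_univ _)), fun x => hC x (mem_univ _)⟩

lemma norm_fc_le {φ : Torus L → ℝ} {C : ℝ} (hC : ∀ x, |φ x| ≤ C) (k : ℤ × ℤ) :
    ‖fc (fun x => (φ x : ℂ)) k‖ ≤ C := by
  have hLp := hL.out
  have hv : (volume : Measure (Torus L)).real univ = L ^ 2 := by
    rw [measureReal_def, volume_pi, Measure.pi_univ]
    simp [AddCircle.measure_univ, hL.out.le]
  have := norm_integral_le_of_norm_le_const (μ := (volume : Measure (Torus L)))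
    (f := fun x => (φ x : ℂ) * conj (mode k x)) (C := C) (Eventually.of_forall fun x => by
      rw [norm_mul, Complex.norm_conj, norm_mode, mul_one, Complex.norm_real]; exact hC x)
  rw [hv] at this
  rw [fc, norm_mul, norm_inv, norm_pow, Complex.norm_real, Real.norm_of_nonneg hLp.le]
  rw [inv_mul_le_iff₀ (by positivity)]
  linarith

/-- Translation invariance makes the coefficient of a translate an explicit exponential in s.
Differentiating at s = 0 gives the coefficients of a partial derivative and replaces integration by
parts on the torus. -/
lemma integral_translate_mul_conj_mode (φ : Torus L → ℝ) (i : Fin 2) (k : ℤ × ℤ) (s : ℝ) :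
    ∫ x : Torus L, ((φ (x + Pi.single i (s : AddCircle L)) : ℝ) : ℂ) * conj (mode k x) =
      Complex.exp (Complex.I * freq L * cmp i k * s) *
        ∫ x : Torus L, (φ x : ℂ) * conj (mode k x) := by
  rw [← mode_single]
  generalize (Pi.single i (s : AddCircle L) : Torus L) = y
  rw [← integral_const_mul, ← integral_add_right_eq_self (fun x : Torus L =>
    mode k y * ((φ x : ℂ) * conj (mode k x))) y]
  congr 1
  funext x
  have h1 : mode k y * conj (mode k y) = 1 := by
    rw [Complex.mul_conj, Complex.normSq_eq_norm_sq, norm_mode]; simp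
  rw [mode_add_right, map_mul]
  linear_combination (-(φ (x + y) : ℂ) * conj (mode k x)) * h1

lemma hasDerivAt_integral_translate {φ : Torus L → ℝ} (h : IsTest φ) (i : Fin 2) (k : ℤ × ℤ) :
    HasDerivAt (fun s : ℝ => ∫ x : Torus L,
      ((φ (x + Pi.single i (s : AddCircle L)) : ℝ) : ℂ) * conj (mode k x))
      (∫ x : Torus L, (pderiv i φ x : ℂ) * conj (mode k x)) 0 := by
  have hφ := h.continuous
  have hφ' := (h.pderiv i).continuous
  obtain ⟨C, hC0, hC⟩ := exists_bound hφ'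
  have hm : Continuous fun x : Torus L => conj (mode k x) :=
    Complex.continuous_conj.comp (mode k).continuous
  have hcont : ∀ {ψ : Torus L → ℝ}, Continuous ψ → ∀ y : Torus L, Continuous fun x : Torus L =>
      ((ψ (x + y) : ℝ) : ℂ) * conj (mode k x) := fun hψ s =>
    (Complex.continuous_ofReal.comp (hψ.comp (continuous_id.add continuous_const))).mul hm
  have hInt : ∀ {ψ : Torus L → ℂ}, Continuous ψ → Integrable ψ := fun hψ =>
    hψ.integrable_of_hasCompactSupport (HasCompactSupport.of_compactSpace _)
  set F : ℝ → Torus L → ℂ := fun s x =>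
    ((φ (x + Pi.single i (s : AddCircle L)) : ℝ) : ℂ) * conj (mode k x) with hF
  set F' : ℝ → Torus L → ℂ := fun s x =>
    ((pderiv i φ (x + Pi.single i (s : AddCircle L)) : ℝ) : ℂ) * conj (mode k x) with hF'
  have hb : ∀ x s, ‖F' s x‖ ≤ C := fun x s => by
    rw [hF', norm_mul, Complex.norm_conj, norm_mode, mul_one, Complex.norm_real]; exact hC _
  have hd : ∀ x s, HasDerivAt (fun s => F s x) (F' s x) s := fun x s =>
    ((h.hasDerivAt i x s).ofReal_comp).mul_const _
  have h0 : F' 0 = fun x => (pderiv i φ x : ℂ) * conj (mode k x) := by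
    funext x
    rw [hF']
    dsimp only
    rw [AddCircle.coe_zero, Pi.single_zero, add_zero]
  rw [← h0]
  exact (hasDerivAt_integral_of_dominated_loc_of_deriv_le (μ := (volume : Measure (Torus L)))
    (F := F) (F' := F') (x₀ := 0) (s := univ) (bound := fun _ => C) univ_mem
    (Eventually.of_forall fun s => (hcont hφ _).aestronglyMeasurable)
    (hInt (hcont hφ _)) (hcont hφ' _).aestronglyMeasurable
    (Eventually.of_forall fun x s _ => hb x s) (integrable_const _)
    (Eventually.of_forall fun x s _ => hd x s)).2

lemma fc_pderiv {φ : Torus L → ℝ} (h : IsTest φ) (i : Fin 2) (k : ℤ × ℤ) :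
    fc (fun x => (pderiv i φ x : ℂ)) k =
      Complex.I * freq L * cmp i k * fc (fun x => (φ x : ℂ)) k := by
  have key := hasDerivAt_integral_translate h i k
  simp_rw [integral_translate_mul_conj_mode] at key
  have h3 : HasDerivAt (fun s : ℝ => Complex.I * freq L * cmp i k * (s : ℂ))
      (Complex.I * freq L * cmp i k) 0 := by
    simpa using ((hasDerivAt_id (0 : ℝ)).ofReal_comp).const_mul (Complex.I * freq L * cmp i k)
  have h4 := key.unique (h3.cexp.mul_const _)
  rw [fc, fc, h4]
  simp only [Complex.ofReal_zero, mul_zero, Complex.exp_zero, one_mul]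
  ring

lemma fc_mderiv {φ : Torus L → ℝ} (h : IsTest φ) (β : ℕ × ℕ) (k : ℤ × ℤ) :
    fc (fun x => (mderiv β φ x : ℂ)) k = dsym L β k * fc (fun x => (φ x : ℂ)) k := by
  have key : ∀ (i : Fin 2) (n : ℕ) {ψ : Torus L → ℝ}, IsTest ψ →
      fc (fun x => ((pderiv i)^[n] ψ x : ℂ)) k =
        (Complex.I * freq L * cmp i k) ^ n * fc (fun x => (ψ x : ℂ)) k := by
    intro i n ψ hψ
    induction n with
    | zero => simp
    | succ n ih =>
      rw [Function.iterate_succ_apply', fc_pderiv (hψ.iterate i n), ih, pow_succ]; ring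
  rw [mderiv, key 0 β.1 (h.iterate 1 β.2), key 1 β.2 h, dsym]
  simp only [cmp, if_true, if_neg (one_ne_zero)]
  ring

lemma freq_pos : 0 < freq L := by
  have := hL.out; have := Real.pi_pos; unfold freq; positivity

/-- Four derivatives in each coordinate direction give decay of order `wt k ^ (-4)`, which is
summable. -/
lemma summable_fc {φ : Torus L → ℝ} (h : IsTest φ) :
    Summable fun k => ‖fc (fun x => (φ x : ℂ)) k‖ := by
  obtain ⟨C₀, hC₀, h₀⟩ := exists_bound h.continuous
  obtain ⟨C₁, hC₁, h₁⟩ := exists_bound (h.mderiv (4, 0)).continuous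
  obtain ⟨C₂, hC₂, h₂⟩ := exists_bound (h.mderiv (0, 4)).continuous
  have hξ := freq_pos (L := L)
  refine Summable.of_nonneg_of_le (fun _ => norm_nonneg _) (fun k => ?_)
    (summable_wt.mul_left (27 * (C₀ + (freq L ^ 4)⁻¹ * C₁ + (freq L ^ 4)⁻¹ * C₂)))
  have hw := wt_pos k
  rw [← div_eq_mul_inv, le_div_iff₀ (by positivity)]
  have e0 := norm_fc_le h₀ k
  have e1 := norm_fc_le h₁ k
  have e2 := norm_fc_le h₂ k
  rw [fc_mderiv h, norm_mul] at e1 e2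
  have d1 : ‖dsym L (4, 0) k‖ = freq L ^ 4 * (k.1 : ℝ) ^ 4 := by
    simp only [dsym, pow_zero, mul_one, norm_pow, norm_mul, Complex.norm_I,
      Complex.norm_real, Real.norm_of_nonneg hξ.le, Complex.norm_intCast, mul_pow]
    rw [one_pow, one_mul, show (4 : ℕ) = 2 * 2 by norm_num, pow_mul |((k.1 : ℤ) : ℝ)|, sq_abs, ← pow_mul]
  have d2 : ‖dsym L (0, 4) k‖ = freq L ^ 4 * (k.2 : ℝ) ^ 4 := by
    simp only [dsym, pow_zero, one_mul, norm_pow, norm_mul, Complex.norm_I,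
      Complex.norm_real, Real.norm_of_nonneg hξ.le, Complex.norm_intCast, mul_pow]
    rw [one_pow, one_mul, show (4 : ℕ) = 2 * 2 by norm_num, pow_mul |((k.2 : ℤ) : ℝ)|, sq_abs, ← pow_mul]
  rw [d1] at e1
  rw [d2] at e2
  set z := ‖fc (fun x => (φ x : ℂ)) k‖
  have hz : 0 ≤ z := norm_nonneg _
  have e1' : (k.1 : ℝ) ^ 4 * z ≤ (freq L ^ 4)⁻¹ * C₁ := by
    rw [le_inv_mul_iff₀ (by positivity)]; linarith
  have e2' : (k.2 : ℝ) ^ 4 * z ≤ (freq L ^ 4)⁻¹ * C₂ := by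
    rw [le_inv_mul_iff₀ (by positivity)]; linarith
  -- The inequality (x + y + z)² ≤ 3 (x² + y² + z²) is used twice, whence 27 = 3² · 3.
  have hpow : wt k ^ 4 ≤ 27 * (1 + (k.1 : ℝ) ^ 4 + (k.2 : ℝ) ^ 4) := by
    have a1 : (k.1 : ℝ) ^ 4 = |(k.1 : ℝ)| ^ 4 := by
      rw [show (4 : ℕ) = 2 * 2 by norm_num, pow_mul, pow_mul, sq_abs]
    have a2 : (k.2 : ℝ) ^ 4 = |(k.2 : ℝ)| ^ 4 := by
      rw [show (4 : ℕ) = 2 * 2 by norm_num, pow_mul, pow_mul, sq_abs]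
    rw [a1, a2, wt]
    generalize |(k.1 : ℝ)| = p
    generalize |(k.2 : ℝ)| = q
    have b1 : (1 + p + q) ^ 2 ≤ 3 * (1 + p ^ 2 + q ^ 2) := by
      nlinarith [sq_nonneg (p - 1), sq_nonneg (q - 1), sq_nonneg (p - q)]
    have b2 : (1 + p ^ 2 + q ^ 2) ^ 2 ≤ 3 * (1 + p ^ 4 + q ^ 4) := by
      nlinarith [sq_nonneg (p ^ 2 - 1), sq_nonneg (q ^ 2 - 1), sq_nonneg (p ^ 2 - q ^ 2)]
    calc (1 + p + q) ^ 4 = ((1 + p + q) ^ 2) ^ 2 := by ring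
      _ ≤ (3 * (1 + p ^ 2 + q ^ 2)) ^ 2 := by gcongr
      _ = 9 * (1 + p ^ 2 + q ^ 2) ^ 2 := by ring
      _ ≤ _ := by linarith
  calc z * wt k ^ 4 ≤ z * (27 * (1 + (k.1 : ℝ) ^ 4 + (k.2 : ℝ) ^ 4)) := by gcongr
    _ = 27 * (z + (k.1 : ℝ) ^ 4 * z + (k.2 : ℝ) ^ 4 * z) := by ring
    _ ≤ _ := by linarith

/-- The Fourier series of a test function may be integrated against any integrable function. -/
lemma hasSum_integral_mul {φ : Torus L → ℝ} (h : IsTest φ) {g : Torus L → ℝ}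
    (hg : Integrable g) :
    HasSum (fun k => (L : ℂ) ^ 2 * (fc (fun x => (φ x : ℂ)) k * fc (fun x => (g x : ℂ)) (-k)))
      ((∫ x, g x * φ x : ℝ) : ℂ) := by
  have hL' : (L : ℂ) ≠ 0 := by exact_mod_cast hL.out.ne'
  set a := fc (fun x => (φ x : ℂ)) with ha
  let Φ : C(Torus L, ℂ) := ⟨fun x => (φ x : ℂ), Complex.continuous_ofReal.comp h.continuous⟩
  have hsum : Summable fun k => a k • mode (L := L) k := by
    refine Summable.of_norm_bounded (summable_fc h) fun k => ?_
    rw [norm_smul]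
    refine mul_le_of_le_one_right (norm_nonneg _) ?_
    exact (ContinuousMap.norm_le _ zero_le_one).2 fun x => (norm_mode k x).le
  obtain ⟨S, hS⟩ := hsum
  -- The uniform limit S of the Fourier series has the coefficients of φ, so the two agree almost
  -- everywhere. Absolute convergence then allows integration term by term against a merely
  -- integrable g.
  have hΦ : ContinuousMap.toLp (E := ℂ) 2 (volume : Measure (Torus L)) ℂ Φ =
      ContinuousMap.toLp (E := ℂ) 2 volume ℂ S := by
    have h1 := (ContinuousMap.toLp (E := ℂ) 2 (volume : Measure (Torus L)) ℂ).hasSum hS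
    have h2 := modeBasis.hasSum_repr (ContinuousMap.toLp (E := ℂ) 2 (volume : Measure (Torus L)) ℂ Φ)
    refine h2.unique (h1.congr_fun fun k => ?_)
    rw [modeBasis.repr_apply_apply, modeBasis_apply, inner_modeLp,
      fc_congr (ContinuousMap.coeFn_toLp (p := 2) (𝕜 := ℂ) (volume : Measure (Torus L)) Φ),
      map_smul, modeLp, map_smul, smul_smul]
    congr 1
    change (L : ℂ) * a k * (L : ℂ)⁻¹ = a k
    field_simp
  have hae : ∀ᵐ x : Torus L, (φ x : ℂ) = S x := by
    have h1 := ContinuousMap.coeFn_toLp (p := 2) (𝕜 := ℂ) (volume : Measure (Torus L)) Φ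
    have h2 := ContinuousMap.coeFn_toLp (p := 2) (𝕜 := ℂ) (volume : Measure (Torus L)) S
    filter_upwards [h1, h2] with x h1 h2
    rw [← h2, ← hΦ, h1]; rfl
  have hgC : Integrable fun x => (g x : ℂ) := hg.ofReal
  have hF : ∀ k, Integrable fun x => (g x : ℂ) * (a k * mode k x) := fun k => by
    refine hgC.mul_bdd (c := ‖a k‖)
      (continuous_const.mul (mode k).continuous).aestronglyMeasurable
      (Eventually.of_forall fun x => ?_)
    rw [norm_mul, norm_mode, mul_one]
  have hFs : Summable fun k => ∫ x, ‖(g x : ℂ) * (a k * mode k x)‖ := by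
    have : (fun k => ∫ x, ‖(g x : ℂ) * (a k * mode k x)‖) =
        fun k => ‖a k‖ * ∫ x, ‖(g x : ℂ)‖ := by
      funext k
      rw [← integral_const_mul]
      congr 1; funext x
      rw [norm_mul, norm_mul, norm_mode]; ring
    rw [this]
    exact (summable_fc h).mul_right _
  have hfin := hasSum_integral_of_summable_integral_norm hF hFs
  have e1 : ∫ x, ∑' k, (g x : ℂ) * (a k * mode k x) = ((∫ x, g x * φ x : ℝ) : ℂ) := by
    rw [← integral_complex_ofReal]
    refine integral_congr_ae ?_
    filter_upwards [hae] with x hx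
    rw [tsum_mul_left, Complex.ofReal_mul, hx]
    congr 1
    exact (ContinuousMap.hasSum_apply hS x).tsum_eq
  rw [e1] at hfin
  refine hfin.congr_fun fun k => ?_
  have e2 : ∫ x, (g x : ℂ) * (a k * mode k x) = a k * ∫ x, (g x : ℂ) * conj (mode (-k) x) := by
    rw [← integral_const_mul]
    congr 1; funext x
    rw [mode_neg, Complex.conj_conj]; ring
  rw [e2, fc]
  field_simp

lemma integral_mul_rmode {g : Torus L → ℝ} (hg : Integrable g) (c : ℂ) (k : ℤ × ℤ) :
    ∫ x, g x * rmode c k x = (c * ((L : ℂ) ^ 2 * fc (fun x => (g x : ℂ)) (-k))).re := by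
  have hL' : (L : ℂ) ≠ 0 := by exact_mod_cast hL.out.ne'
  have hInt : Integrable fun x => (g x : ℂ) * (c * mode k x) := by
    refine hg.ofReal.mul_bdd (c := ‖c‖)
      (continuous_const.mul (mode k).continuous).aestronglyMeasurable
      (Eventually.of_forall fun x => ?_)
    rw [norm_mul, norm_mode, mul_one]
  have h1 : ∫ x, g x * rmode c k x = (∫ x, (g x : ℂ) * (c * mode k x)).re := by
    have := integral_re hInt
    simp only [RCLike.re_to_complex] at this
    rw [← this]
    congr 1; funext x
    rw [rmode, Complex.re_ofReal_mul]
  have h2 : ∫ x, (g x : ℂ) * (c * mode k x) = c * ∫ x, (g x : ℂ) * conj (mode (-k) x) := by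
    rw [← integral_const_mul]
    congr 1; funext x
    rw [mode_neg, Complex.conj_conj]; ring
  rw [h1, h2, fc]
  congr 1
  field_simp

end Test


/-! ### Weak derivatives in terms of Fourier coefficients -/

section Weak

variable {L : ℝ}

/-- The Fourier multiplier of `-(Δ - 1)`. -/
noncomputable def helm (L : ℝ) (k : ℤ × ℤ) : ℝ := 1 + freq L ^ 2 * ((k.1 : ℝ) ^ 2 + (k.2 : ℝ) ^ 2)

lemma helm_pos (k : ℤ × ℤ) : 0 < helm L k := by unfold helm; positivity

lemma helm_neg (k : ℤ × ℤ) : helm L (-k) = helm L k := by simp [helm]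

lemma dsym_laplacian (k : ℤ × ℤ) : dsym L (2, 0) k + dsym L (0, 2) k - 1 = -(helm L k : ℂ) := by
  simp only [dsym, helm, pow_zero, mul_one, one_mul, mul_pow, Complex.I_sq]
  push_cast; ring

lemma one_le_helm (k : ℤ × ℤ) : 1 ≤ helm L k := by
  unfold helm
  have : 0 ≤ freq L ^ 2 * ((k.1 : ℝ) ^ 2 + (k.2 : ℝ) ^ 2) := by positivity
  linarith

lemma helm_bounds (k : ℤ × ℤ) : freq L * |(k.1 : ℝ)| ≤ helm L k ∧ freq L * |(k.2 : ℝ)| ≤ helm L k := by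
  unfold helm
  have h1 := sq_abs (k.1 : ℝ)
  have h2 := sq_abs (k.2 : ℝ)
  constructor
  · nlinarith [sq_nonneg (freq L * |(k.1 : ℝ)| - 1), sq_nonneg (freq L * |(k.2 : ℝ)|)]
  · nlinarith [sq_nonneg (freq L * |(k.2 : ℝ)| - 1), sq_nonneg (freq L * |(k.1 : ℝ)|)]

lemma dsym_herm (β : ℕ × ℕ) : Herm (dsym L β) := fun k => by
  simp [dsym]

lemma wt_pow_le (s : ℕ) (k : ℤ × ℤ) :
    wt k ^ s ≤ 3 ^ s * (1 + |(k.1 : ℝ)| ^ s + |(k.2 : ℝ)| ^ s) := by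
  have h1 := abs_nonneg (k.1 : ℝ)
  have h2 := abs_nonneg (k.2 : ℝ)
  unfold wt
  generalize |(k.1 : ℝ)| = p at *
  generalize |(k.2 : ℝ)| = q at *
  have hp : 0 ≤ p ^ s := by positivity
  have hq : 0 ≤ q ^ s := by positivity
  have key : ∀ r : ℝ, 0 ≤ r → 1 ≤ r → p ≤ r → q ≤ r →
      r ^ s ≤ 1 + p ^ s + q ^ s → (1 + p + q) ^ s ≤ 3 ^ s * (1 + p ^ s + q ^ s) := by
    intro r hr h1 h2 h3 h4
    calc (1 + p + q) ^ s ≤ (3 * r) ^ s := by gcongr; linarith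
      _ = 3 ^ s * r ^ s := mul_pow _ _ _
      _ ≤ _ := by gcongr
  rcases le_total p q with hpq | hpq
  · rcases le_total 1 q with hq1 | hq1
    · exact key q h2 hq1 hpq le_rfl (by linarith)
    · exact key 1 zero_le_one le_rfl (hpq.trans hq1) hq1 (by rw [one_pow]; linarith)
  · rcases le_total 1 p with hp1 | hp1
    · exact key p h1 hp1 le_rfl hpq (by linarith)
    · exact key 1 zero_le_one le_rfl hp1 (hpq.trans hp1) (by rw [one_pow]; linarith)

variable [hL : Fact (0 < L)]

lemma integrable_L2 (u : L2 L) : Integrable fun x => u x :=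
  (Lp.memLp u).integrable (by norm_num)

lemma sq_ne_zero_L : (L : ℂ) ^ 2 ≠ 0 := pow_ne_zero _ (by exact_mod_cast hL.out.ne')

/-- Trigonometric monomials are test functions, which isolates each coefficient; conversely the
absolutely convergent Fourier series of a test function sums the identities back. The same two
arguments prove `hasWeakDiv_iff` and `isStream_iff`. -/
lemma hasWeakDeriv_iff (β : ℕ × ℕ) (u v : L2 L) :
    HasWeakDeriv β u v ↔ ∀ k, coef v k = dsym L β k * coef u k := by
  constructor
  · intro h k
    have h1 : ∀ c : ℂ, (c * (dsym L β (-k) * ((L : ℂ) ^ 2 * coef u k))).re =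
        (c * ((-1) ^ (β.1 + β.2) * ((L : ℂ) ^ 2 * coef v k))).re := by
      intro c
      have := h (rmode c (-k)) (isTest_rmode c (-k))
      rw [mderiv_rmode, integral_mul_rmode (integrable_L2 u), integral_mul_rmode (integrable_L2 v),
        neg_neg] at this
      have e : ((-1 : ℝ) ^ (β.1 + β.2)) * (c * ((L : ℂ) ^ 2 * coef v k)).re =
          (c * ((-1) ^ (β.1 + β.2) * ((L : ℂ) ^ 2 * coef v k))).re := by
        rw [← Complex.re_ofReal_mul]
        congr 1; push_cast; ring
      rw [← e]
      refine Eq.trans ?_ this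
      congr 1
      change c * (dsym L β (-k) * ((L : ℂ) ^ 2 * fc (fun x => (u x : ℂ)) k)) = _
      ring
    have h2 := eq_of_forall_re h1
    rw [dsym_neg] at h2
    have h3 : ((-1 : ℂ) ^ (β.1 + β.2)) ≠ 0 := pow_ne_zero _ (by norm_num)
    have h4 := sq_ne_zero_L (L := L)
    have h5 : ((-1 : ℂ) ^ (β.1 + β.2) * (L : ℂ) ^ 2) * coef v k =
        ((-1 : ℂ) ^ (β.1 + β.2) * (L : ℂ) ^ 2) * (dsym L β k * coef u k) := by
      linear_combination -h2
    exact mul_left_cancel₀ (mul_ne_zero h3 h4) h5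
  · intro h φ hφ
    have h1 := hasSum_integral_mul (hφ.mderiv β) (integrable_L2 u)
    have h2 := (hasSum_integral_mul hφ (integrable_L2 v)).mul_left ((-1) ^ (β.1 + β.2))
    have h3 : ((∫ x, u x * mderiv β φ x : ℝ) : ℂ) =
        (-1) ^ (β.1 + β.2) * ((∫ x, v x * φ x : ℝ) : ℂ) := by
      refine h1.unique (h2.congr_fun fun k => ?_)
      have e1 : fc (fun x => (v x : ℂ)) (-k) = dsym L β (-k) * fc (fun x => (u x : ℂ)) (-k) := h (-k)
      have e2 : ((-1 : ℂ) ^ (β.1 + β.2)) * (-1) ^ (β.1 + β.2) = 1 := by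
        rw [← mul_pow]; simp
      rw [fc_mderiv hφ, e1, dsym_neg]
      linear_combination (-(L : ℂ) ^ 2 * dsym L β k * fc (fun x => (φ x : ℂ)) k *
        fc (fun x => (u x : ℂ)) (-k)) * e2
    exact_mod_cast h3

lemma integrable_mul_test {g : Torus L → ℝ} (hg : Integrable g) {φ : Torus L → ℝ}
    (hφ : Continuous φ) : Integrable fun x => g x * φ x := by
  obtain ⟨C, -, hC⟩ := exists_bound hφ
  exact hg.mul_bdd (c := C) hφ.aestronglyMeasurable (Eventually.of_forall hC)

lemma hasWeakDiv_iff {g : Fin 2 → Torus L → ℝ} (hg : ∀ i, Integrable (g i)) (v : L2 L) :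
    HasWeakDiv g v ↔ ∀ k, coef v k = Complex.I * freq L * k.1 * fc (fun x => (g 0 x : ℂ)) k +
      Complex.I * freq L * k.2 * fc (fun x => (g 1 x : ℂ)) k := by
  have hsplit : ∀ φ : Torus L → ℝ, IsTest φ → ∫ x, ∑ i, g i x * pderiv i φ x =
      (∫ x, g 0 x * pderiv 0 φ x) + ∫ x, g 1 x * pderiv 1 φ x := fun φ hφ => by
    simp_rw [Fin.sum_univ_two]
    exact integral_add (integrable_mul_test (hg 0) (hφ.pderiv 0).continuous)
      (integrable_mul_test (hg 1) (hφ.pderiv 1).continuous)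
  constructor
  · intro h k
    have h1 : ∀ c : ℂ, (c * ((L : ℂ) ^ 2 * (Complex.I * freq L * k.1 * fc (fun x => (g 0 x : ℂ)) k +
        Complex.I * freq L * k.2 * fc (fun x => (g 1 x : ℂ)) k))).re =
        (c * ((L : ℂ) ^ 2 * coef v k)).re := by
      intro c
      have := h (rmode c (-k)) (isTest_rmode c (-k))
      rw [hsplit _ (isTest_rmode c (-k)), pderiv_rmode, pderiv_rmode, integral_mul_rmode (hg 0),
        integral_mul_rmode (hg 1), integral_mul_rmode (integrable_L2 v), neg_neg] at this
      rw [coef, ← neg_neg (c * ((L : ℂ) ^ 2 * fc (fun x => (v x : ℂ)) k)).re, ← this,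
        ← Complex.add_re, ← Complex.neg_re]
      congr 1
      simp only [cmp_neg]
      simp only [cmp, if_true, if_neg (one_ne_zero)]
      push_cast; ring
    exact (mul_left_cancel₀ sq_ne_zero_L (eq_of_forall_re h1)).symm
  · intro h φ hφ
    rw [hsplit φ hφ]
    have h0 := hasSum_integral_mul (hφ.pderiv 0) (hg 0)
    have h1 := hasSum_integral_mul (hφ.pderiv 1) (hg 1)
    have h2 := (hasSum_integral_mul hφ (integrable_L2 v)).neg
    have h3 : ((∫ x, g 0 x * pderiv 0 φ x : ℝ) : ℂ) + ((∫ x, g 1 x * pderiv 1 φ x : ℝ) : ℂ) =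
        -((∫ x, v x * φ x : ℝ) : ℂ) := by
      refine (h0.add h1).unique (h2.congr_fun fun k => ?_)
      have e1 : fc (fun x => (v x : ℂ)) (-k) = _ := h (-k)
      rw [fc_pderiv hφ, fc_pderiv hφ, e1]
      simp only [cmp, if_true, if_neg (one_ne_zero), Prod.fst_neg, Prod.snd_neg]
      push_cast; ring
    exact_mod_cast h3

lemma isStream_iff (f ω ψ : L2 L) :
    (∀ φ : Torus L → ℝ, IsTest φ →
      ∫ x, ψ x * (mderiv (2, 0) φ x + mderiv (0, 2) φ x - φ x) = ∫ x, (ω x - f x) * φ x) ↔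
    ∀ k, (helm L k : ℂ) * coef ψ k = -(coef ω k - coef f k) := by
  have hsub : ∀ φ : Torus L → ℝ, ∫ x, (ω x - f x) * φ x = ∫ x, (ω - f : L2 L) x * φ x := fun φ =>
    integral_congr_ae ((Lp.coeFn_sub ω f).mono fun x hx => by
      change _ = (ω - f : L2 L) x * φ x
      rw [hx, Pi.sub_apply])
  have hsplit : ∀ φ : Torus L → ℝ, IsTest φ →
      ∫ x, ψ x * (mderiv (2, 0) φ x + mderiv (0, 2) φ x - φ x) =
      (∫ x, ψ x * mderiv (2, 0) φ x) + (∫ x, ψ x * mderiv (0, 2) φ x) - ∫ x, ψ x * φ x :=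
    fun φ hφ => by
    have i1 := integrable_mul_test (integrable_L2 ψ) (hφ.mderiv (2, 0)).continuous
    have i2 := integrable_mul_test (integrable_L2 ψ) (hφ.mderiv (0, 2)).continuous
    have i3 := integrable_mul_test (integrable_L2 ψ) hφ.continuous
    have i12 : Integrable fun x => ψ x * mderiv (2, 0) φ x + ψ x * mderiv (0, 2) φ x := i1.add i2
    rw [← integral_add i1 i2, ← integral_sub i12 i3]
    congr 1; funext x
    ring
  constructor
  · intro h k
    have h1 : ∀ c : ℂ, (c * ((L : ℂ) ^ 2 * (-(helm L k : ℂ) * coef ψ k))).re =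
        (c * ((L : ℂ) ^ 2 * coef (ω - f) k)).re := by
      intro c
      have := h (rmode c (-k)) (isTest_rmode c (-k))
      rw [hsub, hsplit _ (isTest_rmode c (-k)), mderiv_rmode, mderiv_rmode,
        integral_mul_rmode (integrable_L2 ψ), integral_mul_rmode (integrable_L2 ψ),
        integral_mul_rmode (integrable_L2 ψ), integral_mul_rmode (integrable_L2 (ω - f)),
        neg_neg] at this
      rw [coef, coef, ← this, ← Complex.add_re, ← Complex.sub_re, ← helm_neg, ← dsym_laplacian]
      congr 1; ring
    have h2 := mul_left_cancel₀ sq_ne_zero_L (eq_of_forall_re h1)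
    rw [coef_sub] at h2
    linear_combination -h2
  · intro h φ hφ
    rw [hsub, hsplit φ hφ]
    have h1 := ((hasSum_integral_mul (hφ.mderiv (2, 0)) (integrable_L2 ψ)).add
      (hasSum_integral_mul (hφ.mderiv (0, 2)) (integrable_L2 ψ))).sub
      (hasSum_integral_mul hφ (integrable_L2 ψ))
    have h2 := hasSum_integral_mul hφ (integrable_L2 (ω - f))
    have h3 := h1.unique (h2.congr_fun fun k => by
      have e1 : fc (fun x => (((ω - f : L2 L) x : ℝ) : ℂ)) (-k) = coef ω (-k) - coef f (-k) :=
        coef_sub ω f (-k)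
      have e2 := h (-k)
      rw [helm_neg] at e2
      have e3 := dsym_laplacian (L := L) k
      have e4 : coef ψ (-k) = fc (fun x => (ψ x : ℂ)) (-k) := rfl
      rw [fc_mderiv hφ, fc_mderiv hφ, e1, ← e4]
      linear_combination ((L : ℂ) ^ 2 * fc (fun x => (φ x : ℂ)) k * coef ψ (-k)) * e3
        - ((L : ℂ) ^ 2 * fc (fun x => (φ x : ℂ)) k) * e2)
    exact_mod_cast h3

/-- The coefficients of the stream function. -/
noncomputable def streamCoef (f ω : L2 L) (k : ℤ × ℤ) : ℂ :=
  -(coef ω k - coef f k) / helm L k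

lemma isVelocity_coef {f ω : L2 L} {u : Fin 2 → L2 L} (h : IsVelocity f ω u) (k : ℤ × ℤ) :
    coef (u 0) k = -(Complex.I * freq L * k.2 * streamCoef f ω k) ∧
      coef (u 1) k = Complex.I * freq L * k.1 * streamCoef f ω k := by
  obtain ⟨ψ, h1, h2, h3⟩ := h
  have e1 := (isStream_iff f ω ψ).1 h1 k
  have e2 := (hasWeakDeriv_iff _ _ _).1 h2 k
  have e3 := (hasWeakDeriv_iff _ _ _).1 h3 k
  have hh : (helm L k : ℂ) ≠ 0 := by exact_mod_cast (helm_pos k).ne'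
  have e4 : coef ψ k = streamCoef f ω k := by
    rw [streamCoef, eq_div_iff hh, mul_comm, e1]
  rw [coef_neg] at e2
  rw [e4] at e2 e3
  simp only [dsym, pow_zero, pow_one, one_mul, mul_one] at e2 e3
  exact ⟨by linear_combination -e2, e3⟩

lemma summable_of_le_coef {a : ℤ × ℤ → ℂ} {C : ℝ} {u : L2 L} (h : ∀ k, ‖a k‖ ≤ C * ‖coef u k‖) :
    Summable fun k => ‖a k‖ ^ 2 := by
  have hs : Summable fun k => ‖coef u k‖ ^ 2 :=
    (summable_mul_left_iff (pow_ne_zero 2 hL.out.ne')).1 (hasSum_norm_coef_sq u).summable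
  refine Summable.of_nonneg_of_le (fun _ => sq_nonneg _) (fun k => ?_) (hs.mul_left (C ^ 2))
  rw [← mul_pow]
  exact pow_le_pow_left₀ (norm_nonneg _) (h k) 2

/-- Every vorticity has a velocity field. -/
lemma exists_isVelocity (f ω : L2 L) : ∃ u : Fin 2 → L2 L, IsVelocity f ω u := by
  have hξ := freq_pos (L := L)
  have hs : Herm (streamCoef f ω) := fun k => by
    simp only [streamCoef, coef_herm ω k, coef_herm f k, helm_neg, map_div₀, map_neg, map_sub,
      Complex.conj_ofReal]
  have hn : ∀ k, ‖streamCoef f ω k‖ * helm L k = ‖coef (ω - f) k‖ := fun k => by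
    have := helm_pos (L := L) k
    rw [streamCoef, norm_div, norm_neg, ← coef_sub, Complex.norm_real,
      Real.norm_of_nonneg this.le, div_mul_cancel₀ _ this.ne']
  have hb : ∀ (c : ℝ) (j k : ℤ × ℤ), |c| ≤ helm L k → ‖(c : ℂ) * streamCoef f ω k‖ ≤
      1 * ‖coef (ω - f) k‖ := fun c j k hc => by
    rw [norm_mul, Complex.norm_real, Real.norm_eq_abs, ← hn k, one_mul, mul_comm]
    exact mul_le_mul_of_nonneg_left hc (norm_nonneg _)
  obtain ⟨ψ, hψ⟩ := exists_coef_eq (L := L) (summable_of_le_coef (C := 1) (u := ω - f) fun k => by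
    simpa using hb 1 0 k (by simpa using one_le_helm k)) hs
  obtain ⟨u₀, hu₀⟩ := exists_coef_eq (L := L)
    (a := fun k => -(Complex.I * freq L * k.2 * streamCoef f ω k))
    (summable_of_le_coef (C := 1) (u := ω - f) fun k => by
      have := hb (freq L * k.2) 0 k (by rw [abs_mul, abs_of_pos hξ]; exact (helm_bounds k).2)
      simp only [norm_neg, norm_mul, Complex.norm_I, one_mul] at this ⊢
      simpa using this) (fun k => by simp [hs k])
  obtain ⟨u₁, hu₁⟩ := exists_coef_eq (L := L)
    (a := fun k => Complex.I * freq L * k.1 * streamCoef f ω k)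
    (summable_of_le_coef (C := 1) (u := ω - f) fun k => by
      have := hb (freq L * k.1) 0 k (by rw [abs_mul, abs_of_pos hξ]; exact (helm_bounds k).1)
      simp only [norm_mul, Complex.norm_I, one_mul] at this ⊢
      simpa using this) (fun k => by simp [hs k])
  refine ⟨![u₀, u₁], ψ, (isStream_iff f ω ψ).2 fun k => ?_, (hasWeakDeriv_iff _ _ _).2 fun k => ?_,
    (hasWeakDeriv_iff _ _ _).2 fun k => ?_⟩
  · have hh : (helm L k : ℂ) ≠ 0 := by exact_mod_cast (helm_pos k).ne'
    rw [hψ, streamCoef]; field_simp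
  · simp only [Matrix.cons_val_zero, coef_neg, hu₀, hψ, dsym, pow_zero, pow_one]; ring
  · simp only [Matrix.cons_val_one, Matrix.cons_val_fin_one, hu₁, hψ, dsym, pow_zero, pow_one]; ring

/-! ### Sobolev norms in terms of Fourier coefficients -/

lemma HasWeakDeriv.unique {β : ℕ × ℕ} {u v v' : L2 L} (h : HasWeakDeriv β u v)
    (h' : HasWeakDeriv β u v') : v = v' :=
  coef_injective (funext fun k => by
    rw [(hasWeakDeriv_iff _ _ _).1 h, (hasWeakDeriv_iff _ _ _).1 h'])

lemma HasWeakDeriv.weakDeriv_eq {β : ℕ × ℕ} {u v : L2 L} (h : HasWeakDeriv β u v) :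
    weakDeriv β u = v := by
  have hex : ∃ v, HasWeakDeriv β u v := ⟨v, h⟩
  rw [weakDeriv, dif_pos hex]
  exact hex.choose_spec.unique h

lemma sobBd_zero_coef (u : L2 L) : SobBd 0 (coef u) (‖u‖ / L) := by
  have hLp := hL.out
  refine ⟨by positivity, fun S => ?_⟩
  rw [div_pow, le_div_iff₀ (by positivity), Finset.sum_mul]
  refine le_trans (le_of_eq (Finset.sum_congr rfl fun k _ => ?_))
    (sum_le_hasSum S (fun k _ => by positivity) (hasSum_norm_coef_sq u))
  ring

lemma norm_le_of_sobBd {u : L2 L} {R : ℝ} (h : SobBd 0 (coef u) R) : ‖u‖ ≤ L * R := by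
  have hLp := hL.out
  refine le_of_sq_le_sq ?_ (mul_nonneg hLp.le h.1)
  refine hasSum_le_of_sum_le (hasSum_norm_coef_sq u) fun S => ?_
  rw [← Finset.mul_sum, mul_pow]
  refine mul_le_mul_of_nonneg_left ?_ (by positivity)
  simpa using h.2 S

lemma norm_dsym_le {β : ℕ × ℕ} {s : ℕ} (hβ : β.1 + β.2 ≤ s) (k : ℤ × ℤ) :
    ‖dsym L β k‖ ≤ (1 + freq L) ^ s * wt k ^ s := by
  have hξ := freq_pos (L := L)
  have hw := one_le_wt k
  have h1 : ∀ j : ℤ, |(j : ℝ)| ≤ wt k → ‖Complex.I * freq L * j‖ ≤ (1 + freq L) * wt k := by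
    intro j hj
    rw [norm_mul, norm_mul, Complex.norm_I, one_mul, Complex.norm_real,
      Real.norm_of_nonneg hξ.le, Complex.norm_intCast]
    gcongr
    linarith
  rw [dsym, norm_mul, norm_pow, norm_pow, ← mul_pow]
  calc _ ≤ ((1 + freq L) * wt k) ^ β.1 * ((1 + freq L) * wt k) ^ β.2 := by
        gcongr
        · exact h1 _ (abs_fst_le_wt k)
        · exact h1 _ (abs_snd_le_wt k)
    _ = ((1 + freq L) * wt k) ^ (β.1 + β.2) := (pow_add _ _ _).symm
    _ ≤ _ := pow_le_pow_right₀ (by nlinarith) hβ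

lemma SobBd.exists_hasWeakDeriv {s : ℕ} {u : L2 L} {R : ℝ} (h : SobBd s (coef u) R) {β : ℕ × ℕ}
    (hβ : β.1 + β.2 ≤ s) : ∃ v, HasWeakDeriv β u v ∧ ‖v‖ ≤ L * ((1 + freq L) ^ s * R) := by
  have hξ := freq_pos (L := L)
  have hb : SobBd 0 (fun k => dsym L β k * coef u k) ((1 + freq L) ^ s * R) := by
    refine ⟨mul_nonneg (by positivity) h.1, fun S => ?_⟩
    rw [mul_pow]
    refine le_trans ?_ (mul_le_mul_of_nonneg_left (h.2 S) (by positivity))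
    rw [Finset.mul_sum]
    refine Finset.sum_le_sum fun k _ => ?_
    have := norm_dsym_le (L := L) hβ k
    have hw := wt_pos k
    rw [pow_zero, one_mul, norm_mul, ← mul_pow, ← mul_assoc]
    gcongr
  have hs : Summable fun k => ‖dsym L β k * coef u k‖ ^ 2 := by
    simpa only [pow_zero, one_mul] using hb.summable
  have hh : Herm fun k => dsym L β k * coef u k := fun k => by
    change dsym L β (-k) * coef u (-k) = conj (dsym L β k * coef u k)
    rw [dsym_herm, coef_herm, map_mul]
  obtain ⟨v, hv⟩ := exists_coef_eq (L := L) hs hh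
  exact ⟨v, (hasWeakDeriv_iff _ _ _).2 fun k => by rw [hv],
    norm_le_of_sobBd (by rwa [hv])⟩

/-- The constant in the bound of the Sobolev norm by the weighted `ℓ²` norm. -/
noncomputable def sobConst (L : ℝ) (s : ℕ) : ℝ :=
  ∑ n ∈ Finset.range (s + 1), ∑ _β ∈ Finset.HasAntidiagonal.antidiagonal n, L * (1 + freq L) ^ s

lemma SobBd.memSobolev {s : ℕ} {u : L2 L} {R : ℝ} (h : SobBd s (coef u) R) : MemSobolev s u :=
  fun _ hβ => let ⟨v, hv, _⟩ := h.exists_hasWeakDeriv hβ; ⟨v, hv⟩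

lemma SobBd.sobolevNorm_le {s : ℕ} {u : L2 L} {R : ℝ} (h : SobBd s (coef u) R) :
    sobolevNorm s u ≤ sobConst L s * R := by
  rw [sobolevNorm, sobConst, Finset.sum_mul]
  refine Finset.sum_le_sum fun n hn => ?_
  rw [Finset.sum_mul]
  refine Finset.sum_le_sum fun β hβ => ?_
  have hβ' : β.1 + β.2 ≤ s := by
    rw [Finset.HasAntidiagonal.mem_antidiagonal.1 hβ]
    exact Nat.lt_succ_iff.1 (Finset.mem_range.1 hn)
  obtain ⟨v, hv, hn⟩ := h.exists_hasWeakDeriv hβ'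
  rw [hv.weakDeriv_eq]
  exact hn.trans_eq (by ring)

lemma sobolevNorm_nonneg (s : ℕ) (u : L2 L) : 0 ≤ sobolevNorm s u :=
  Finset.sum_nonneg fun _ _ => Finset.sum_nonneg fun _ _ => norm_nonneg _

lemma norm_weakDeriv_le {s : ℕ} (u : L2 L) {β : ℕ × ℕ} (hβ : β.1 + β.2 ≤ s) :
    ‖weakDeriv β u‖ ≤ sobolevNorm s u := by
  refine le_trans ?_ (Finset.single_le_sum (f := fun n =>
    ∑ β ∈ Finset.HasAntidiagonal.antidiagonal n, ‖weakDeriv β u‖)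
    (fun _ _ => Finset.sum_nonneg fun _ _ => norm_nonneg _)
    (Finset.mem_range.2 (Nat.lt_succ_iff.2 hβ)))
  exact Finset.single_le_sum (f := fun β => ‖weakDeriv β u‖) (fun _ _ => norm_nonneg _)
    (Finset.HasAntidiagonal.mem_antidiagonal.2 rfl)

/-- The constant in the bound of the weighted `ℓ²` norm by the Sobolev norm. -/
noncomputable def sobConst' (L : ℝ) (s : ℕ) : ℝ := 3 ^ s * (1 + (freq L ^ s)⁻¹) * (3 / L)

lemma sobConst'_nonneg (s : ℕ) : 0 ≤ sobConst' L s := by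
  have := freq_pos (L := L); have := hL.out; unfold sobConst'; positivity

/-- By `wt_pow_le` the function itself and its two pure derivatives of order s suffice. Their
symbols enter through absolute values, so that the three contributions add without cancellation. -/
lemma MemSobolev.sobBd {s : ℕ} {u : L2 L} (h : MemSobolev s u) :
    SobBd s (coef u) (sobConst' L s * sobolevNorm s u) := by
  have hξ := freq_pos (L := L)
  have hLp := hL.out
  have hbd : ∀ β : ℕ × ℕ, β.1 + β.2 ≤ s →
      SobBd 0 (fun k => ((‖dsym L β k‖ * ‖coef u k‖ : ℝ) : ℂ)) (sobolevNorm s u / L) := by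
    intro β hβ
    obtain ⟨v, hv⟩ := h β hβ
    have h1 := norm_weakDeriv_le u hβ
    rw [hv.weakDeriv_eq] at h1
    refine ((sobBd_zero_coef v).of_le fun k => ?_).mono (by gcongr)
    rw [(hasWeakDeriv_iff _ _ _).1 hv, norm_mul, Complex.norm_real, Real.norm_of_nonneg (by positivity)]
  have hsum := ((hbd (0, 0) (by simp)).add (hbd (s, 0) (by simp))).add (hbd (0, s) (by simp))
  refine ⟨mul_nonneg (sobConst'_nonneg s) (sobolevNorm_nonneg s u), fun S => ?_⟩
  set c : ℝ := 3 ^ s * (1 + (freq L ^ s)⁻¹) with hc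
  have hc0 : 0 ≤ c := by positivity
  have key : ∀ k, wt k ^ s * ‖coef u k‖ ≤ c * (wt k ^ 0 *
      ‖((‖dsym L (0, 0) k‖ * ‖coef u k‖ : ℝ) : ℂ) + ((‖dsym L (s, 0) k‖ * ‖coef u k‖ : ℝ) : ℂ) +
        ((‖dsym L (0, s) k‖ * ‖coef u k‖ : ℝ) : ℂ)‖) := by
    intro k
    have e0 : ‖dsym L (0, 0) k‖ = 1 := by simp [dsym]
    have e1 : ‖dsym L (s, 0) k‖ = freq L ^ s * |(k.1 : ℝ)| ^ s := by
      simp only [dsym, pow_zero, mul_one, norm_pow, norm_mul, Complex.norm_I,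
        Complex.norm_real, Real.norm_of_nonneg hξ.le, Complex.norm_intCast, mul_pow]
      rw [one_pow, one_mul]
    have e2 : ‖dsym L (0, s) k‖ = freq L ^ s * |(k.2 : ℝ)| ^ s := by
      simp only [dsym, pow_zero, norm_pow, norm_mul, Complex.norm_I,
        Complex.norm_real, Real.norm_of_nonneg hξ.le, Complex.norm_intCast, one_mul, mul_pow]
      rw [one_pow, one_mul]
    rw [e0, e1, e2, ← Complex.ofReal_add, ← Complex.ofReal_add, Complex.norm_real,
      Real.norm_of_nonneg (by positivity), pow_zero, one_mul, ← add_mul, ← add_mul, ← mul_assoc]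
    refine mul_le_mul_of_nonneg_right ((wt_pow_le s k).trans ?_) (norm_nonneg _)
    rw [hc, mul_assoc]
    refine mul_le_mul_of_nonneg_left ?_ (by positivity)
    have hp : 0 ≤ |(k.1 : ℝ)| ^ s := by positivity
    have hq : 0 ≤ |(k.2 : ℝ)| ^ s := by positivity
    have hf : 0 < freq L ^ s := by positivity
    have hi : (freq L ^ s)⁻¹ * freq L ^ s = 1 := inv_mul_cancel₀ hf.ne'
    have hi0 : 0 ≤ (freq L ^ s)⁻¹ := by positivity
    generalize |(k.1 : ℝ)| ^ s = p at *
    generalize |(k.2 : ℝ)| ^ s = q at *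
    generalize freq L ^ s = r at *
    have : (1 + r⁻¹) * (1 + r * p + r * q) = 1 + r⁻¹ + r * p + r * q + p + q := by
      linear_combination (p + q) * hi
    rw [this]
    have := mul_nonneg hf.le hp
    have := mul_nonneg hf.le hq
    linarith
  calc ∑ k ∈ S, (wt k ^ s * ‖coef u k‖) ^ 2 ≤ ∑ k ∈ S, (c * (wt k ^ 0 *
      ‖((‖dsym L (0, 0) k‖ * ‖coef u k‖ : ℝ) : ℂ) + ((‖dsym L (s, 0) k‖ * ‖coef u k‖ : ℝ) : ℂ) +
        ((‖dsym L (0, s) k‖ * ‖coef u k‖ : ℝ) : ℂ)‖)) ^ 2 :=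
        Finset.sum_le_sum fun k _ =>
          pow_le_pow_left₀ (mul_nonneg (pow_nonneg (wt_pos k).le _) (norm_nonneg _)) (key k) 2
    _ ≤ c ^ 2 * (sobolevNorm s u / L + sobolevNorm s u / L + sobolevNorm s u / L) ^ 2 := by
        simp_rw [mul_pow c]
        rw [← Finset.mul_sum]
        exact mul_le_mul_of_nonneg_left (hsum.2 S) (sq_nonneg _)
    _ = _ := by rw [sobConst', ← hc]; ring

end Weak


/-! ### The system in Fourier variables -/

section Bridge

lemma multiplier_bound {ξ : ℝ} (hξ : 0 < ξ) (p q : ℝ) :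
    ξ ^ 2 / (1 + ξ ^ 2 * (p ^ 2 + q ^ 2)) * (1 + p + q) ^ 2 ≤ 3 * (1 + ξ ^ 2) := by
  rw [div_mul_eq_mul_div, div_le_iff₀ (by positivity)]
  have h1 : (1 + p + q) ^ 2 ≤ 3 * (1 + p ^ 2 + q ^ 2) := by
    nlinarith [sq_nonneg (1 - p), sq_nonneg (1 - q), sq_nonneg (p - q)]
  calc ξ ^ 2 * (1 + p + q) ^ 2 ≤ ξ ^ 2 * (3 * (1 + p ^ 2 + q ^ 2)) := by gcongr
    _ ≤ _ := by nlinarith [mul_nonneg (sq_nonneg (ξ ^ 2)) (add_nonneg (sq_nonneg p) (sq_nonneg q))]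

variable {L : ℝ} [hL : Fact (0 < L)]

/-- The Fourier coefficients of the data of the system. -/
noncomputable def fdata {uh : Fin 2 → L2 L} {f : L2 L} (huh : MemSobolevDiv 3 uh)
    (hf : MemSobolev 2 f) : FData where
  ξ := freq L
  G k := freq L ^ 2 / helm L k
  CG := 3 * (1 + freq L ^ 2)
  f := coef f
  v₁ := coef (uh 0)
  v₂ := coef (uh 1)
  F := sobConst' L 2 * sobolevNorm 2 f
  V := sobConst' L 3 * sobolevNorm 3 (uh 0) + sobConst' L 3 * sobolevNorm 3 (uh 1)
  G_neg k := by rw [helm_neg]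
  G_le k := by
    have h := helm_pos (L := L) k
    rw [abs_of_nonneg (by positivity), helm, ← sq_abs (k.1 : ℝ), ← sq_abs (k.2 : ℝ)]
    exact multiplier_bound freq_pos _ _
  f_bd := hf.sobBd
  v₁_bd := (huh.1 0).sobBd.mono (le_add_of_nonneg_right (huh.1 1).sobBd.1)
  v₂_bd := (huh.1 1).sobBd.mono (le_add_of_nonneg_left (huh.1 0).sobBd.1)
  f_herm := coef_herm _
  v₁_herm := coef_herm _
  v₂_herm := coef_herm _

lemma coef_zero (k : ℤ × ℤ) : coef (0 : L2 L) k = 0 := by rw [← coefCLM_apply, map_zero]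

lemma hasWeakDiv_congr {g g' : Fin 2 → Torus L → ℝ} (h : ∀ i, g i =ᵐ[volume] g' i) (v : L2 L) :
    HasWeakDiv g v ↔ HasWeakDiv g' v := by
  refine forall₂_congr fun φ _ => ?_
  rw [integral_congr_ae]
  filter_upwards [h 0, h 1] with x h0 h1
  rw [Fin.sum_univ_two, Fin.sum_univ_two, h0, h1]

lemma hasSum_fc_mul (b u : L2 L) (k : ℤ × ℤ) :
    HasSum (fun m => coef u (k - m) * coef b m) (fc (fun x => ((b x * u x : ℝ) : ℂ)) k) := by
  have h := hasSum_coef_mul u b k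
  simp_rw [mul_comm (b _) (u _)]
  exact h

section

variable {uh : Fin 2 → L2 L} {f : L2 L} (huh : MemSobolevDiv 3 uh) (hf : MemSobolev 2 f)

/-- The product becomes a convolution and the velocity is expressed through the stream function. In
k · ∇^⊥ the term k × k drops out, which leaves the cross product of k and m in the kernel. -/
lemma hasWeakDiv_velocity_iff {ω : L2 L} {u : Fin 2 → L2 L} (hu : IsVelocity f ω u) (b v : L2 L) :
    HasWeakDiv (fun i x => b x * u i x) v ↔
      coef v = (fdata huh hf).trans (fun k => coef ω k - coef f k) (coef b) := by
  rw [hasWeakDiv_iff (fun i => integrable_mul b (u i)), funext_iff]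
  refine forall_congr' fun k => ?_
  have h0 := (hasSum_fc_mul b (u 0) k).mul_left (Complex.I * freq L * k.1)
  have h1 := (hasSum_fc_mul b (u 1) k).mul_left (Complex.I * freq L * k.2)
  rw [FData.trans, kconv, ← (h0.add h1).tsum_eq]
  refine Eq.congr_right (tsum_congr fun m => ?_)
  obtain ⟨e0, e1⟩ := isVelocity_coef hu (k - m)
  have hh : (helm L (k - m) : ℂ) ≠ 0 := by exact_mod_cast (helm_pos (k - m)).ne'
  rw [e0, e1, FData.tker, streamCoef]
  simp only [fdata, Prod.fst_sub, Prod.snd_sub]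
  push_cast
  field_simp
  linear_combination (-((k.1 : ℂ) * m.2 - k.2 * m.1)) * (freq L : ℂ) ^ 2 *
    (coef ω (k - m) - coef f (k - m)) * coef b m * Complex.I_sq

lemma hasWeakDiv_sub_velocity_iff {ω : L2 L} {u : Fin 2 → L2 L} (hu : IsVelocity f ω u)
    (b v : L2 L) :
    HasWeakDiv (fun i x => (ω x - b x) * u i x) v ↔
      coef v = (fdata huh hf).trans (fun k => coef ω k - coef f k)
        (fun k => coef ω k - coef b k) := by
  have hc : (fun k => coef ω k - coef b k) = coef (ω - b) := funext fun k => (coef_sub ω b k).symm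
  rw [hc, ← hasWeakDiv_velocity_iff huh hf hu]
  refine hasWeakDiv_congr (fun i => ?_) v
  filter_upwards [Lp.coeFn_sub ω b] with x hx
  rw [hx, Pi.sub_apply]

/-- Since `uh` is divergence-free, (k - m) · ûh(k - m) = 0. The derivative of the product thus falls
on b alone and the frequency k may be replaced by m. -/
lemma hasWeakDiv_forcing_iff {b : L2 L} {B : ℝ} (hb : SobBd 1 (coef b) B) (v : L2 L) :
    HasWeakDiv (fun i x => b x * uh i x) v ↔ coef v = (fdata huh hf).forcing (coef b) := by
  rw [hasWeakDiv_iff (fun i => integrable_mul b (uh i)), funext_iff]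
  refine forall_congr' fun k => ?_
  have h0 := (hasSum_fc_mul b (uh 0) k).mul_left (Complex.I * freq L * k.1)
  have h1 := (hasSum_fc_mul b (uh 1) k).mul_left (Complex.I * freq L * k.2)
  obtain ⟨s0, s1⟩ := (fdata huh hf).forcing_summable hb k
  rw [FData.forcing, kconv, kconv, ← s0.tsum_add s1, ← (h0.add h1).tsum_eq]
  refine Eq.congr_right (tsum_congr fun m => ?_)
  have hd := (hasWeakDiv_iff (fun i => integrable_L2 (uh i)) 0).1 huh.2 (k - m)
  rw [coef_zero] at hd
  have hd' : 0 = Complex.I * freq L * ((k - m).1 : ℤ) * coef (uh 0) (k - m) +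
    Complex.I * freq L * ((k - m).2 : ℤ) * coef (uh 1) (k - m) := hd
  simp only [fdata, Prod.fst_sub, Prod.snd_sub] at hd' ⊢
  push_cast at hd'
  linear_combination -(coef b m) * hd'

end

/-! ### Strong solutions and their Fourier coefficients -/

lemma ContinuousInSobolev.sobBd_sub {s : ℕ} {T : ℝ} {b : ℝ → L2 L}
    (h : ContinuousInSobolev s T b) {r t : ℝ} (hr : r ∈ Icc 0 T) (ht : t ∈ Icc 0 T) :
    SobBd s (fun k => coef (b r) k - coef (b t) k)
      (sobConst' L s * sobolevNorm s (b r - b t)) := by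
  have e : (fun k => coef (b r) k - coef (b t) k) = coef (b r - b t) :=
    funext fun k => (coef_sub _ _ k).symm
  -- This crude bound only shows that the difference lies in the Sobolev space; the bound claimed
  -- then comes from its own norm.
  have h1 := (h.1 r hr).sobBd.sub (h.1 t ht).sobBd
  rw [e] at h1 ⊢
  exact h1.memSobolev.sobBd

/-- Continuity bounds the norm near each time, and compactness of the interval makes the bound
uniform. -/
lemma ContinuousInSobolev.exists_sobBd {s : ℕ} {T : ℝ} {b : ℝ → L2 L}
    (h : ContinuousInSobolev s T b) : ∃ C, ∀ t ∈ Icc 0 T, SobBd s (coef (b t)) C := by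
  suffices H : ∃ C, ∀ t ∈ Icc 0 T, t ∈ Icc 0 T → SobBd s (coef (b t)) C from
    H.imp fun C hC t ht => hC t ht ht
  refine isCompact_Icc.induction_on
    (p := fun S => ∃ C, ∀ t ∈ S, t ∈ Icc 0 T → SobBd s (coef (b t)) C) ⟨0, by simp⟩ ?_ ?_ ?_
  · rintro S S' hS ⟨C, hC⟩
    exact ⟨C, fun t ht => hC t (hS ht)⟩
  · rintro S S' ⟨C, hC⟩ ⟨C', hC'⟩
    refine ⟨max C C', fun t ht ht' => ht.elim (fun ht => ?_) fun ht => ?_⟩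
    · exact (hC t ht ht').mono (le_max_left _ _)
    · exact (hC' t ht ht').mono (le_max_right _ _)
  · intro t ht
    have h1 := (h.2 t ht).eventually (eventually_le_nhds (b := (1 : ℝ)) zero_lt_one)
    refine ⟨_, h1, sobConst' L s * 1 + sobConst' L s * sobolevNorm s (b t), fun r hr hr' => ?_⟩
    have h2 := ((h.sobBd_sub hr' ht).mono
      (mul_le_mul_of_nonneg_left hr (sobConst'_nonneg s))).add (h.1 t ht).sobBd
    simpa using h2

lemma ContinuousInSobolev.continuousOn_coef {s : ℕ} {T : ℝ} {b : ℝ → L2 L}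
    (h : ContinuousInSobolev s T b) (k : ℤ × ℤ) :
    ContinuousOn (fun t => coef (b t) k) (Icc 0 T) := by
  intro t ht
  refine tendsto_iff_norm_sub_tendsto_zero.2 ?_
  have h1 := (h.2 t ht).const_mul (sobConst' L s)
  rw [mul_zero] at h1
  refine squeeze_zero' (Eventually.of_forall fun _ => norm_nonneg _) ?_ h1
  filter_upwards [self_mem_nhdsWithin] with r hr
  exact (h.sobBd_sub hr ht).norm_le k

lemma coef_intervalIntegral {g : ℝ → L2 L} {a c : ℝ} (hg : IntervalIntegrable g volume a c)
    (k : ℤ × ℤ) : coef (∫ τ in a..c, g τ) k = ∫ τ in a..c, coef (g τ) k := by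
  rw [← coefCLM_apply, ← ContinuousLinearMap.intervalIntegral_comp_comm _ hg]
  simp_rw [coefCLM_apply]

variable {uh : Fin 2 → L2 L} {f : L2 L}
variable {b₀ ω₀ : L2 L} {b ω : ℝ → L2 L} {T : ℝ}

/-- Each Fourier coefficient is a continuous linear functional and commutes with the Bochner
integral. The integrands are identified through the divergence lemmas, so the particular choice of
u, Db, Dω, Dh is immaterial. -/
lemma IsLocalSolution.isSol (huh : MemSobolevDiv 3 uh) (hf : MemSobolev 2 f)
    (h : IsLocalSolution uh f b₀ ω₀ b ω T) :
    0 < T ∧ b 0 = b₀ ∧ ω 0 = ω₀ ∧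
      ∃ R, IsSol (fdata huh hf) T R (fun t => coef (b t)) fun t => coef (ω t) := by
  obtain ⟨hT, hb, hω, u, Db, Dω, Dh, hu, ib, iω, ih, eb, eω⟩ := h
  have h0 : (0 : ℝ) ∈ Icc 0 T := ⟨le_rfl, hT.le⟩
  have hb0 : b 0 = b₀ := by simpa using eb 0 h0
  have hω0 : ω 0 = ω₀ := by simpa using eω 0 h0
  obtain ⟨C, hC⟩ := hb.exists_sobBd
  obtain ⟨C', hC'⟩ := hω.exists_sobBd
  have hbR : ∀ t ∈ Icc 0 T, SobBd 3 (coef (b t)) (max C C') := fun t ht =>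
    (hC t ht).mono (le_max_left _ _)
  have hωR : ∀ t ∈ Icc 0 T, SobBd 2 (coef (ω t)) (max C C') := fun t ht =>
    (hC' t ht).mono (le_max_right _ _)
  have hcont := (fdata huh hf).continuousOn_rhs hbR hωR hb.continuousOn_coef hω.continuousOn_coef
  have hsub : ∀ t ∈ Icc 0 T, ∀ {g : ℝ → L2 L}, IntervalIntegrable g volume 0 T →
      IntervalIntegrable g volume 0 t := fun t ht g hg =>
    hg.mono_set (uIcc_subset_uIcc left_mem_uIcc (by rwa [uIcc_of_le hT.le]))
  have hmem : ∀ t ∈ Icc 0 T, ∀ τ ∈ uIcc 0 t, τ ∈ Icc 0 T := fun t ht τ hτ => by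
    rw [uIcc_of_le ht.1] at hτ
    exact ⟨hτ.1, hτ.2.trans ht.2⟩
  refine ⟨hT, hb0, hω0, max C C', hbR, hωR, fun t _ => coef_herm _, fun t _ => coef_herm _,
    fun t ht k => ?_, fun t ht k => ?_⟩
  · rw [add_zero]
    refine (forall_hasDerivWithinAt_iff (x := fun t => coef (b t) k) (hcont k).1).2
      (fun t ht => ?_) t ht
    rw [eb t ht, coef_sub, coef_intervalIntegral (hsub t ht ib), hb0, sub_eq_add_neg,
      ← intervalIntegral.integral_neg]
    congr 1
    refine intervalIntegral.integral_congr fun τ hτ => ?_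
    have := (hasWeakDiv_velocity_iff huh hf (hu τ (hmem t ht τ hτ)).1 _ _).1
      (hu τ (hmem t ht τ hτ)).2.1
    change -coef (Db τ) k = _
    rw [this]; rfl
  · rw [add_zero]
    refine (forall_hasDerivWithinAt_iff (x := fun t => coef (ω t) k) (hcont k).2).2
      (fun t ht => ?_) t ht
    rw [eω t ht, coef_sub, coef_intervalIntegral ((hsub t ht iω).add (hsub t ht ih)), hω0,
      sub_eq_add_neg, ← intervalIntegral.integral_neg]
    congr 1
    refine intervalIntegral.integral_congr fun τ hτ => ?_
    have hτ' := hmem t ht τ hτ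
    have h1 := (hasWeakDiv_sub_velocity_iff huh hf (hu τ hτ').1 _ _).1 (hu τ hτ').2.2.1
    have h2 := (hasWeakDiv_forcing_iff huh hf ((hbR τ hτ').mono_order (by norm_num)) _).1
      (hu τ hτ').2.2.2
    change -coef (Dω τ + Dh τ) k = _
    rw [coef_add, h1, h2]; rfl

lemma IsSol.exists_modulus {D : FData} {R : ℝ} {b ω : ℝ → ℤ × ℤ → ℂ} (h : IsSol D T R b ω)
    {t : ℝ} (ht : t ∈ Icc 0 T) : ∃ r : ℝ → ℝ, Tendsto r (𝓝[Icc 0 T] t) (𝓝 0) ∧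
      ∀ s ∈ Icc 0 T, SobBd 3 (fun k => b s k - b t k) (r s) ∧
        SobBd 2 (fun k => ω s k - ω t k) (r s) := by
  obtain ⟨h1, h2⟩ := h.tendsto_sub ht
  refine ⟨fun s => √(∑' k, (wt k ^ 3 * ‖b s k - b t k‖) ^ 2) +
    √(∑' k, (wt k ^ 2 * ‖ω s k - ω t k‖) ^ 2), ?_, fun s hs => ⟨?_, ?_⟩⟩
  · simpa using h1.sqrt.add h2.sqrt
  · exact (SobBd.of_summable ((h.bdB s hs).sub (h.bdB t ht)).summable).mono
      (le_add_of_nonneg_right (Real.sqrt_nonneg _))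
  · exact (SobBd.of_summable ((h.bdW s hs).sub (h.bdW t ht)).summable).mono
      (le_add_of_nonneg_left (Real.sqrt_nonneg _))

lemma continuousInSobolev_of_modulus {s : ℕ} {R : ℝ}
    (hb : ∀ t ∈ Icc 0 T, SobBd s (coef (b t)) R)
    (h : ∀ t ∈ Icc 0 T, ∃ r : ℝ → ℝ, Tendsto r (𝓝[Icc 0 T] t) (𝓝 0) ∧
      ∀ r' ∈ Icc 0 T, SobBd s (fun k => coef (b r') k - coef (b t) k) (r r')) :
    ContinuousInSobolev s T b := by
  refine ⟨fun t ht => (hb t ht).memSobolev, fun t ht => ?_⟩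
  obtain ⟨r, hr, hbd⟩ := h t ht
  have h1 := hr.const_mul (sobConst L s)
  rw [mul_zero] at h1
  refine squeeze_zero' (Eventually.of_forall fun _ => sobolevNorm_nonneg _ _) ?_ h1
  filter_upwards [self_mem_nhdsWithin] with r' hr'
  have h2 := hbd r' hr'
  simp_rw [← coef_sub] at h2
  exact h2.sobolevNorm_le

lemma continuousOn_of_modulus {v : ℝ → L2 L} {I : Set ℝ}
    (h : ∀ t ∈ I, ∃ r : ℝ → ℝ, Tendsto r (𝓝[I] t) (𝓝 0) ∧
      ∀ s ∈ I, SobBd 0 (fun k => coef (v s) k - coef (v t) k) (r s)) : ContinuousOn v I := by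
  intro t ht
  obtain ⟨r, hr, hbd⟩ := h t ht
  have h1 := hr.const_mul L
  rw [mul_zero] at h1
  refine tendsto_iff_norm_sub_tendsto_zero.2
    (squeeze_zero' (Eventually.of_forall fun _ => norm_nonneg _) ?_ h1)
  filter_upwards [self_mem_nhdsWithin] with s hs
  have h2 := hbd s hs
  simp_rw [← coef_sub] at h2
  exact norm_le_of_sobBd h2

lemma FData.trans_sub_bound (D : FData) {ζ ζ' c c' : ℤ × ℤ → ℂ} {A A' B B' z y : ℝ}
    (hζ : SobBd 2 ζ A) (hζ' : SobBd 2 ζ' A') (hc : SobBd 2 c B) (hc' : SobBd 2 c' B')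
    (hz : SobBd 0 (fun k => ζ k - ζ' k) z) (hy : SobBd 1 (fun k => c k - c' k) y) :
    SobBd 0 (fun k => D.trans ζ c k - D.trans ζ' c' k)
      (D.CT * (z * B) + D.CT * (A' * y)) := by
  have h := (D.trans_bound_zero hz hc).add (D.trans_bound_zero' hζ' hy)
  convert h using 2 with k
  rw [D.trans_sub_left hζ hζ' hc, D.trans_sub_right hζ' hc hc']
  ring

lemma exists_coef_eq_of_sobBd {s : ℕ} {a : ℤ × ℤ → ℂ} {A : ℝ} (h : SobBd s a A) (ha : Herm a) :
    ∃ u : L2 L, coef u = a := by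
  refine exists_coef_eq ?_ ha
  have := (h.mono_order (Nat.zero_le s)).summable
  simpa only [pow_zero, one_mul] using this

/-- Beyond the coefficientwise equations, the divergences must be Bochner integrable in L². They are
even continuous there, by strong continuity of the solution and the difference bounds for transport
and forcing. Their values outside [0, T] play no role. -/
lemma IsSol.isLocalSolution (huh : MemSobolevDiv 3 uh) (hf : MemSobolev 2 f)
    {R : ℝ} (hT : 0 < T)
    (h : IsSol (fdata huh hf) T R (fun t => coef (b t)) fun t => coef (ω t)) :
    IsLocalSolution uh f (b 0) (ω 0) b ω T := by
  set D := fdata huh hf with hD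
  have hbc : ∀ k, ContinuousOn (fun t => coef (b t) k) (Icc 0 T) := fun k t ht =>
    (h.derivB t ht k).continuousWithinAt
  have hωc : ∀ k, ContinuousOn (fun t => coef (ω t) k) (Icc 0 T) := fun k t ht =>
    (h.derivW t ht k).continuousWithinAt
  have hcont := D.continuousOn_rhs h.bdB h.bdW hbc hωc
  have hζ : ∀ t ∈ Icc 0 T, SobBd 2 (fun k => coef (ω t) k - coef f k) (R + D.F) := fun t ht =>
    (h.bdW t ht).sub D.f_bd
  have hb2 : ∀ t ∈ Icc 0 T, SobBd 2 (coef (b t)) R := fun t ht => (h.bdB t ht).mono_order (by norm_num)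
  have hc : ∀ t ∈ Icc 0 T, SobBd 2 (fun k => coef (ω t) k - coef (b t) k) (R + R) := fun t ht =>
    (h.bdW t ht).sub (hb2 t ht)
  choose u hu using fun t => exists_isVelocity f (ω t)
  have hDb : ∀ t, ∃ v : L2 L, t ∈ Icc 0 T →
      coef v = D.trans (fun k => coef (ω t) k - coef f k) (coef (b t)) := fun t => by
    by_cases ht : t ∈ Icc 0 T
    · obtain ⟨v, hv⟩ := exists_coef_eq_of_sobBd (L := L) (D.trans_bound_two (hζ t ht) (h.bdB t ht))
        (D.trans_herm ((coef_herm _).sub (coef_herm _)) (coef_herm _))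
      exact ⟨v, fun _ => hv⟩
    · exact ⟨0, fun h => absurd h ht⟩
  have hDω : ∀ t, ∃ v : L2 L, t ∈ Icc 0 T →
      coef v = D.trans (fun k => coef (ω t) k - coef f k)
        (fun k => coef (ω t) k - coef (b t) k) := fun t => by
    by_cases ht : t ∈ Icc 0 T
    · obtain ⟨v, hv⟩ := exists_coef_eq_of_sobBd (L := L) (D.trans_bound_one' (hζ t ht) (hc t ht))
        (D.trans_herm ((coef_herm _).sub (coef_herm _)) ((coef_herm _).sub (coef_herm _)))
      exact ⟨v, fun _ => hv⟩
    · exact ⟨0, fun h => absurd h ht⟩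
  have hDh : ∀ t, ∃ v : L2 L, t ∈ Icc 0 T → coef v = D.forcing (coef (b t)) := fun t => by
    by_cases ht : t ∈ Icc 0 T
    · obtain ⟨v, hv⟩ := exists_coef_eq_of_sobBd (L := L) (D.forcing_bound_two (h.bdB t ht))
        (D.forcing_herm (coef_herm _))
      exact ⟨v, fun _ => hv⟩
    · exact ⟨0, fun h => absurd h ht⟩
  choose Db hDb using hDb
  choose Dω hDω using hDω
  choose Dh hDh using hDh
  have hsub : ∀ (a a' c : ℤ × ℤ → ℂ), (fun k => a k - c k - (a' k - c k)) = fun k => a k - a' k :=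
    fun a a' c => funext fun k => by ring
  have cDb : ContinuousOn Db (Icc 0 T) := continuousOn_of_modulus fun t ht => by
    obtain ⟨r, hr, hbd⟩ := h.exists_modulus ht
    refine ⟨fun s => D.CT * (r s * R) + D.CT * ((R + D.F) * r s), ?_, fun s hs => ?_⟩
    · simpa using ((hr.mul_const R).const_mul D.CT).add ((hr.const_mul (R + D.F)).const_mul D.CT)
    · rw [hDb s hs, hDb t ht]
      refine D.trans_sub_bound (hζ s hs) (hζ t ht) (hb2 s hs) (hb2 t ht) ?_
        ((hbd s hs).1.mono_order (by norm_num))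
      rw [hsub]
      exact (hbd s hs).2.mono_order (by norm_num)
  have cDω : ContinuousOn Dω (Icc 0 T) := continuousOn_of_modulus fun t ht => by
    obtain ⟨r, hr, hbd⟩ := h.exists_modulus ht
    refine ⟨fun s => D.CT * (r s * (R + R)) + D.CT * ((R + D.F) * (r s + r s)), ?_,
      fun s hs => ?_⟩
    · simpa using ((hr.mul_const (R + R)).const_mul D.CT).add
        (((hr.add hr).const_mul (R + D.F)).const_mul D.CT)
    · rw [hDω s hs, hDω t ht]
      refine D.trans_sub_bound (hζ s hs) (hζ t ht) (hc s hs) (hc t ht) ?_ ?_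
      · rw [hsub]
        exact (hbd s hs).2.mono_order (by norm_num)
      · have h1 := ((hbd s hs).2.mono_order (r := 1) (by norm_num)).sub
          ((hbd s hs).1.mono_order (r := 1) (by norm_num))
        convert h1 using 2 with k
        ring
  have cDh : ContinuousOn Dh (Icc 0 T) := continuousOn_of_modulus fun t ht => by
    obtain ⟨r, hr, hbd⟩ := h.exists_modulus ht
    refine ⟨fun s => D.CU * r s, by simpa using hr.const_mul D.CU, fun s hs => ?_⟩
    rw [hDh s hs, hDh t ht]
    have h1 := D.forcing_bound_zero ((hbd s hs).1.mono_order (r := 1) (by norm_num))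
    convert h1 using 2 with k
    exact (D.forcing_sub ((hb2 s hs).mono_order (by norm_num))
      ((hb2 t ht).mono_order (by norm_num)) k).symm
  have hmem : ∀ t ∈ Icc 0 T, ∀ τ ∈ uIcc 0 t, τ ∈ Icc 0 T := fun t ht τ hτ => by
    rw [uIcc_of_le ht.1] at hτ
    exact ⟨hτ.1, hτ.2.trans ht.2⟩
  have hInt : ∀ t ∈ Icc 0 T, ∀ {g : ℝ → L2 L}, ContinuousOn g (Icc 0 T) →
      IntervalIntegrable g volume 0 t := fun t ht g hg =>
    (hg.mono fun τ hτ => hmem t ht τ hτ).intervalIntegrable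
  have hTm : T ∈ Icc 0 T := ⟨hT.le, le_rfl⟩
  refine ⟨hT, continuousInSobolev_of_modulus h.bdB fun t ht => ?_,
    continuousInSobolev_of_modulus h.bdW fun t ht => ?_, u, Db, Dω, Dh, fun t ht => ⟨hu t, ?_, ?_, ?_⟩,
    hInt T hTm cDb, hInt T hTm cDω, hInt T hTm cDh, fun t ht => coef_injective (funext fun k => ?_),
    fun t ht => coef_injective (funext fun k => ?_)⟩
  · obtain ⟨r, hr, hbd⟩ := h.exists_modulus ht
    exact ⟨r, hr, fun s hs => (hbd s hs).1⟩
  · obtain ⟨r, hr, hbd⟩ := h.exists_modulus ht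
    exact ⟨r, hr, fun s hs => (hbd s hs).2⟩
  · exact (hasWeakDiv_velocity_iff huh hf (hu t) _ _).2 (hDb t ht)
  · exact (hasWeakDiv_sub_velocity_iff huh hf (hu t) _ _).2 (hDω t ht)
  · exact (hasWeakDiv_forcing_iff huh hf ((hb2 t ht).mono_order (by norm_num)) _).2 (hDh t ht)
  · have e := (forall_hasDerivWithinAt_iff (x := fun t => coef (b t) k) (hcont k).1).1
      (fun t ht => by simpa only [add_zero] using h.derivB t ht k) t ht
    rw [coef_sub, coef_intervalIntegral (hInt t ht cDb), sub_eq_add_neg,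
      ← intervalIntegral.integral_neg]
    refine e.trans (congrArg _ (intervalIntegral.integral_congr fun τ hτ => ?_))
    change _ = -coef (Db τ) k
    rw [hDb τ (hmem t ht τ hτ)]; rfl
  · have e := (forall_hasDerivWithinAt_iff (x := fun t => coef (ω t) k) (hcont k).2).1
      (fun t ht => by simpa only [add_zero] using h.derivW t ht k) t ht
    rw [coef_sub, coef_intervalIntegral ((hInt t ht cDω).add (hInt t ht cDh)), sub_eq_add_neg,
      ← intervalIntegral.integral_neg]
    refine e.trans (congrArg _ (intervalIntegral.integral_congr fun τ hτ => ?_))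
    change _ = -coef (Dω τ + Dh τ) k
    rw [coef_add, hDω τ (hmem t ht τ hτ), hDh τ (hmem t ht τ hτ)]; rfl

end Bridge


/-! ### Continuation of solutions -/

section Continuation

lemma IsSol.congr {D : FData} {T R : ℝ} {b ω b' ω' : ℝ → ℤ × ℤ → ℂ} (h : IsSol D T R b ω)
    (hb : ∀ t ∈ Icc 0 T, b' t = b t) (hω : ∀ t ∈ Icc 0 T, ω' t = ω t) : IsSol D T R b' ω' where
  bdB t ht := by rw [hb t ht]; exact h.bdB t ht
  bdW t ht := by rw [hω t ht]; exact h.bdW t ht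
  hermB t ht := by rw [hb t ht]; exact h.hermB t ht
  hermW t ht := by rw [hω t ht]; exact h.hermW t ht
  derivB t ht k := by
    rw [hb t ht, hω t ht]
    exact (h.derivB t ht k).congr (fun s hs => congrFun (hb s hs) k) (congrFun (hb t ht) k)
  derivW t ht k := by
    rw [hb t ht, hω t ht]
    exact (h.derivW t ht k).congr (fun s hs => congrFun (hω s hs) k) (congrFun (hω t ht) k)

/-- A function that follows `x` up to time `T` and `y` afterwards. -/
noncomputable def splice {E : Type*} (T : ℝ) (x y : ℝ → E) (t : ℝ) : E :=
  if t ≤ T then x t else y (t - T)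

lemma splice_of_le {E : Type*} {T t : ℝ} {x y : ℝ → E} (h : t ≤ T) : splice T x y t = x t :=
  if_pos h

lemma splice_of_ge {E : Type*} {T t : ℝ} {x y : ℝ → E} (hxy : y 0 = x T) (h : T ≤ t) :
    splice T x y t = y (t - T) := by
  rcases h.eq_or_lt with rfl | h
  · rw [splice_of_le le_rfl, sub_self, hxy]
  · exact if_neg h.not_ge

/-- At the junction the one-sided derivatives agree because h 0 = g T, as happens for an autonomous
equation restarted from its final state. -/
lemma hasDerivWithinAt_splice {T τ : ℝ} {x y g h : ℝ → ℂ} (hT : 0 ≤ T)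
    (hxy : y 0 = x T) (hgh : h 0 = g T)
    (hx : ∀ t ∈ Icc 0 T, HasDerivWithinAt x (g t) (Icc 0 T) t)
    (hy : ∀ t ∈ Icc 0 τ, HasDerivWithinAt y (h t) (Icc 0 τ) t) {t : ℝ} (ht : t ∈ Icc 0 (T + τ)) :
    HasDerivWithinAt (splice T x y) (splice T g h t) (Icc 0 (T + τ)) t := by
  have hl : ∀ t ∈ Icc 0 T, HasDerivWithinAt (splice T x y) (splice T g h t) (Icc 0 T) t := by
    intro t ht
    rw [splice_of_le ht.2]
    exact (hx t ht).congr (fun s hs => splice_of_le hs.2) (splice_of_le ht.2)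
  have hr : ∀ t ∈ Icc T (T + τ),
      HasDerivWithinAt (splice T x y) (splice T g h t) (Icc T (T + τ)) t := by
    intro t ht
    rw [splice_of_ge hgh ht.1]
    have h1 : HasDerivWithinAt (fun s => y (s - T)) (h (t - T)) (Icc T (T + τ)) t := by
      have hm : MapsTo (fun s => s - T) (Icc T (T + τ)) (Icc 0 τ) := fun s hs =>
        ⟨sub_nonneg.2 hs.1, sub_le_iff_le_add'.2 hs.2⟩
      have h2 := (hy (t - T) (hm ht)).scomp t
        ((hasDerivWithinAt_id t (Icc T (T + τ))).sub_const T) hm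
      rw [one_smul] at h2
      exact h2
    exact h1.congr (fun s hs => splice_of_ge hxy hs.1) (splice_of_ge hxy ht.1)
  rcases lt_trichotomy t T with h | rfl | h
  · refine (hl t ⟨ht.1, h.le⟩).mono_of_mem_nhdsWithin ?_
    filter_upwards [self_mem_nhdsWithin, mem_nhdsWithin_of_mem_nhds (Iio_mem_nhds h)] with s hs hs'
    exact ⟨hs.1, le_of_lt hs'⟩
  · refine ((hl t ⟨ht.1, le_rfl⟩).union (hr t ⟨le_rfl, ht.2⟩)).mono fun s hs => ?_
    exact (le_total s t).imp (fun h => ⟨hs.1, h⟩) fun h => ⟨h, hs.2⟩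
  · refine (hr t ⟨h.le, ht.2⟩).mono_of_mem_nhdsWithin ?_
    filter_upwards [self_mem_nhdsWithin, mem_nhdsWithin_of_mem_nhds (Ioi_mem_nhds h)] with s hs hs'
    exact ⟨le_of_lt hs', hs.2⟩

lemma splice_cases {E : Type*} {T τ : ℝ} {x y : ℝ → E} {P : E → Prop}
    (hx : ∀ t ∈ Icc 0 T, P (x t)) (hy : ∀ t ∈ Icc 0 τ, P (y t)) :
    ∀ t ∈ Icc 0 (T + τ), P (splice T x y t) := fun t ht => by
  by_cases h : t ≤ T
  · rw [splice_of_le h]; exact hx t ⟨ht.1, h⟩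
  · rw [splice, if_neg h]
    push Not at h
    exact hy _ ⟨by linarith, by linarith [ht.2]⟩

lemma IsSol.splice {D : FData} {T τ R : ℝ} {b ω b' ω' : ℝ → ℤ × ℤ → ℂ} (hT : 0 ≤ T)
    (h : IsSol D T R b ω) (h' : IsSol D τ R b' ω') (hb : b' 0 = b T) (hω : ω' 0 = ω T) :
    IsSol D (T + τ) R (splice T b b') (splice T ω ω') where
  bdB := splice_cases (P := fun a => SobBd 3 a R) h.bdB h'.bdB
  bdW := splice_cases (P := fun a => SobBd 2 a R) h.bdW h'.bdW
  hermB := splice_cases h.hermB h'.hermB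
  hermW := splice_cases h.hermW h'.hermW
  derivB t ht k := by
    have h1 := hasDerivWithinAt_splice (x := fun t => b t k) (y := fun t => b' t k)
      (g := fun t => D.rhsB (b t) (ω t) k + 0) (h := fun t => D.rhsB (b' t) (ω' t) k + 0) hT
      (congrFun hb k) (by simp only [hb, hω]) (fun t ht => h.derivB t ht k)
      (fun t ht => h'.derivB t ht k) ht
    convert h1 using 1
    · funext s; unfold TQG.splice; split_ifs <;> rfl
    · unfold TQG.splice; split_ifs <;> rfl
  derivW t ht k := by
    have h1 := hasDerivWithinAt_splice (x := fun t => ω t k) (y := fun t => ω' t k)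
      (g := fun t => D.rhsW (b t) (ω t) k + 0) (h := fun t => D.rhsW (b' t) (ω' t) k + 0) hT
      (congrFun hω k) (by simp only [hb, hω]) (fun t ht => h.derivW t ht k)
      (fun t ht => h'.derivW t ht k) ht
    convert h1 using 1
    · funext s; unfold TQG.splice; split_ifs <;> rfl
    · unfold TQG.splice; split_ifs <;> rfl

variable {L : ℝ} [hL : Fact (0 < L)]
variable {uh : Fin 2 → L2 L} {f : L2 L}
variable {b₀ ω₀ : L2 L} {b ω b' ω' : ℝ → L2 L} {T T' : ℝ}

lemma IsSol.exists_isLocalSolution (huh : MemSobolevDiv 3 uh) (hf : MemSobolev 2 f)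
    {R : ℝ} {B W : ℝ → ℤ × ℤ → ℂ} (hT : 0 < T)
    (h : IsSol (fdata huh hf) T R B W) (hb : B 0 = coef b₀) (hω : W 0 = coef ω₀) :
    ∃ b ω : ℝ → L2 L, IsLocalSolution uh f b₀ ω₀ b ω T := by
  have h1 : ∀ t, ∃ v : L2 L, t ∈ Icc 0 T → coef v = B t := fun t => by
    by_cases ht : t ∈ Icc 0 T
    · obtain ⟨v, hv⟩ := exists_coef_eq_of_sobBd (L := L) (h.bdB t ht) (h.hermB t ht)
      exact ⟨v, fun _ => hv⟩
    · exact ⟨0, fun h => absurd h ht⟩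
  have h2 : ∀ t, ∃ v : L2 L, t ∈ Icc 0 T → coef v = W t := fun t => by
    by_cases ht : t ∈ Icc 0 T
    · obtain ⟨v, hv⟩ := exists_coef_eq_of_sobBd (L := L) (h.bdW t ht) (h.hermW t ht)
      exact ⟨v, fun _ => hv⟩
    · exact ⟨0, fun h => absurd h ht⟩
  choose b hb' using h1
  choose ω hω' using h2
  have h0 : (0 : ℝ) ∈ Icc 0 T := ⟨le_rfl, hT.le⟩
  have eb : b 0 = b₀ := coef_injective ((hb' 0 h0).trans hb)
  have eω : ω 0 = ω₀ := coef_injective ((hω' 0 h0).trans hω)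
  refine ⟨b, ω, ?_⟩
  rw [← eb, ← eω]
  exact (h.congr hb' hω').isLocalSolution huh hf hT

lemma IsLocalSolution.congr (huh : MemSobolevDiv 3 uh) (hf : MemSobolev 2 f)
    (h : IsLocalSolution uh f b₀ ω₀ b ω T)
    (hb : ∀ t ∈ Icc 0 T, b' t = b t) (hω : ∀ t ∈ Icc 0 T, ω' t = ω t) :
    IsLocalSolution uh f b₀ ω₀ b' ω' T := by
  obtain ⟨hT, rfl, rfl, R, hR⟩ := h.isSol huh hf
  have h0 : (0 : ℝ) ∈ Icc 0 T := ⟨le_rfl, hT.le⟩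
  rw [← hb 0 h0, ← hω 0 h0]
  exact (hR.congr (fun t ht => congrArg coef (hb t ht))
    fun t ht => congrArg coef (hω t ht)).isLocalSolution huh hf hT

lemma IsLocalSolution.mono (huh : MemSobolevDiv 3 uh) (hf : MemSobolev 2 f)
    (h : IsLocalSolution uh f b₀ ω₀ b ω T) (hT' : 0 < T') (hle : T' ≤ T) :
    IsLocalSolution uh f b₀ ω₀ b ω T' := by
  obtain ⟨hT, rfl, rfl, R, hR⟩ := h.isSol huh hf
  exact (hR.mono_time hle).isLocalSolution huh hf hT'

lemma IsLocalSolution.unique (huh : MemSobolevDiv 3 uh) (hf : MemSobolev 2 f)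
    (h : IsLocalSolution uh f b₀ ω₀ b ω T)
    (h' : IsLocalSolution uh f b₀ ω₀ b' ω' T') {t : ℝ} (ht : 0 ≤ t) (htT : t ≤ T) (htT' : t ≤ T') :
    b t = b' t ∧ ω t = ω' t := by
  obtain ⟨hT, hb, hω, R, hR⟩ := h.isSol huh hf
  obtain ⟨hT', hb', hω', R', hR'⟩ := h'.isSol huh hf
  have := IsSol.unique (lt_min hT hT') (hR.mono_time (min_le_left T T'))
    (hR'.mono_time (min_le_right T T')) (by rw [hb, hb']) (by rw [hω, hω'])
    (t := t) ⟨ht, le_min htT htT'⟩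
  exact ⟨coef_injective this.1, coef_injective this.2⟩

lemma IsLocalSolution.exists_normM_le (huh : MemSobolevDiv 3 uh) (hf : MemSobolev 2 f)
    (h : IsLocalSolution uh f b₀ ω₀ b ω T) :
    ∃ M, ∀ t ∈ Icc 0 T, normM (b t) (ω t) ≤ M := by
  obtain ⟨-, -, -, R, hR⟩ := h.isSol huh hf
  exact ⟨_, fun t ht => add_le_add (hR.bdB t ht).sobolevNorm_le (hR.bdW t ht).sobolevNorm_le⟩

lemma exists_isLocalSolution (huh : MemSobolevDiv 3 uh) (hf : MemSobolev 2 f)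
    (hb₀ : MemSobolev 3 b₀) (hω₀ : MemSobolev 2 ω₀) :
    ∃ T, ∃ b ω : ℝ → L2 L, IsLocalSolution uh f b₀ ω₀ b ω T := by
  obtain ⟨B, W, hB, hW, h⟩ := exists_isSol (fdata huh hf)
    (hb₀.sobBd.mono (le_max_left _ _)) (hω₀.sobBd.mono (le_max_right _ _))
    (coef_herm b₀) (coef_herm ω₀)
  exact ⟨_, h.exists_isLocalSolution huh hf (FData.lifespan_pos _ _) hB hW⟩

/-- A solution can be continued for a time that depends only on its final norm. -/
lemma exists_extension (huh : MemSobolevDiv 3 uh) (hf : MemSobolev 2 f)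
    (b₀ ω₀ : L2 L) (M : ℝ) : ∃ τ > 0, ∀ (b ω : ℝ → L2 L) (T : ℝ),
    IsLocalSolution uh f b₀ ω₀ b ω T → normM (b T) (ω T) ≤ M →
      ∃ b' ω' : ℝ → L2 L, IsLocalSolution uh f b₀ ω₀ b' ω' (T + τ) := by
  set D := fdata huh hf with hD
  set R := (sobConst' L 3 + sobConst' L 2) * M with hR
  refine ⟨D.lifespan R, D.lifespan_pos R, fun b ω T h hM => ?_⟩
  have h3 := sobConst'_nonneg (L := L) 3
  have h2 := sobConst'_nonneg (L := L) 2
  have n3 := sobolevNorm_nonneg 3 (b T)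
  have n2 := sobolevNorm_nonneg 2 (ω T)
  unfold normM at hM
  have hM0 : 0 ≤ M := by linarith
  have hTm : T ∈ Icc 0 T := ⟨h.1.le, le_rfl⟩
  obtain ⟨B, W, hB, hW, hBW⟩ := exists_isSol D (R := R)
    ((h.2.1.1 T hTm).sobBd.mono (by
      rw [hR, add_mul]
      exact (mul_le_mul_of_nonneg_left (by linarith) h3).trans
        (le_add_of_nonneg_right (mul_nonneg h2 hM0))))
    ((h.2.2.1.1 T hTm).sobBd.mono (by
      rw [hR, add_mul]
      exact (mul_le_mul_of_nonneg_left (by linarith) h2).trans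
        (le_add_of_nonneg_left (mul_nonneg h3 hM0))))
    (coef_herm _) (coef_herm _)
  obtain ⟨hT, hb, hω, R', hR'⟩ := h.isSol huh hf
  have key := (hR'.mono_radius (le_max_left R' _)).splice hT.le
    (hBW.mono_radius (le_max_right R' _)) hB hW
  refine key.exists_isLocalSolution huh hf (add_pos hT (D.lifespan_pos R)) ?_ ?_
  · rw [splice_of_le hT.le, hb]
  · rw [splice_of_le hT.le, hω]

end Continuation

/-! ### Maximal solutions -/

section Maximal

variable {L : ℝ} [hL : Fact (0 < L)]
variable {uh : Fin 2 → L2 L} {f : L2 L}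
variable {b₀ ω₀ : L2 L} {b ω b' ω' : ℝ → L2 L} {Tmax Tmax' : EReal}

lemma exists_eventually_normM_le {T : ℕ → ℝ}
    (h : limsup (fun n => ((normM (b (T n)) (ω (T n)) ^ 2 : ℝ) : EReal)) atTop ≠ ⊤) :
    ∃ M, ∀ᶠ n in atTop, normM (b (T n)) (ω (T n)) ≤ M := by
  obtain ⟨C, hC, -⟩ := EReal.lt_iff_exists_real_btwn.1 (lt_top_iff_ne_top.2 h)
  refine ⟨C + 1, (eventually_lt_of_limsup_lt hC).mono fun n hn => ?_⟩
  have hn' : normM (b (T n)) (ω (T n)) ^ 2 < C := EReal.coe_lt_coe_iff.1 hn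
  nlinarith [sq_nonneg (normM (b (T n)) (ω (T n)) - 1)]

/-- If the second maximal time were smaller, it would lie below some time up to which the first
solution exists and is bounded. By uniqueness the second solution shares this bound, contradicting
its blow-up. -/
lemma IsMaximalSolution.le (huh : MemSobolevDiv 3 uh) (hf : MemSobolev 2 f)
    (h : IsMaximalSolution uh f b₀ ω₀ b ω Tmax)
    (h' : IsMaximalSolution uh f b₀ ω₀ b' ω' Tmax') : Tmax ≤ Tmax' := by
  by_contra! hlt
  obtain ⟨-, T, -, hT, hsol, -⟩ := h
  obtain ⟨-, T', hmono', hT', hsol', hblow⟩ := h'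
  obtain ⟨m, hm⟩ := (hT.eventually (lt_mem_nhds hlt)).exists
  obtain ⟨M, hM⟩ := (hsol m).exists_normM_le huh hf
  have hle : ∀ n, T' n ≤ T m := fun n => by
    have h1 : (T' n : EReal) ≤ Tmax' :=
      Monotone.ge_of_tendsto (fun i j hij => EReal.coe_le_coe_iff.2 (hmono'.monotone hij)) hT' n
    exact EReal.coe_le_coe_iff.1 (h1.trans hm.le)
  have hbd : ∀ n, normM (b' (T' n)) (ω' (T' n)) ≤ M := fun n => by
    obtain ⟨e1, e2⟩ := (hsol' n).unique huh hf (hsol m) (hsol' n).1.le le_rfl (hle n)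
    rw [e1, e2]
    exact hM _ ⟨(hsol' n).1.le, hle n⟩
  have h1 := hblow (hlt.trans_le le_top)
  have h2 : limsup (fun n => ((normM (b' (T' n)) (ω' (T' n)) ^ 2 : ℝ) : EReal)) atTop ≤
      ((M ^ 2 : ℝ) : EReal) := by
    refine limsup_le_of_le (by isBoundedDefault) (Eventually.of_forall fun n => ?_)
    exact EReal.coe_le_coe_iff.2 (pow_le_pow_left₀
      (add_nonneg (sobolevNorm_nonneg _ _) (sobolevNorm_nonneg _ _)) (hbd n) 2)
  rw [h1] at h2
  exact absurd h2 (not_le.2 (EReal.coe_lt_top _))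

lemma IsMaximalSolution.eq_of_lt (huh : MemSobolevDiv 3 uh) (hf : MemSobolev 2 f)
    (h : IsMaximalSolution uh f b₀ ω₀ b ω Tmax)
    (h' : IsMaximalSolution uh f b₀ ω₀ b' ω' Tmax) {t : ℝ} (ht : 0 ≤ t) (htT : (t : EReal) < Tmax) :
    b t = b' t ∧ ω t = ω' t := by
  obtain ⟨-, T, -, hT, hsol, -⟩ := h
  obtain ⟨-, T', -, hT', hsol', -⟩ := h'
  obtain ⟨n, hn⟩ := (hT.eventually (lt_mem_nhds htT)).exists
  obtain ⟨m, hm⟩ := (hT'.eventually (lt_mem_nhds htT)).exists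
  exact (hsol n).unique huh hf (hsol' m) ht (EReal.coe_lt_coe_iff.1 hn).le
    (EReal.coe_lt_coe_iff.1 hm).le

/-- The local solutions fit together to one that exists as long as any of them does. -/
lemma exists_glued (huh : MemSobolevDiv 3 uh) (hf : MemSobolev 2 f)
    (b₀ ω₀ : L2 L) : ∃ b ω : ℝ → L2 L, ∀ T : ℝ,
    (∃ b' ω' : ℝ → L2 L, IsLocalSolution uh f b₀ ω₀ b' ω' T) →
      IsLocalSolution uh f b₀ ω₀ b ω T := by
  have hex : ∀ T : ℝ, ∃ p : (ℝ → L2 L) × (ℝ → L2 L), p.1 0 = b₀ ∧ p.2 0 = ω₀ ∧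
      ((∃ b' ω' : ℝ → L2 L, IsLocalSolution uh f b₀ ω₀ b' ω' T) →
        IsLocalSolution uh f b₀ ω₀ p.1 p.2 T) := fun T => by
    by_cases h : ∃ b' ω' : ℝ → L2 L, IsLocalSolution uh f b₀ ω₀ b' ω' T
    · obtain ⟨b', ω', h'⟩ := h
      exact ⟨(b', ω'), (h'.isSol huh hf).2.1, (h'.isSol huh hf).2.2.1, fun _ => h'⟩
    -- The default keeps the correct initial values. They are needed at time 0, where the glued
    -- function reads `p 0` although no solution of lifespan 0 exists.
    · exact ⟨(fun _ => b₀, fun _ => ω₀), rfl, rfl, fun h' => absurd h' h⟩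
  choose p hp1 hp2 hp using hex
  -- At time t the solution chosen for the interval [0, t] is read off; uniqueness makes these
  -- choices compatible.
  refine ⟨fun t => (p t).1 t, fun t => (p t).2 t, fun T hT => ?_⟩
  have key : ∀ t ∈ Icc 0 T, (p t).1 t = (p T).1 t ∧ (p t).2 t = (p T).2 t := fun t ht => by
    rcases ht.1.eq_or_lt with rfl | h0
    · rw [hp1, hp1, hp2, hp2]; exact ⟨rfl, rfl⟩
    · exact (hp t ⟨_, _, (hp T hT).mono huh hf h0 ht.2⟩).unique huh hf (hp T hT) ht.1 le_rfl ht.2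
  exact (hp T hT).congr huh hf (fun t ht => (key t ht).1) fun t ht => (key t ht).2

/-- The maximal time is the supremum of all lifespans. Were it finite with bounded limsup,
`exists_extension` would provide one τ > 0 for all late states, and continuation from a time closer
than τ to the supremum would exceed it. -/
theorem exists_isMaximalSolution (huh : MemSobolevDiv 3 uh) (hf : MemSobolev 2 f)
    (hb₀ : MemSobolev 3 b₀) (hω₀ : MemSobolev 2 ω₀) :
    ∃ (b ω : ℝ → L2 L) (Tmax : EReal), IsMaximalSolution uh f b₀ ω₀ b ω Tmax := by
  obtain ⟨b, ω, hglue⟩ := exists_glued huh hf b₀ ω₀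
  set E : Set EReal :=
    {x | ∃ T : ℝ, x = T ∧ ∃ b' ω' : ℝ → L2 L, IsLocalSolution uh f b₀ ω₀ b' ω' T} with hE
  obtain ⟨T₀, b₁, ω₁, h₁⟩ := exists_isLocalSolution huh hf hb₀ hω₀
  have hpos : 0 < sSup E :=
    lt_of_lt_of_le (EReal.coe_pos.2 h₁.1) (le_sSup ⟨T₀, rfl, b₁, ω₁, h₁⟩)
  -- The terms are positive and strictly below the supremum, so each is a real number dominated by
  -- an actual lifespan, whether or not the supremum is finite or attained.
  obtain ⟨x, hmono, hx, hlim⟩ := exists_seq_strictMono_tendsto' hpos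
  have hreal : ∀ n, ((x n).toReal : EReal) = x n := fun n =>
    EReal.coe_toReal (ne_top_of_lt (hx n).2) (ne_bot_of_gt (hx n).1)
  have hsol : ∀ n, IsLocalSolution uh f b₀ ω₀ b ω (x n).toReal := fun n => by
    obtain ⟨-, ⟨T, rfl, b', ω', h'⟩, hlt⟩ := lt_sSup_iff.1 (hx n).2
    have h1 : 0 < (x n).toReal := EReal.coe_pos.1 (by rw [hreal]; exact (hx n).1)
    have h2 : (x n).toReal ≤ T := EReal.coe_le_coe_iff.1 (by rw [hreal]; exact hlt.le)
    exact hglue _ ⟨b', ω', h'.mono huh hf h1 h2⟩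
  refine ⟨b, ω, sSup E, hpos, fun n => (x n).toReal, fun i j hij => ?_, ?_, hsol, fun htop => ?_⟩
  · exact EReal.coe_lt_coe_iff.1 (by rw [hreal, hreal]; exact hmono hij)
  · simpa only [hreal] using hlim
  · by_contra hne
    obtain ⟨M, hM⟩ := exists_eventually_normM_le hne
    obtain ⟨τ, hτ, hext⟩ := exists_extension huh hf b₀ ω₀ M
    lift sSup E to ℝ using ⟨htop.ne, ne_bot_of_gt hpos⟩ with S hS
    have h1 : ∀ᶠ n in atTop, ((S - τ : ℝ) : EReal) < x n :=
      hlim.eventually (lt_mem_nhds (EReal.coe_lt_coe_iff.2 (by linarith)))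
    obtain ⟨n, hn, hn'⟩ := (h1.and hM).exists
    have h2 : (((x n).toReal + τ : ℝ) : EReal) ≤ S := by
      rw [hS]
      exact le_sSup ⟨_, rfl, hext b ω _ (hsol n) hn'⟩
    have h3 := EReal.coe_le_coe_iff.1 h2
    rw [← hreal n] at hn
    have h4 := EReal.coe_lt_coe_iff.1 hn
    linarith

end Maximal

end TQG

theorem mainTheorem1 (L : ℝ) [Fact (0 < L)]
    (uh : Fin 2 → TQG.L2 L) (f b₀ ω₀ : TQG.L2 L)
    (huh : TQG.MemSobolevDiv 3 uh) (hf : TQG.MemSobolev 2 f)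
    (hb₀ : TQG.MemSobolev 3 b₀) (hω₀ : TQG.MemSobolev 2 ω₀) :
    ∃ (b ω : ℝ → TQG.L2 L) (Tmax : EReal),
      TQG.IsMaximalSolution uh f b₀ ω₀ b ω Tmax ∧
      ∀ (b' ω' : ℝ → TQG.L2 L) (Tmax' : EReal),
        TQG.IsMaximalSolution uh f b₀ ω₀ b' ω' Tmax' →
          Tmax' = Tmax ∧
          ∀ t : ℝ, 0 ≤ t → (t : EReal) < Tmax → b' t = b t ∧ ω' t = ω t := by
  obtain ⟨b, ω, Tmax, h⟩ := TQG.exists_isMaximalSolution huh hf hb₀ hω₀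
  refine ⟨b, ω, Tmax, h, fun b' ω' Tmax' h' => ?_⟩
  obtain rfl : Tmax' = Tmax := le_antisymm (h'.le huh hf h) (h.le huh hf h')
  exact ⟨rfl, fun t ht htT => h'.eq_of_lt huh hf h ht htT⟩
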